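/- Let $(X,d)$ be a compact metric space and $\mu$ a Borel probability measure on $X$ with $\mu(U)>0$ for every non-empty open set $U$. Let $(\mathcal E,\operatorname{Dom}\mathcal E)$ be a symmetric, regular, strictly local Dirichlet form on $L^2(X,\mu)$ (strictly local: $\mathcal E(u,v)=0$ whenever $v$ is constant on a neighbourhood of the support of $u$) which admits a carré du champ $\Gamma$, and write $\Gamma(f)=\Gamma(f,f)$. Let $\Delta\le 0$ be its generator and $P_t=e^{t\Delta}$ its heat semigroup. Let $\mathcal H$ be the Hilbert space of $L^2$ one-forms, i.e. the completion, after factoring out elements of norm zero, of $(C(X)\cap\operatorname{Dom}\mathcal E)\otimes\mathcal B_b(X)$ ($\mathcal B_b(X)$ being the bounded Borel functions) for the inner product $$\langle f_1\otimes g_1,f_2\otimes g_2\rangle_{\mathcal H}=\int_X g_1g_2\,\Gamma(f_1,f_2)\,d\mu ,$$ let $\|\eta\|_{\mathcal H_x}$ be the corresponding fibrewise norm, so that $\|\eta\|_{\mathcal H}^2=\int_X\|\eta\|_{\mathcal H_x}^2\,d\mu(x)$, let $\partial:\operatorname{Dom}\mathcal E\to\mathcal H$ be the closure of $f\mapsto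 f\otimes\mathbf 1$, let $\partial^*$ be its adjoint, and put $\vec\Delta=-\partial\partial^*$. Let $C_1\ge 1$. Assume the semigroup domination $$\|e^{t\vec\Delta}\eta\|_{\mathcal H_x}\le C_1\,(P_t\|\eta\|_{\mathcal H_\cdot})(x)\quad\text{for }\mu\text{-a.e. }x,\qquad \eta\in\mathcal H,\ 0\le t\le 1,$$ and the weak Bakry–Émery estimate (with $C_2=0$) $$\sqrt{\Gamma(P_tf)}\le C_1\,P_t\sqrt{\Gamma(f)}\quad\mu\text{-a.e.},\qquad f\in\operatorname{Dom}\mathcal E,\ t\ge 0.$$ Assume also that $\mathcal E$ satisfies a spectral gap inequality: there is $\lambda>0$ with $$\int_X\Big(f-\int_X f\,d\mu\Big)^2d\mu\le\frac1\lambda\,\mathcal E(f,f),\qquad f\in\operatorname{Dom}\mathcal E,$$ and let the spectral gap $\lambda_1\in(0,\infty]$ be the supremum of all such $\lambda$. For a Borel set $A\subset X$ let $$P(A)=\operatorname{Var}\mathbf 1_A=\sup\{\langle \mathbf 1_A,\partial^*\eta\rangle_{L^2}\;:\;\eta\in\operatorname{Dom}\partial^*,\ \|\eta\|_{\mathcal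 H_x}\le 1\ \text{for }\mu\text{-a.e. }x\}\in[0,\infty]$$ be its perimeter, and let $$h=\inf\Big\{\frac{P(A)}{\mu(A)}\;:\;A\subset X\text{ Borel},\ P(A)<\infty,\ 0<\mu(A)\le\tfrac12\Big\}\in[0,\infty]$$ be the Cheeger constant of $X$ (with $\inf\emptyset=\infty$). Then $$\lambda_1\le C_{\mathrm{buser}}\,h^2\qquad\text{with}\qquad C_{\mathrm{buser}}=\frac{2\,C_1^6}{(1-e^{-1})^2},$$ a constant depending on $C_1$ only; equivalently $h^2\ge\frac{(1-e^{-1})^2}{2C_1^6}\,\lambda_1$. -/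

import Mathlib

open MeasureTheory Filter Topology
open scoped ENNReal NNReal TensorProduct LinearPMap

noncomputable section

/-! ### Dirichlet forms -/

/-- A symmetric Dirichlet form on `L²(X, μ)`: a densely defined, symmetric, nonnegative bilinear
form that is closed and Markovian. -/
structure DirichletForm {X : Type*} [MeasurableSpace X] (μ : Measure X) where
  /-- the domain `Dom ℰ` -/
  domain : Submodule ℝ (Lp ℝ 2 μ)
  /-- the form `ℰ(u, v)` for `u, v ∈ Dom ℰ` -/
  form : domain →ₗ[ℝ] domain →ₗ[ℝ] ℝ
  dense : Dense (domain : Set (Lp ℝ 2 μ))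
  symm : ∀ u v, form u v = form v u
  nonneg : ∀ u, 0 ≤ form u u
  /-- `Dom ℰ` is complete for the norm `(ℰ(u, u) + ‖u‖₂²)^{1/2}`. -/
  closed : ∀ u : ℕ → domain,
    (∀ ε > 0, ∃ N, ∀ m ≥ N, ∀ n ≥ N,
      form (u m - u n) (u m - u n) + ‖(u m : Lp ℝ 2 μ) - u n‖ ^ 2 < ε) →
    ∃ v : domain, Tendsto
      (fun n => form (u n - v) (u n - v) + ‖(u n : Lp ℝ 2 μ) - v‖ ^ 2) atTop (𝓝 0)
  /-- The unit contraction `(0 ∨ u) ∧ 1` operates on `ℰ`. -/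
  markov : ∀ u : domain, ∃ v : domain,
    (∀ᵐ x ∂μ, (v : Lp ℝ 2 μ) x = min (max ((u : Lp ℝ 2 μ) x) 0) 1) ∧ form v v ≤ form u u

/-- The bounded Borel functions on `X`. -/
def boundedBorel (X : Type*) [MeasurableSpace X] : Submodule ℝ (X → ℝ) where
  carrier := {g | Measurable g ∧ ∃ M : ℝ, ∀ x, |g x| ≤ M}
  add_mem' := by
    rintro f g ⟨hf, M, hM⟩ ⟨hg, N, hN⟩
    exact ⟨hf.add hg, M + N, fun x => (abs_add_le _ _).trans (add_le_add (hM x) (hN x))⟩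
  zero_mem' := ⟨measurable_const, 0, fun x => by simp⟩
  smul_mem' := by
    rintro c f ⟨hf, M, hM⟩
    refine ⟨hf.const_smul c, |c| * M, fun x => ?_⟩
    simp only [Pi.smul_apply, smul_eq_mul, abs_mul]
    exact mul_le_mul_of_nonneg_left (hM x) (abs_nonneg c)

/-- The class modulo `μ` of a bounded Borel function. -/
def boundedBorel.toAE {X : Type*} [MeasurableSpace X] (μ : Measure X) :
    boundedBorel X →ₗ[ℝ] (X →ₘ[μ] ℝ) where
  toFun g := AEEqFun.mk g.1 g.2.1.aestronglyMeasurable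
  map_add' _ _ := rfl
  map_smul' _ _ := rfl

/-- Pointwise multiplication of classes of functions, as a bilinear map. -/
def aeMul {X : Type*} [MeasurableSpace X] (μ : Measure X) :
    (X →ₘ[μ] ℝ) →ₗ[ℝ] (X →ₘ[μ] ℝ) →ₗ[ℝ] (X →ₘ[μ] ℝ) :=
  LinearMap.mk₂ ℝ (fun f g => f * g)
    (fun f g h => by
      apply AEEqFun.ext
      filter_upwards [AEEqFun.coeFn_mul (f + g) h, AEEqFun.coeFn_add f g,
        AEEqFun.coeFn_add (f * h) (g * h), AEEqFun.coeFn_mul f h, AEEqFun.coeFn_mul g h]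
        with x h1 h2 h3 h4 h5
      simp [h1, h2, h3, h4, h5, add_mul])
    (fun c f g => by
      apply AEEqFun.ext
      filter_upwards [AEEqFun.coeFn_mul (c • f) g, AEEqFun.coeFn_smul c f,
        AEEqFun.coeFn_smul c (f * g), AEEqFun.coeFn_mul f g] with x h1 h2 h3 h4
      simp [h1, h2, h3, h4, mul_assoc])
    (fun f g h => by
      apply AEEqFun.ext
      filter_upwards [AEEqFun.coeFn_mul f (g + h), AEEqFun.coeFn_add g h,
        AEEqFun.coeFn_add (f * g) (f * h), AEEqFun.coeFn_mul f g, AEEqFun.coeFn_mul f h]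
        with x h1 h2 h3 h4 h5
      simp [h1, h2, h3, h4, h5, mul_add])
    (fun c f g => by
      apply AEEqFun.ext
      filter_upwards [AEEqFun.coeFn_mul f (c • g), AEEqFun.coeFn_smul c g,
        AEEqFun.coeFn_smul c (f * g), AEEqFun.coeFn_mul f g] with x h1 h2 h3 h4
      simp [h1, h2, h3, h4, mul_left_comm])

namespace DirichletForm

variable {X : Type*} [MeasurableSpace X] {μ : Measure X}

/-- `𝒞 = C(X) ∩ Dom ℰ` for a compact space `X`. -/
def core [MetricSpace X] [CompactSpace X] [BorelSpace X] [IsFiniteMeasure μ]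
    (E : DirichletForm μ) : Submodule ℝ C(X, ℝ) :=
  E.domain.comap (ContinuousMap.toLp 2 μ ℝ : C(X, ℝ) →L[ℝ] Lp ℝ 2 μ).toLinearMap

/-- An element of `𝒞`, seen in `Dom ℰ`. -/
def coreToDomain [MetricSpace X] [CompactSpace X] [BorelSpace X] [IsFiniteMeasure μ]
    (E : DirichletForm μ) : E.core →ₗ[ℝ] E.domain :=
  ((ContinuousMap.toLp 2 μ ℝ : C(X, ℝ) →L[ℝ] Lp ℝ 2 μ).toLinearMap).restrict fun _ h => h

/-- Regularity (on a compact space): `𝒞` is dense in `Dom ℰ` for the norm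
`(ℰ(u, u) + ‖u‖₂²)^{1/2}` and dense in `C(X)` for the uniform norm. -/
structure IsRegular [MetricSpace X] [CompactSpace X] [BorelSpace X] [IsFiniteMeasure μ]
    (E : DirichletForm μ) : Prop where
  dense_domain : ∀ (u : E.domain), ∀ ε > 0, ∃ φ : E.core,
    E.form (u - E.coreToDomain φ) (u - E.coreToDomain φ)
      + ‖(u : Lp ℝ 2 μ) - E.coreToDomain φ‖ ^ 2 < ε
  dense_continuous : Dense (E.core : Set C(X, ℝ))

/-- Strict (also called strong) locality: `ℰ(u, v) = 0` if `v` is constant on a neighbourhood `U`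
of the support of `u`. All supports are compact since `X` is. -/
def IsStrictlyLocal [TopologicalSpace X] (E : DirichletForm μ) : Prop :=
  ∀ (u v : E.domain) (K U : Set X) (c : ℝ), IsClosed K → IsOpen U → K ⊆ U →
    (∀ᵐ x ∂μ, x ∉ K → (u : Lp ℝ 2 μ) x = 0) →
    (∀ᵐ x ∂μ, x ∈ U → (v : Lp ℝ 2 μ) x = c) → E.form u v = 0

/-- The element `u` of `Dom ℰ` is essentially bounded. -/
def IsBdd (E : DirichletForm μ) (u : E.domain) : Prop :=
  ∃ M : ℝ, ∀ᵐ x ∂μ, |(u : Lp ℝ 2 μ) x| ≤ M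

/-- A carré du champ for `ℰ`: a symmetric nonnegative continuous bilinear map
`Γ : Dom ℰ × Dom ℰ → L¹(μ)` with
`ℰ(fh, g) + ℰ(gh, f) - ℰ(h, fg) = 2 ∫ h Γ(f, g) dμ` for all bounded `f, g, h ∈ Dom ℰ`.
There is at most one, because bounded elements are dense in `Dom ℰ`. -/
structure CarreDuChamp (E : DirichletForm μ) where
  toMap : E.domain →ₗ[ℝ] E.domain →ₗ[ℝ] (X →ₘ[μ] ℝ)
  integrable : ∀ f g, Integrable (toMap f g) μ
  symm : ∀ f g, toMap f g = toMap g f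
  nonneg : ∀ f, ∀ᵐ x ∂μ, 0 ≤ toMap f f x
  /-- continuity for the norm `(ℰ(f, f) + ‖f‖₂²)^{1/2}` on `Dom ℰ` -/
  continuous : ∃ C : ℝ, ∀ f, ∫ x, toMap f f x ∂μ ≤ C * (E.form f f + ‖(f : Lp ℝ 2 μ)‖ ^ 2)
  formula : ∀ f g h fg fh gh : E.domain, E.IsBdd f → E.IsBdd g → E.IsBdd h →
    (∀ᵐ x ∂μ, (fg : Lp ℝ 2 μ) x = (f : Lp ℝ 2 μ) x * (g : Lp ℝ 2 μ) x) →
    (∀ᵐ x ∂μ, (fh : Lp ℝ 2 μ) x = (f : Lp ℝ 2 μ) x * (h : Lp ℝ 2 μ) x) →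
    (∀ᵐ x ∂μ, (gh : Lp ℝ 2 μ) x = (g : Lp ℝ 2 μ) x * (h : Lp ℝ 2 μ) x) →
    E.form fh g + E.form gh f - E.form h fg = 2 * ∫ x, (h : Lp ℝ 2 μ) x * toMap f g x ∂μ

/-- The graph of the generator `Δ ≤ 0` of `ℰ`: `u ∈ Dom Δ` and `Δ u = w` iff `u ∈ Dom ℰ` and
`ℰ(u, φ) = -⟨w, φ⟩` for all `φ ∈ Dom ℰ`. -/
def generator (E : DirichletForm μ) : Set (Lp ℝ 2 μ × Lp ℝ 2 μ) :=
  {p | ∃ u : E.domain, (u : Lp ℝ 2 μ) = p.1 ∧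
    ∀ φ : E.domain, E.form u φ = -inner ℝ p.2 (φ : Lp ℝ 2 μ)}

end DirichletForm

/-! ### Semigroups -/

/-- `S` is a strongly continuous semigroup of bounded operators whose generator is the operator
with graph `A`. -/
structure IsSemigroupGeneratedBy {H : Type*} [NormedAddCommGroup H] [NormedSpace ℝ H]
    (A : Set (H × H)) (S : ℝ≥0 → H →L[ℝ] H) : Prop where
  zero : S 0 = ContinuousLinearMap.id ℝ H
  add : ∀ s t, S (s + t) = (S s).comp (S t)
  continuous : ∀ u, Tendsto (fun t => S t u) (𝓝 0) (𝓝 u)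
  generator : ∀ u w, (u, w) ∈ A ↔
    Tendsto (fun t : ℝ≥0 => (t : ℝ)⁻¹ • (S t u - u)) (𝓝[>] 0) (𝓝 w)

/-- The semigroup `e^{tA}`: the strongly continuous semigroup generated by `A`. It is unique, and
it exists for instance if `A` is self-adjoint and nonpositive. -/
def expSemigroup {H : Type*} [NormedAddCommGroup H] [NormedSpace ℝ H] (A : Set (H × H)) :
    ℝ≥0 → H →L[ℝ] H :=
  Classical.epsilon (IsSemigroupGeneratedBy A)

/-- The heat semigroup `P_t = e^{tΔ}` on `L²(X, μ)`. -/
def DirichletForm.heat {X : Type*} [MeasurableSpace X] {μ : Measure X} (E : DirichletForm μ) :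
    ℝ≥0 → Lp ℝ 2 μ →L[ℝ] Lp ℝ 2 μ :=
  expSemigroup E.generator

/-! ### Differential one-forms -/

namespace DirichletForm.CarreDuChamp

variable {X : Type*} [MeasurableSpace X] {μ : Measure X} {E : DirichletForm μ}

/-- `√Γ(f)`, an element of `L²(X, μ)`. -/
def sqrtGamma (Γ : E.CarreDuChamp) (f : E.domain) : Lp ℝ 2 μ :=
  MemLp.toLp (fun x => √(Γ.toMap f f x)) (by
    have hm : AEStronglyMeasurable (fun x => √(Γ.toMap f f x)) μ :=
      Real.continuous_sqrt.comp_aestronglyMeasurable (Γ.integrable f f).aestronglyMeasurable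
    refine (memLp_two_iff_integrable_sq hm).2 ((Γ.integrable f f).congr ?_)
    filter_upwards [Γ.nonneg f] with x hx
    exact (Real.sq_sqrt hx).symm)

variable [MetricSpace X] [CompactSpace X] [BorelSpace X] [IsProbabilityMeasure μ]

/-- The algebraic tensor product `𝒞 ⊗ 𝓑_b(X)`. -/
def PreForm (_Γ : E.CarreDuChamp) : Type _ := E.core ⊗[ℝ] boundedBorel X

instance (Γ : E.CarreDuChamp) : AddCommGroup Γ.PreForm :=
  inferInstanceAs (AddCommGroup (E.core ⊗[ℝ] boundedBorel X))

instance (Γ : E.CarreDuChamp) : Module ℝ Γ.PreForm :=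
  inferInstanceAs (Module ℝ (E.core ⊗[ℝ] boundedBorel X))

/-- The simple tensor `f ⊗ g`. -/
def tmul (Γ : E.CarreDuChamp) (f : E.core) (g : boundedBorel X) : Γ.PreForm :=
  (f ⊗ₜ[ℝ] g : E.core ⊗[ℝ] boundedBorel X)

/-- The fibrewise inner product `⟨ω, ω'⟩_{ℋ_x}` on `𝒞 ⊗ 𝓑_b(X)`, the bilinear map with
`⟨f₁ ⊗ g₁, f₂ ⊗ g₂⟩_{ℋ_x} = g₁(x) g₂(x) Γ(f₁, f₂)(x)`. -/
def fiberInner (Γ : E.CarreDuChamp) : Γ.PreForm →ₗ[ℝ] Γ.PreForm →ₗ[ℝ] (X →ₘ[μ] ℝ) :=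
  LinearMap.compr₂
    (LinearMap.BilinMap.tmul (R := ℝ) (A := ℝ) (M₁ := E.core) (M₂ := boundedBorel X)
      (Γ.toMap.compl₁₂ E.coreToDomain E.coreToDomain)
      ((aeMul μ).compl₁₂ (boundedBorel.toAE μ) (boundedBorel.toAE μ)))
    (TensorProduct.lift (aeMul μ))

theorem fiberInner_tmul (Γ : E.CarreDuChamp) (f₁ f₂ : E.core) (g₁ g₂ : boundedBorel X) :
    Γ.fiberInner (Γ.tmul f₁ g₁) (Γ.tmul f₂ g₂) =
      Γ.toMap (E.coreToDomain f₁) (E.coreToDomain f₂) *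
        (boundedBorel.toAE μ g₁ * boundedBorel.toAE μ g₂) := rfl

theorem coeFn_fiberInner_tmul (Γ : E.CarreDuChamp) (f₁ f₂ : E.core) (g₁ g₂ : boundedBorel X) :
    ∀ᵐ x ∂μ, Γ.fiberInner (Γ.tmul f₁ g₁) (Γ.tmul f₂ g₂) x =
      (g₁.1 x * g₂.1 x) * Γ.toMap (E.coreToDomain f₁) (E.coreToDomain f₂) x := by
  rw [fiberInner_tmul]
  filter_upwards [AEEqFun.coeFn_mul (Γ.toMap (E.coreToDomain f₁) (E.coreToDomain f₂))
      (boundedBorel.toAE μ g₁ * boundedBorel.toAE μ g₂),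
    AEEqFun.coeFn_mul (boundedBorel.toAE μ g₁) (boundedBorel.toAE μ g₂),
    AEEqFun.coeFn_mk g₁.1 (μ := μ) g₁.2.1.aestronglyMeasurable,
    AEEqFun.coeFn_mk g₂.1 (μ := μ) g₂.2.1.aestronglyMeasurable] with x h1 h2 h3 h4
  rw [h1, Pi.mul_apply, h2, Pi.mul_apply, mul_comm]
  exact congrArg₂ (fun a b => a * b * _) h3 h4

theorem PreForm.exists_sum (Γ : E.CarreDuChamp) (ω : Γ.PreForm) :
    ∃ (k : ℕ) (f : Fin k → E.core) (g : Fin k → boundedBorel X), ω = ∑ i, Γ.tmul (f i) (g i) :=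
  TensorProduct.exists_sum_tmul_eq ω

theorem PreForm.induction (Γ : E.CarreDuChamp) {p : Γ.PreForm → Prop} (ω : Γ.PreForm)
    (h0 : p 0) (h1 : ∀ f g, p (Γ.tmul f g)) (h2 : ∀ a b, p a → p b → p (a + b)) : p ω :=
  TensorProduct.induction_on ω h0 h1 h2

theorem integrable_fiberInner (Γ : E.CarreDuChamp) (ω ω' : Γ.PreForm) :
    Integrable (Γ.fiberInner ω ω') μ := by
  refine PreForm.induction Γ (p := fun ω => Integrable (Γ.fiberInner ω ω') μ) ω ?_
    (fun f g => ?_) (fun a b ha hb => ?_)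
  · rw [map_zero, LinearMap.zero_apply]
    exact (integrable_zero X ℝ μ).congr AEEqFun.coeFn_zero.symm
  · refine PreForm.induction Γ (p := fun ω' => Integrable (Γ.fiberInner (Γ.tmul f g) ω') μ) ω' ?_
      (fun f' g' => ?_) (fun a b ha hb => ?_)
    · rw [map_zero]
      exact (integrable_zero X ℝ μ).congr AEEqFun.coeFn_zero.symm
    · obtain ⟨M, hM⟩ := g.2.2
      obtain ⟨N, hN⟩ := g'.2.2
      have h : Integrable (fun x => (g.1 x * g'.1 x) *
          Γ.toMap (E.coreToDomain f) (E.coreToDomain f') x) μ := by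
        refine (Γ.integrable _ _).bdd_mul (c := M * N)
          (g.2.1.mul g'.2.1).aestronglyMeasurable (ae_of_all _ fun x => ?_)
        rw [norm_mul]
        exact mul_le_mul (hM x) (hN x) (norm_nonneg _) ((abs_nonneg _).trans (hM x))
      refine h.congr ?_
      filter_upwards [Γ.coeFn_fiberInner_tmul f f' g g'] with x hx
      exact hx.symm
    · rw [map_add]
      exact (ha.add hb).congr (AEEqFun.coeFn_add _ _).symm
  · rw [map_add, LinearMap.add_apply]
    exact (ha.add hb).congr (AEEqFun.coeFn_add _ _).symm

theorem fiberInner_symm (Γ : E.CarreDuChamp) (ω ω' : Γ.PreForm) :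
    Γ.fiberInner ω ω' = Γ.fiberInner ω' ω := by
  refine PreForm.induction Γ (p := fun ω => Γ.fiberInner ω ω' = Γ.fiberInner ω' ω) ω (by simp)
    (fun f g => ?_) (fun a b ha hb => by simp [ha, hb])
  refine PreForm.induction Γ
    (p := fun ω' => Γ.fiberInner (Γ.tmul f g) ω' = Γ.fiberInner ω' (Γ.tmul f g)) ω' (by simp)
    (fun f' g' => ?_) (fun a b ha hb => by simp [ha, hb])
  rw [fiberInner_tmul, fiberInner_tmul, Γ.symm, mul_comm (boundedBorel.toAE μ g)]

theorem fiberInner_nonneg (Γ : E.CarreDuChamp) (ω : Γ.PreForm) :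
    ∀ᵐ x ∂μ, 0 ≤ Γ.fiberInner ω ω x := by
  obtain ⟨k, f, g, rfl⟩ := PreForm.exists_sum Γ ω
  have hsum : ∀ {ι : Type} (s : Finset ι) (F : ι → (X →ₘ[μ] ℝ)),
      ∀ᵐ x ∂μ, (∑ i ∈ s, F i : X →ₘ[μ] ℝ) x = ∑ i ∈ s, F i x := by
    intro ι s F
    classical
    induction s using Finset.induction_on with
    | empty => simp only [Finset.sum_empty]; exact AEEqFun.coeFn_zero
    | insert a s ha ih =>
      rw [Finset.sum_insert ha]
      filter_upwards [AEEqFun.coeFn_add (F a) (∑ i ∈ s, F i), ih] with x h1 h2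
      rw [h1, Pi.add_apply, h2, Finset.sum_insert ha]
  have hsmul : ∀ (q : Fin k → ℚ) (i j : Fin k), ∀ᵐ x ∂μ,
      ((q i : ℝ) • ((q j : ℝ) • Γ.toMap (E.coreToDomain (f i)) (E.coreToDomain (f j)))) x
        = q i * q j * Γ.toMap (E.coreToDomain (f i)) (E.coreToDomain (f j)) x := by
    intro q i j
    filter_upwards [AEEqFun.coeFn_smul (q i : ℝ)
      ((q j : ℝ) • Γ.toMap (E.coreToDomain (f i)) (E.coreToDomain (f j))),
      AEEqFun.coeFn_smul (q j : ℝ) (Γ.toMap (E.coreToDomain (f i)) (E.coreToDomain (f j)))]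
      with x h1 h2
    rw [h1, Pi.smul_apply, h2, Pi.smul_apply, smul_eq_mul, smul_eq_mul, mul_assoc]
  have hrat : ∀ᵐ x ∂μ, ∀ q : Fin k → ℚ, 0 ≤ ∑ i, ∑ j, (q i * q j : ℝ) *
      Γ.toMap (E.coreToDomain (f i)) (E.coreToDomain (f j)) x := by
    rw [ae_all_iff]
    intro q
    have h := Γ.nonneg (∑ i, (q i : ℝ) • E.coreToDomain (f i))
    have he : Γ.toMap (∑ i, (q i : ℝ) • E.coreToDomain (f i))
        (∑ i, (q i : ℝ) • E.coreToDomain (f i)) = ∑ i, ∑ j, (q i : ℝ) • ((q j : ℝ) •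
          Γ.toMap (E.coreToDomain (f i)) (E.coreToDomain (f j))) := by
      simp only [map_sum, LinearMap.sum_apply, map_smul, LinearMap.smul_apply, Finset.smul_sum]
      rw [Finset.sum_comm]
      exact Finset.sum_congr rfl fun i _ => Finset.sum_congr rfl fun j _ => smul_comm _ _ _
    rw [he] at h
    have h2 : ∀ᵐ x ∂μ, ∀ i j, ((q i : ℝ) • ((q j : ℝ) •
        Γ.toMap (E.coreToDomain (f i)) (E.coreToDomain (f j)))) x
          = q i * q j * Γ.toMap (E.coreToDomain (f i)) (E.coreToDomain (f j)) x := by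
      rw [ae_all_iff]; intro i; rw [ae_all_iff]; intro j; exact hsmul q i j
    have h3 : ∀ᵐ x ∂μ, ∀ i, (∑ j, (q i : ℝ) • ((q j : ℝ) •
        Γ.toMap (E.coreToDomain (f i)) (E.coreToDomain (f j))) : X →ₘ[μ] ℝ) x
          = ∑ j, ((q i : ℝ) • ((q j : ℝ) •
        Γ.toMap (E.coreToDomain (f i)) (E.coreToDomain (f j)))) x := by
      rw [ae_all_iff]; intro i; exact hsum _ _
    filter_upwards [h, h2, h3, hsum Finset.univ fun i => ∑ j, (q i : ℝ) • ((q j : ℝ) •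
      Γ.toMap (E.coreToDomain (f i)) (E.coreToDomain (f j)))] with x k1 k2 k3 k4
    rw [k4] at k1
    simpa only [k3, k2] using k1
  have hform : ∀ᵐ x ∂μ, Γ.fiberInner (∑ i, Γ.tmul (f i) (g i)) (∑ i, Γ.tmul (f i) (g i)) x
      = ∑ i, ∑ j, ((g i).1 x * (g j).1 x) *
        Γ.toMap (E.coreToDomain (f i)) (E.coreToDomain (f j)) x := by
    have he : Γ.fiberInner (∑ i, Γ.tmul (f i) (g i)) (∑ i, Γ.tmul (f i) (g i)) =
        ∑ i, ∑ j, Γ.fiberInner (Γ.tmul (f i) (g i)) (Γ.tmul (f j) (g j)) := by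
      simp only [map_sum, LinearMap.sum_apply]
      exact Finset.sum_comm
    rw [he]
    have h3 : ∀ᵐ x ∂μ, ∀ i, (∑ j, Γ.fiberInner (Γ.tmul (f i) (g i)) (Γ.tmul (f j) (g j)) :
        X →ₘ[μ] ℝ) x = ∑ j, Γ.fiberInner (Γ.tmul (f i) (g i)) (Γ.tmul (f j) (g j)) x := by
      rw [ae_all_iff]; intro i; exact hsum _ _
    have h4 : ∀ᵐ x ∂μ, ∀ i j, Γ.fiberInner (Γ.tmul (f i) (g i)) (Γ.tmul (f j) (g j)) x =
        ((g i).1 x * (g j).1 x) *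
          Γ.toMap (E.coreToDomain (f i)) (E.coreToDomain (f j)) x := by
      rw [ae_all_iff]; intro i; rw [ae_all_iff]; intro j
      exact Γ.coeFn_fiberInner_tmul _ _ _ _
    filter_upwards [h3, h4, hsum Finset.univ fun i =>
      ∑ j, Γ.fiberInner (Γ.tmul (f i) (g i)) (Γ.tmul (f j) (g j))] with x k1 k2 k3
    rw [k3]
    simp only [k1, k2]
  filter_upwards [hrat, hform] with x hx hy
  rw [hy]
  set G : Fin k → Fin k → ℝ := fun i j =>
    Γ.toMap (E.coreToDomain (f i)) (E.coreToDomain (f j)) x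
  have hclosed : IsClosed {v : Fin k → ℝ | 0 ≤ ∑ i, ∑ j, (v i * v j) * G i j} :=
    isClosed_le continuous_const (by fun_prop)
  have hd : DenseRange (fun (q : Fin k → ℚ) (i : Fin k) => (q i : ℝ)) :=
    DenseRange.piMap fun _ => Rat.denseRange_cast
  have := hclosed.closure_subset_iff.2 (Set.range_subset_iff.2 fun q => hx q)
  exact this (hd fun i => (g i).1 x)

/-- The semi-inner product `⟨ω, ω'⟩_ℋ = ∫ ⟨ω, ω'⟩_{ℋ_x} dμ(x)` on `𝒞 ⊗ 𝓑_b(X)`. -/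
abbrev preCore (Γ : E.CarreDuChamp) : PreInnerProductSpace.Core ℝ Γ.PreForm where
  inner ω ω' := ∫ x, Γ.fiberInner ω ω' x ∂μ
  conj_inner_symm ω ω' := by simp [Γ.fiberInner_symm ω ω']
  re_inner_nonneg ω := integral_nonneg_of_ae (Γ.fiberInner_nonneg ω)
  add_left a b c := by
    rw [map_add, LinearMap.add_apply, integral_congr_ae (AEEqFun.coeFn_add _ _)]
    exact integral_add (Γ.integrable_fiberInner a c) (Γ.integrable_fiberInner b c)
  smul_left a b r := by
    rw [map_smul, LinearMap.smul_apply, integral_congr_ae (AEEqFun.coeFn_smul _ _)]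
    exact integral_const_mul r _

instance (Γ : E.CarreDuChamp) : SeminormedAddCommGroup Γ.PreForm :=
  @InnerProductSpace.Core.toSeminormedAddCommGroup ℝ _ _ _ _ Γ.preCore

instance (Γ : E.CarreDuChamp) : InnerProductSpace ℝ Γ.PreForm :=
  InnerProductSpace.ofCore Γ.preCore

/-- The Hilbert space `ℋ` of `L²` differential one-forms: the completion of `𝒞 ⊗ 𝓑_b(X)`, after
factoring out the elements of seminorm zero. -/
abbrev OneForm (Γ : E.CarreDuChamp) : Type _ := UniformSpace.Completion Γ.PreForm

theorem memLp_preFiberNorm (Γ : E.CarreDuChamp) (ω : Γ.PreForm) :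
    MemLp (fun x => √(Γ.fiberInner ω ω x)) 2 μ := by
  have hm : AEStronglyMeasurable (fun x => √(Γ.fiberInner ω ω x)) μ :=
    Real.continuous_sqrt.comp_aestronglyMeasurable
      (Γ.integrable_fiberInner ω ω).aestronglyMeasurable
  refine (memLp_two_iff_integrable_sq hm).2 ((Γ.integrable_fiberInner ω ω).congr ?_)
  filter_upwards [Γ.fiberInner_nonneg ω] with x hx
  exact (Real.sq_sqrt hx).symm

/-- The fibrewise norm `‖ω‖_{ℋ_x}` of `ω ∈ 𝒞 ⊗ 𝓑_b(X)`, as an element of `L²(X, μ)`. -/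
def preFiberNorm (Γ : E.CarreDuChamp) (ω : Γ.PreForm) : Lp ℝ 2 μ :=
  (Γ.memLp_preFiberNorm ω).toLp

theorem coeFn_fiberInner_add_smul (Γ : E.CarreDuChamp) (ω ω' : Γ.PreForm) (q : ℝ) :
    ∀ᵐ x ∂μ, Γ.fiberInner (ω + q • ω') (ω + q • ω') x =
      Γ.fiberInner ω ω x + 2 * q * Γ.fiberInner ω ω' x + q ^ 2 * Γ.fiberInner ω' ω' x := by
  have he : Γ.fiberInner (ω + q • ω') (ω + q • ω') =
      Γ.fiberInner ω ω + ((2 * q) • Γ.fiberInner ω ω' + (q ^ 2) • Γ.fiberInner ω' ω') := by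
    simp only [map_add, map_smul, LinearMap.add_apply, LinearMap.smul_apply,
      Γ.fiberInner_symm ω' ω]
    module
  rw [he]
  filter_upwards [AEEqFun.coeFn_add (Γ.fiberInner ω ω)
      ((2 * q) • Γ.fiberInner ω ω' + (q ^ 2) • Γ.fiberInner ω' ω'),
    AEEqFun.coeFn_add ((2 * q) • Γ.fiberInner ω ω') ((q ^ 2) • Γ.fiberInner ω' ω'),
    AEEqFun.coeFn_smul (2 * q) (Γ.fiberInner ω ω'),
    AEEqFun.coeFn_smul (q ^ 2) (Γ.fiberInner ω' ω')] with x h1 h2 h3 h4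
  rw [h1, Pi.add_apply, h2, Pi.add_apply, h3, h4, Pi.smul_apply, Pi.smul_apply, smul_eq_mul,
    smul_eq_mul, add_assoc]

theorem lipschitz_preFiberNorm (Γ : E.CarreDuChamp) : LipschitzWith 1 Γ.preFiberNorm := by
  have hnorm : ∀ ω : Γ.PreForm, ‖ω‖ ^ 2 = ∫ x, Γ.fiberInner ω ω x ∂μ := fun ω =>
    (real_inner_self_eq_norm_sq ω).symm
  refine LipschitzWith.of_dist_le_mul fun ω ω' => ?_
  rw [NNReal.coe_one, one_mul, dist_eq_norm, dist_eq_norm]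
  refine le_of_sq_le_sq ?_ (norm_nonneg _)
  rw [hnorm, ← real_inner_self_eq_norm_sq, L2.inner_def]
  refine integral_mono_ae (L2.integrable_inner _ _) (Γ.integrable_fiberInner _ _) ?_
  have hpoly : ∀ᵐ x ∂μ, ∀ q : ℚ, Γ.fiberInner (ω + (q : ℝ) • ω') (ω + (q : ℝ) • ω') x =
      Γ.fiberInner ω ω x + 2 * q * Γ.fiberInner ω ω' x + q ^ 2 * Γ.fiberInner ω' ω' x := by
    rw [ae_all_iff]
    exact fun q => Γ.coeFn_fiberInner_add_smul ω ω' q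
  have hpos : ∀ᵐ x ∂μ, ∀ q : ℚ,
      0 ≤ Γ.fiberInner (ω + (q : ℝ) • ω') (ω + (q : ℝ) • ω') x := by
    rw [ae_all_iff]
    exact fun q => Γ.fiberInner_nonneg _
  filter_upwards [hpoly, hpos, Γ.fiberInner_nonneg ω, Γ.fiberInner_nonneg ω',
    Lp.coeFn_sub (Γ.preFiberNorm ω) (Γ.preFiberNorm ω'),
    MemLp.coeFn_toLp (Γ.memLp_preFiberNorm ω), MemLp.coeFn_toLp (Γ.memLp_preFiberNorm ω')]
    with x h1 h2 ha hb h3 h4 h5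
  have hm := h1 (-1)
  rw [show ω + ((-1 : ℚ) : ℝ) • ω' = ω - ω' by push_cast; rw [neg_one_smul, sub_eq_add_neg]] at hm
  have e4 : Γ.preFiberNorm ω x = √(Γ.fiberInner ω ω x) := h4
  have e5 : Γ.preFiberNorm ω' x = √(Γ.fiberInner ω' ω' x) := h5
  rw [hm, h3, Pi.sub_apply, e4, e5]
  generalize Γ.fiberInner ω ω x = a at *
  generalize Γ.fiberInner ω' ω' x = b at *
  generalize Γ.fiberInner ω ω' x = m at *
  have hq : ∀ t : ℝ, 0 ≤ b * (t * t) + 2 * m * t + a := by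
    intro t
    have hc : IsClosed {t : ℝ | 0 ≤ b * (t * t) + 2 * m * t + a} :=
      isClosed_le continuous_const (by fun_prop)
    have hr : ∀ q : ℚ, (q : ℝ) ∈ {t : ℝ | 0 ≤ b * (t * t) + 2 * m * t + a} := by
      intro q
      have h := h2 q
      rw [h1 q] at h
      rw [Set.mem_ofPred_eq]
      linarith
    have := hc.closure_subset_iff.2 (Set.range_subset_iff.2 hr)
    exact this (Rat.denseRange_cast t)
  have hdis := discrim_le_zero hq
  rw [discrim] at hdis
  have hle : m ≤ √a * √b := by
    rw [← Real.sqrt_mul ha]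
    exact Real.le_sqrt_of_sq_le (by nlinarith)
  have sa := Real.sq_sqrt ha
  have sb := Real.sq_sqrt hb
  simp only [real_inner_self_eq_norm_sq, Real.norm_eq_abs, sq_abs]
  push_cast
  nlinarith

/-- The fibrewise norm `‖η‖_{ℋ_x}` of a one-form `η ∈ ℋ`, as an element of `L²(X, μ)`: the
continuous extension of the fibrewise norm on `𝒞 ⊗ 𝓑_b(X)`. -/
def fiberNorm (Γ : E.CarreDuChamp) : Γ.OneForm → Lp ℝ 2 μ :=
  UniformSpace.Completion.extension Γ.preFiberNorm

/-- On the classes of `𝒞 ⊗ 𝓑_b(X)`, the extension is the fibrewise norm. -/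
theorem fiberNorm_coe (Γ : E.CarreDuChamp) (ω : Γ.PreForm) :
    Γ.fiberNorm (ω : Γ.OneForm) = Γ.preFiberNorm ω :=
  UniformSpace.Completion.extension_coe Γ.lipschitz_preFiberNorm.uniformContinuous ω

/-- The exterior derivative `f ↦ f ⊗ 1` on `𝒞`. -/
def preD (Γ : E.CarreDuChamp) : E.core →ₗ[ℝ] Γ.OneForm where
  toFun f := (Γ.tmul f ⟨fun _ => 1, measurable_const, 1, fun _ => by simp⟩ : Γ.PreForm)
  map_add' f g := by
    rw [← UniformSpace.Completion.coe_add]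
    exact congrArg _ (TensorProduct.add_tmul f g _)
  map_smul' c f := by
    rw [RingHom.id_apply, ← UniformSpace.Completion.coe_smul]
    rfl

/-- The exterior derivative `∂ : Dom ℰ ⊆ L²(X, μ) → ℋ`: the closure of `f ↦ f ⊗ 1` on `𝒞`. -/
def extDeriv (Γ : E.CarreDuChamp) : Lp ℝ 2 μ →ₗ.[ℝ] Γ.OneForm :=
  (LinearMap.range ((E.domain.subtype.comp E.coreToDomain).prod Γ.preD)).topologicalClosure.toLinearPMap

/-- The codifferential `∂*`, the adjoint of `∂`. -/
def codiff (Γ : E.CarreDuChamp) : Γ.OneForm →ₗ.[ℝ] Lp ℝ 2 μ := Γ.extDeriv†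

/-- The graph of the Laplacian `-∂ ∂*` on one-forms. -/
def formGenerator (Γ : E.CarreDuChamp) : Set (Γ.OneForm × Γ.OneForm) :=
  {p | ∃ v : Lp ℝ 2 μ, (p.1, v) ∈ Γ.codiff.graph ∧ (v, -p.2) ∈ Γ.extDeriv.graph}

/-- The semigroup on one-forms generated by `-∂ ∂*`. -/
def formHeat (Γ : E.CarreDuChamp) : ℝ≥0 → Γ.OneForm →L[ℝ] Γ.OneForm :=
  expSemigroup Γ.formGenerator

/-- The semigroup domination `‖e^{t\vec Δ} η‖_{ℋ_x} ≤ C₁ (P_t ‖η‖_{ℋ_·})(x)` for `0 ≤ t ≤ 1`. -/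
def SemigroupDomination (Γ : E.CarreDuChamp) (C₁ : ℝ) : Prop :=
  ∀ (η : Γ.OneForm) (t : ℝ≥0), t ≤ 1 →
    ∀ᵐ x ∂μ, Γ.fiberNorm (Γ.formHeat t η) x ≤ C₁ * E.heat t (Γ.fiberNorm η) x

/-- The variation
`Var f = sup {⟨f, ∂* η⟩ | η ∈ Dom ∂*, ‖η‖_{ℋ_x} ≤ 1 for μ-almost every x} ∈ [0, ∞]`. -/
def variation (Γ : E.CarreDuChamp) (f : Lp ℝ 2 μ) : ℝ≥0∞ :=
  ⨆ (η : Γ.codiff.domain) (_ : ∀ᵐ x ∂μ, Γ.fiberNorm η x ≤ 1),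
    ENNReal.ofReal (inner ℝ f (Γ.codiff η))

/-- The perimeter `P(A) = Var 1_A` of a Borel set `A`. -/
def perimeter (Γ : E.CarreDuChamp) {A : Set X} (hA : MeasurableSet A) : ℝ≥0∞ :=
  Γ.variation (indicatorConstLp 2 hA (measure_ne_top μ A) 1)

/-- Cheeger's constant `h = inf P(A) / μ(A)` over the Caccioppoli sets `A` (the Borel sets of
finite perimeter) with `0 < μ(A) ≤ 1/2`; `h = ∞` if there is none. -/
def cheeger (Γ : E.CarreDuChamp) : ℝ≥0∞ :=
  ⨅ (A : Set X) (hA : MeasurableSet A) (_ : Γ.perimeter hA < ∞) (_ : 0 < μ A) (_ : μ A ≤ 1 / 2),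
    Γ.perimeter hA / μ A

end DirichletForm.CarreDuChamp

namespace DirichletForm

variable {X : Type*} [MeasurableSpace X] {μ : Measure X}

/-- The weak Bakry–Émery estimate `√Γ(P_t f) ≤ C₁ e^{C₂ t} P_t √Γ(f)` for `f ∈ Dom ℰ`, `t ≥ 0`.
Here `g` is `P_t f`, which belongs to `Dom ℰ`. -/
def CarreDuChamp.WeakBakryEmery {E : DirichletForm μ} (Γ : E.CarreDuChamp) (C₁ C₂ : ℝ) : Prop :=
  ∀ (f : E.domain) (t : ℝ≥0) (g : E.domain), (g : Lp ℝ 2 μ) = E.heat t f →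
    ∀ᵐ x ∂μ, Γ.sqrtGamma g x ≤ C₁ * Real.exp (C₂ * t) * E.heat t (Γ.sqrtGamma f) x

/-- `∫ (f - ∫ f dμ)² dμ ≤ (1/l) ℰ(f, f)` for all `f ∈ Dom ℰ`. -/
def PoincareWith (E : DirichletForm μ) (l : ℝ) : Prop :=
  ∀ f : E.domain, ∫ x, ((f : Lp ℝ 2 μ) x - ∫ y, (f : Lp ℝ 2 μ) y ∂μ) ^ 2 ∂μ ≤ 1 / l * E.form f f

/-- `ℰ` satisfies a spectral gap inequality. -/
def SpectralGapInequality (E : DirichletForm μ) : Prop :=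
  ∃ l : ℝ, 0 < l ∧ E.PoincareWith l

/-- The spectral gap `λ₁`: the best constant in the spectral gap inequality. -/
def spectralGap (E : DirichletForm μ) : ℝ≥0∞ :=
  ⨆ (l : ℝ) (_ : 0 < l) (_ : E.PoincareWith l), ENNReal.ofReal l

end DirichletForm
end

/-! The perimeter is tested against the forms `∂ P_r g` with `|g| ≤ 1`. The weak Bakry–Émery
estimate controls their size. For `h ≥ 0` put `F(s) = ∫ P_s h (P_{t-s} g)² dμ`; then `F'(s) = 2 ∫
P_s h Γ(P_{t-s} g) dμ`. The squared estimate, Cauchy–Schwarz for `P_s` and the symmetry of `P_s`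
bound this below by `(2 / C₁²) ∫ h Γ(P_t g) dμ`. Integrating over `[0, t]` gives the reverse
Poincaré inequality `Γ(P_t g) ≤ C₁² / (2t)` (`gamma_heat_le`).

The fibre norm of `∂ P_r g` is `√Γ(P_r g)`, and `∂* ∂ P_r g = -Δ P_r g`. Hence the definition of the
variation gives `-⟨1_A, Δ P_r g⟩ ≤ C₁ P(A) / √(2r)`, which integrates to `⟨1_A, g - P_t g⟩ ≤ C₁
√(2t) P(A)` (`inner_sub_heat_le`). Take `g = 2 · 1_A - 1` and `m = μ(A)`. A Poincaré inequality with
constant `l` makes mean-zero functions decay like `e^{-lt}`, so the left side is at least `2 (m -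
m²)(1 - e^{-lt})`. With `m ≤ 1/2` and `t = 1/l` this reads `m (1 - e⁻¹) ≤ C₁ √(2/l) P(A)`. It
remains to square, and to pass to the infimum over `A` and the supremum over `l`; `C₁ ≤ C₁³` gives
the stated constant.

The rest is foundation. `expSemigroup` is an `epsilon` choice, so Hille–Yosida must supply existence
and uniqueness, and let contractivity, symmetry and positivity pass from resolvents to the
semigroup. The resolvent comes from Riesz representation in the form domain and its positivity from
a variational argument. Products of bounded elements must lie in the form domain, because `Γ` is
accessible only through its defining formula. The constant `1` lies there with zero energy, which
gives `P_t 1 = 1`. Functions outside the domain of the generator are replaced by `J n f`. -/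

noncomputable section

/-! ### The Hille–Yosida theorem -/

/-- `J n = (n + 1) (n + 1 - A)⁻¹` for a densely defined operator with graph `A` that generates
contractions. -/
structure IsResolventFamily {H : Type*} [NormedAddCommGroup H] [NormedSpace ℝ H]
    (A : Set (H × H)) (J : ℕ → H →L[ℝ] H) : Prop where
  mem : ∀ n f, (J n f, ((n : ℝ) + 1) • (J n f - f)) ∈ A
  eq : ∀ n u w, (u, w) ∈ A → J n (u - ((n : ℝ) + 1)⁻¹ • w) = u
  norm_le : ∀ n, ‖J n‖ ≤ 1
  dense : Dense {u | ∃ w, (u, w) ∈ A}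

section Yosida

variable {H : Type*} [NormedAddCommGroup H] [NormedSpace ℝ H]

/-- The Yosida approximation of a generator. -/
def yosida (J : ℕ → H →L[ℝ] H) (n : ℕ) : H →L[ℝ] H := ((n : ℝ) + 1) • (J n - 1)

/-- The semigroups generated by the Yosida approximations. -/
def yosidaExp (J : ℕ → H →L[ℝ] H) (n : ℕ) (t : ℝ) : H →L[ℝ] H := NormedSpace.exp (t • yosida J n)

variable {A : Set (H × H)} {J : ℕ → H →L[ℝ] H}

/-- The left-inverse property at the graph point over `J m f` is the resolvent identity `key`.
Adding it to its copy with `m` and `n` exchanged leaves `(n - m)` times the commutator equal to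
zero. -/
theorem IsResolventFamily.comm (h : IsResolventFamily A J) (m n : ℕ) : Commute (J m) (J n) := by
  rcases eq_or_ne m n with rfl | hmn
  · exact Commute.refl _
  have key : ∀ (m n : ℕ) (f : H), ((n : ℝ) + 1) • J m f =
      ((n : ℝ) - m) • J n (J m f) + ((m : ℝ) + 1) • J n f := by
    intro m n f
    have h1 := h.eq n _ _ (h.mem m f)
    have hn : ((n : ℝ) + 1) ≠ 0 := by positivity
    rw [map_sub, map_smul, map_smul, map_sub] at h1
    nth_rewrite 1 [← h1]
    rw [smul_sub, smul_inv_smul₀ hn]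
    module
  ext f
  have h1 := key m n f
  have h2 := key n m f
  have h3 : ((n : ℝ) - m) • (J n (J m f) - J m (J n f)) = 0 := by
    have h1' : ((n : ℝ) - m) • J n (J m f) = ((n : ℝ) + 1) • J m f - ((m : ℝ) + 1) • J n f := by
      rw [h1]; abel
    have h2' : ((m : ℝ) - n) • J m (J n f) = ((m : ℝ) + 1) • J n f - ((n : ℝ) + 1) • J m f := by
      rw [h2]; abel
    have : ((n : ℝ) - m) • (J n (J m f) - J m (J n f)) =
      ((n : ℝ) - m) • J n (J m f) + ((m : ℝ) - n) • J m (J n f) := by module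
    rw [this, h1', h2']; abel
  rcases smul_eq_zero.1 h3 with h4 | h4
  · exact absurd (by exact_mod_cast (sub_eq_zero.1 h4).symm) hmn
  · exact (sub_eq_zero.1 h4).symm

theorem IsResolventFamily.yosida_comm (h : IsResolventFamily A J) (m n : ℕ) :
    Commute (yosida J m) (yosida J n) :=
  (((h.comm m n).sub_left (Commute.one_left _)).sub_right
    ((Commute.one_right _))).smul_left _ |>.smul_right _

/-- The Yosida approximation is `A J n = J n A` on the domain, so its convergence to `A` reduces to
the strong convergence of `J n` to the identity. -/
theorem IsResolventFamily.yosida_apply (h : IsResolventFamily A J) {u w : H} (hu : (u, w) ∈ A)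
    (n : ℕ) : yosida J n u = J n w := by
  have h1 := h.eq n u w hu
  have hn : ((n : ℝ) + 1) ≠ 0 := by positivity
  rw [map_sub, map_smul, sub_eq_iff_eq_add] at h1
  simp only [yosida, smul_apply, sub_apply, one_apply_eq_self]
  rw [h1, add_sub_cancel_left, smul_inv_smul₀ hn]

theorem IsResolventFamily.norm_apply_le (h : IsResolventFamily A J) (n : ℕ) (f : H) :
    ‖J n f‖ ≤ ‖f‖ := by
  simpa using (J n).le_of_opNorm_le (h.norm_le n) f

/-- Uniformly bounded operators converge strongly if they do so on a dense set. -/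
theorem tendsto_of_dense_of_norm_le {ι : Type*} {l : Filter ι} {T : ι → H →L[ℝ] H} {S : H →L[ℝ] H}
    (hT : ∀ i, ‖T i‖ ≤ 1) (hS : ‖S‖ ≤ 1) {D : Set H} (hD : Dense D)
    (h : ∀ u ∈ D, Tendsto (fun i => T i u) l (𝓝 (S u))) (u : H) :
    Tendsto (fun i => T i u) l (𝓝 (S u)) := by
  rw [Metric.tendsto_nhds]
  intro ε hε
  obtain ⟨v, hv, huv⟩ := hD.exists_dist_lt u (by positivity : (0 : ℝ) < ε / 3)
  filter_upwards [Metric.tendsto_nhds.1 (h v hv) (ε / 3) (by positivity)] with i hi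
  have h1 : dist (T i u) (T i v) ≤ dist u v := by
    rw [dist_eq_norm, dist_eq_norm, ← map_sub]
    simpa using (T i).le_of_opNorm_le (hT i) (u - v)
  have h2 : dist (S v) (S u) ≤ dist u v := by
    rw [dist_comm u v, dist_eq_norm, dist_eq_norm, ← map_sub]
    simpa using S.le_of_opNorm_le hS (v - u)
  linarith [dist_triangle4 (T i u) (T i v) (S v) (S u)]

theorem IsResolventFamily.tendsto (h : IsResolventFamily A J) (f : H) :
    Tendsto (fun n => J n f) atTop (𝓝 f) := by
  refine tendsto_of_dense_of_norm_le (S := ContinuousLinearMap.id ℝ H) h.norm_le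
    ContinuousLinearMap.norm_id_le h.dense ?_ f
  rintro u ⟨w, hw⟩
  have h1 : ∀ n : ℕ, ‖J n u - u‖ ≤ 1 / ((n : ℝ) + 1) * ‖w‖ := by
    intro n
    have h1 := h.eq n u w hw
    have h2 : J n u - u = ((n : ℝ) + 1)⁻¹ • J n w := by
      rw [map_sub, map_smul, sub_eq_iff_eq_add] at h1
      rw [h1]
      abel
    rw [h2, norm_smul, norm_inv, Real.norm_of_nonneg (by positivity), one_div]
    exact mul_le_mul_of_nonneg_left (h.norm_apply_le n w) (by positivity)
  rw [tendsto_iff_norm_sub_tendsto_zero]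
  refine squeeze_zero (fun _ => norm_nonneg _) h1 ?_
  simpa using tendsto_one_div_add_atTop_nhds_zero_nat.mul_const ‖w‖

theorem IsResolventFamily.tendsto_yosida (h : IsResolventFamily A J) {u w : H} (hu : (u, w) ∈ A) :
    Tendsto (fun n => yosida J n u) atTop (𝓝 w) := by
  simp only [h.yosida_apply hu]
  exact h.tendsto w

variable [CompleteSpace H]

theorem norm_exp_le_exp_norm (B : H →L[ℝ] H) : ‖NormedSpace.exp B‖ ≤ Real.exp ‖B‖ := by
  have h1 := NormedSpace.exp_series_hasSum_exp' (𝕂 := ℝ) B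
  have h2 := NormedSpace.exp_series_hasSum_exp' (𝕂 := ℝ) ‖B‖
  rw [← Real.exp_eq_exp_ℝ] at h2
  rw [← h1.tsum_eq, ← h2.tsum_eq]
  refine tsum_of_norm_bounded h2.summable.hasSum fun n => ?_
  rw [norm_smul, smul_eq_mul, Real.norm_of_nonneg (by positivity)]
  refine mul_le_mul_of_nonneg_left ?_ (by positivity)
  -- Degree `0` is separate: the identity has norm at most `1`, but not equal to `1` if `H` is
  -- trivial.
  rcases n with _ | n
  · rw [pow_zero, pow_zero]
    exact ContinuousLinearMap.norm_id_le
  · exact norm_pow_le' B (Nat.succ_pos n)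

theorem exp_add_of_commute_real {B C : H →L[ℝ] H} (h : Commute B C) :
    NormedSpace.exp (B + C) = NormedSpace.exp B * NormedSpace.exp C :=
  letI : NormedAlgebra ℚ (H →L[ℝ] H) := NormedAlgebra.restrictScalars ℚ ℝ _
  NormedSpace.exp_add_of_commute h

theorem exp_smul_one (c : ℝ) : NormedSpace.exp (c • (1 : H →L[ℝ] H)) = Real.exp c • 1 := by
  have h1 := NormedSpace.exp_series_hasSum_exp' (𝕂 := ℝ) (c • (1 : H →L[ℝ] H))
  have h2 := (NormedSpace.exp_series_hasSum_exp' (𝕂 := ℝ) c).smul_const (1 : H →L[ℝ] H)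
  rw [← Real.exp_eq_exp_ℝ] at h2
  refine h1.unique (h2.congr_fun ?_)
  intro n
  simp [smul_pow, smul_smul]

/-- Splitting off the scalar part leaves a power series in `J n` with nonnegative coefficients when
`t ≥ 0`. Both contractivity and the invariance of cones are read off from this form. -/
theorem yosidaExp_eq (n : ℕ) (t : ℝ) : yosidaExp J n t =
    Real.exp (-(t * ((n : ℝ) + 1))) • NormedSpace.exp ((t * ((n : ℝ) + 1)) • J n) := by
  have h1 : t • yosida J n = (-(t * ((n : ℝ) + 1))) • 1 + (t * ((n : ℝ) + 1)) • J n := by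
    rw [yosida]; module
  rw [yosidaExp, h1, exp_add_of_commute_real ((Commute.one_left _).smul_left _), exp_smul_one,
    smul_mul_assoc, one_mul]

theorem norm_yosidaExp_le (h : ∀ n, ‖J n‖ ≤ 1) (n : ℕ) {t : ℝ} (ht : 0 ≤ t) :
    ‖yosidaExp J n t‖ ≤ 1 := by
  rw [yosidaExp_eq, norm_smul, Real.norm_of_nonneg (Real.exp_pos _).le]
  have hn : 0 ≤ t * ((n : ℝ) + 1) := by positivity
  calc Real.exp (-(t * ((n : ℝ) + 1))) * ‖NormedSpace.exp ((t * ((n : ℝ) + 1)) • J n)‖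
      ≤ Real.exp (-(t * ((n : ℝ) + 1))) * Real.exp (t * ((n : ℝ) + 1)) := by
        gcongr
        refine (norm_exp_le_exp_norm _).trans (Real.exp_le_exp.2 ?_)
        rw [norm_smul, Real.norm_of_nonneg hn]
        exact mul_le_of_le_one_right hn (h n)
    _ = 1 := by rw [← Real.exp_add]; simp

omit [CompleteSpace H] in
theorem yosidaExp_zero (n : ℕ) : yosidaExp J n 0 = 1 := by
  simp [yosidaExp]

theorem yosidaExp_add (n : ℕ) (s t : ℝ) :
    yosidaExp J n (s + t) = yosidaExp J n s * yosidaExp J n t := by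
  rw [yosidaExp, add_smul, exp_add_of_commute_real
    (((Commute.refl _).smul_left _).smul_right _)]
  rfl

theorem hasDerivAt_yosidaExp (n : ℕ) (t : ℝ) (u : H) :
    HasDerivAt (fun t => yosidaExp J n t u) (yosidaExp J n t (yosida J n u)) t := by
  have h1 := hasDerivAt_exp_smul_const (𝕂 := ℝ) (yosida J n) t
  exact ((ContinuousLinearMap.apply ℝ H u).hasFDerivAt.comp_hasDerivAt t h1)

theorem norm_yosidaExp_sub_le (h : ∀ n, ‖J n‖ ≤ 1) (n : ℕ) {t : ℝ} (ht : 0 ≤ t) (u : H) :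
    ‖yosidaExp J n t u - u‖ ≤ ‖yosida J n u‖ * t := by
  have h1 := norm_image_sub_le_of_norm_deriv_le_segment' (f := fun t => yosidaExp J n t u)
    (f' := fun t => yosidaExp J n t (yosida J n u)) (a := 0) (b := t) (C := ‖yosida J n u‖)
    (fun x _ => (hasDerivAt_yosidaExp n x u).hasDerivWithinAt)
    (fun x hx => by
      simpa using (yosidaExp J n x).le_of_opNorm_le (norm_yosidaExp_le h n hx.1) (yosida J n u))
    t ⟨ht, le_rfl⟩
  simpa [yosidaExp_zero] using h1

/-- First-order Taylor estimate, uniform in `n` after passing to the limit. The image `A u` need not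
lie in the domain, so a nearby `v` of the domain stands in for it. -/
theorem norm_yosidaExp_sub_sub_le (h : ∀ n, ‖J n‖ ≤ 1) (n : ℕ) {t : ℝ} (ht : 0 ≤ t) (u v : H) :
    ‖yosidaExp J n t u - u - t • yosida J n u‖ ≤
      (2 * ‖yosida J n u - v‖ + t * ‖yosida J n v‖) * t := by
  have h1 := norm_image_sub_le_of_norm_deriv_le_segment'
    (f := fun t => yosidaExp J n t u - t • yosida J n u)
    (f' := fun t => yosidaExp J n t (yosida J n u) - (1 : ℝ) • yosida J n u) (a := 0) (b := t)
    (C := 2 * ‖yosida J n u - v‖ + t * ‖yosida J n v‖)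
    (fun x _ => ((hasDerivAt_yosidaExp n x u).sub
      ((hasDerivAt_id x).smul_const (yosida J n u))).hasDerivWithinAt)
    (fun x hx => by
      have e : yosidaExp J n x (yosida J n u) - (1 : ℝ) • yosida J n u =
        yosidaExp J n x (yosida J n u - v) + (yosidaExp J n x v - v) - (yosida J n u - v) := by
        rw [map_sub]; module
      rw [e]
      have h2 : ‖yosidaExp J n x (yosida J n u - v)‖ ≤ ‖yosida J n u - v‖ := by
        simpa using (yosidaExp J n x).le_of_opNorm_le (norm_yosidaExp_le h n hx.1)
          (yosida J n u - v)
      have h3 := norm_yosidaExp_sub_le h n hx.1 v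
      have h4 : ‖yosida J n v‖ * x ≤ t * ‖yosida J n v‖ := by
        rw [mul_comm]; exact mul_le_mul_of_nonneg_right hx.2.le (norm_nonneg _)
      refine (norm_sub_le _ _).trans ?_
      have := norm_add_le (yosidaExp J n x (yosida J n u - v)) (yosidaExp J n x v - v)
      linarith)
    t ⟨ht, le_rfl⟩
  have e : yosidaExp J n t u - u - t • yosida J n u =
    yosidaExp J n t u - t • yosida J n u - (yosidaExp J n 0 u - (0 : ℝ) • yosida J n u) := by
    rw [yosidaExp_zero]; simp; abel
  rw [e]
  simpa using h1

/-- Interpolate by `x ↦ exp((t - x) Aₙ) exp(x Aₘ)` between the two semigroups. As the approximations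
commute, its derivative is this product of contractions applied to `(Aₘ - Aₙ) u`. -/
theorem IsResolventFamily.norm_yosidaExp_sub_yosidaExp_le (h : IsResolventFamily A J) (m n : ℕ)
    {t : ℝ} (ht : 0 ≤ t) (u : H) :
    ‖yosidaExp J m t u - yosidaExp J n t u‖ ≤ ‖yosida J m u - yosida J n u‖ * t := by
  set C := yosida J m - yosida J n with hC
  have hcomm : Commute (yosida J n) C := (h.yosida_comm n m).sub_right (Commute.refl _)
  have key : ∀ x : ℝ, yosidaExp J n t * NormedSpace.exp (x • C) =
      yosidaExp J n (t - x) * yosidaExp J m x := by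
    intro x
    rw [yosidaExp, yosidaExp, yosidaExp,
      ← exp_add_of_commute_real ((hcomm.smul_left _).smul_right _),
      ← exp_add_of_commute_real (((h.yosida_comm n m).smul_left _).smul_right _)]
    congr 1
    rw [hC]; module
  have h1 := norm_image_sub_le_of_norm_deriv_le_segment'
    (f := fun x => yosidaExp J n t (NormedSpace.exp (x • C) u))
    (f' := fun x => yosidaExp J n t ((NormedSpace.exp (x • C) * C) u)) (a := 0) (b := t)
    (C := ‖yosida J m u - yosida J n u‖)
    (fun x _ => by
      have h1 := hasDerivAt_exp_smul_const (𝕂 := ℝ) C x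
      exact ((yosidaExp J n t).hasFDerivAt.comp_hasDerivAt x
        ((ContinuousLinearMap.apply ℝ H u).hasFDerivAt.comp_hasDerivAt x h1)).hasDerivWithinAt)
    (fun x hx => by
      have e : yosidaExp J n t ((NormedSpace.exp (x • C) * C) u) =
        yosidaExp J n (t - x) (yosidaExp J m x (C u)) := by
        have := congrArg (fun T : H →L[ℝ] H => T (C u)) (key x)
        exact this
      rw [e]
      have h2 : ∀ v, ‖yosidaExp J n (t - x) v‖ ≤ ‖v‖ := fun v => by
        simpa using (yosidaExp J n (t - x)).le_of_opNorm_le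
          (norm_yosidaExp_le h.norm_le n (by linarith [hx.2])) v
      have h3 : ∀ v, ‖yosidaExp J m x v‖ ≤ ‖v‖ := fun v => by
        simpa using (yosidaExp J m x).le_of_opNorm_le (norm_yosidaExp_le h.norm_le m hx.1) v
      exact (h2 _).trans (h3 _))
    t ⟨ht, le_rfl⟩
  have e1 : yosidaExp J n t (NormedSpace.exp (t • C) u) = yosidaExp J m t u := by
    have := congrArg (fun T : H →L[ℝ] H => T u) (key t)
    simpa [yosidaExp_zero] using this
  simpa [e1] using h1

end Yosida

/-! ### The limit semigroup and its generator -/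

section HilleYosida

variable {H : Type*} [NormedAddCommGroup H] [NormedSpace ℝ H] [CompleteSpace H]
  {A : Set (H × H)} {J : ℕ → H →L[ℝ] H}

theorem IsResolventFamily.exists_tendsto (h : IsResolventFamily A J) (t : ℝ≥0) (f : H) :
    ∃ g, Tendsto (fun n => yosidaExp J n t f) atTop (𝓝 g) := by
  refine cauchySeq_tendsto_of_complete (Metric.cauchySeq_iff.2 fun ε hε => ?_)
  obtain ⟨u, ⟨w, hw⟩, hu⟩ := h.dense.exists_dist_lt f (by positivity : (0 : ℝ) < ε / 3)
  have hc := (h.tendsto_yosida hw).cauchySeq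
  obtain ⟨N, hN⟩ := Metric.cauchySeq_iff.1 hc (ε / 3 / (t + 1)) (by positivity)
  refine ⟨N, fun m hm n hn => ?_⟩
  have h1 : ∀ n, dist (yosidaExp J n t f) (yosidaExp J n t u) ≤ dist f u := fun n => by
    rw [dist_eq_norm, dist_eq_norm, ← map_sub]
    simpa using (yosidaExp J n t).le_of_opNorm_le (norm_yosidaExp_le h.norm_le n t.2) (f - u)
  have h2 : dist (yosidaExp J m t u) (yosidaExp J n t u) < ε / 3 := by
    rw [dist_eq_norm]
    refine (h.norm_yosidaExp_sub_yosidaExp_le m n t.2 u).trans_lt ?_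
    have h3 := hN m hm n hn
    rw [dist_eq_norm, lt_div_iff₀ (by positivity)] at h3
    refine lt_of_le_of_lt ?_ h3
    exact mul_le_mul_of_nonneg_left (by simp) (norm_nonneg _)
  have h4 := h1 n
  rw [dist_comm] at h4
  linarith [dist_triangle4 (yosidaExp J m t f) (yosidaExp J m t u) (yosidaExp J n t u)
    (yosidaExp J n t f), h1 m]

/-- The limit of the Yosida semigroups. -/
def IsResolventFamily.semigroup (h : IsResolventFamily A J) (t : ℝ≥0) : H →L[ℝ] H :=
  continuousLinearMapOfTendsto (fun n => yosidaExp J n t)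
    (tendsto_pi_nhds.2 fun f => (h.exists_tendsto t f).choose_spec)

theorem IsResolventFamily.tendsto_semigroup (h : IsResolventFamily A J) (t : ℝ≥0) (f : H) :
    Tendsto (fun n => yosidaExp J n t f) atTop (𝓝 (h.semigroup t f)) :=
  (h.exists_tendsto t f).choose_spec

theorem IsResolventFamily.norm_semigroup_apply_le (h : IsResolventFamily A J) (t : ℝ≥0) (f : H) :
    ‖h.semigroup t f‖ ≤ ‖f‖ :=
  le_of_tendsto (h.tendsto_semigroup t f).norm (Eventually.of_forall fun n => by
    simpa using (yosidaExp J n t).le_of_opNorm_le (norm_yosidaExp_le h.norm_le n t.2) f)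

theorem IsResolventFamily.semigroup_zero (h : IsResolventFamily A J) :
    h.semigroup 0 = ContinuousLinearMap.id ℝ H := by
  ext f
  refine tendsto_nhds_unique (h.tendsto_semigroup 0 f) ?_
  simp only [NNReal.coe_zero, yosidaExp_zero]
  exact tendsto_const_nhds

theorem IsResolventFamily.semigroup_add (h : IsResolventFamily A J) (s t : ℝ≥0) :
    h.semigroup (s + t) = (h.semigroup s).comp (h.semigroup t) := by
  ext f
  refine tendsto_nhds_unique (h.tendsto_semigroup (s + t) f) ?_
  have h1 := h.tendsto_semigroup s (h.semigroup t f)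
  rw [← add_zero ((h.semigroup s).comp (h.semigroup t) f)]
  have h2 : Tendsto (fun n => yosidaExp J n s (yosidaExp J n t f - h.semigroup t f)) atTop
      (𝓝 0) := by
    rw [tendsto_zero_iff_norm_tendsto_zero]
    refine squeeze_zero (fun _ => norm_nonneg _) (fun n => ?_)
      (tendsto_iff_norm_sub_tendsto_zero.1 (h.tendsto_semigroup t f))
    simpa using (yosidaExp J n s).le_of_opNorm_le (norm_yosidaExp_le h.norm_le n s.2)
      (yosidaExp J n t f - h.semigroup t f)
  refine (h1.add h2).congr fun n => ?_
  rw [← map_add, add_sub_cancel, NNReal.coe_add, yosidaExp_add]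
  rfl

theorem IsResolventFamily.norm_semigroup_sub_le (h : IsResolventFamily A J) {u w : H}
    (hu : (u, w) ∈ A) (t : ℝ≥0) : ‖h.semigroup t u - u‖ ≤ ‖w‖ * t :=
  le_of_tendsto_of_tendsto' ((h.tendsto_semigroup t u).sub_const u).norm
    ((h.tendsto_yosida hu).norm.mul_const (t : ℝ))
    (fun n => norm_yosidaExp_sub_le h.norm_le n t.2 u)

theorem IsResolventFamily.norm_semigroup_sub_sub_le (h : IsResolventFamily A J) {u w v z : H}
    (hu : (u, w) ∈ A) (hv : (v, z) ∈ A) (t : ℝ≥0) :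
    ‖h.semigroup t u - u - (t : ℝ) • w‖ ≤ (2 * ‖w - v‖ + t * ‖z‖) * t := by
  have hy := h.tendsto_yosida hu
  refine le_of_tendsto_of_tendsto'
    (((h.tendsto_semigroup t u).sub_const u).sub (hy.const_smul (t : ℝ))).norm
    ((((hy.sub_const v).norm.const_mul 2).add
      ((h.tendsto_yosida hv).norm.const_mul (t : ℝ))).mul_const (t : ℝ))
    (fun n => norm_yosidaExp_sub_sub_le h.norm_le n t.2 u v)

omit [CompleteSpace H] in
/-- The difference quotient at `0` of a semigroup on its generator. -/
theorem tendsto_inv_smul_iff {x : ℝ≥0 → H} {w : H} :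
    Tendsto (fun t : ℝ≥0 => (t : ℝ)⁻¹ • x t) (𝓝[>] 0) (𝓝 w) ↔
      ∀ ε > 0, ∃ δ > 0, ∀ t : ℝ≥0, 0 < t → t < δ → ‖x t - (t : ℝ) • w‖ ≤ ε * t := by
  have key : ∀ t : ℝ≥0, 0 < t → ∀ ε : ℝ, (dist ((t : ℝ)⁻¹ • x t) w ≤ ε ↔
      ‖x t - (t : ℝ) • w‖ ≤ ε * t) := by
    intro t ht ε
    have ht' : (0 : ℝ) < t := ht
    have e : x t - (t : ℝ) • w = (t : ℝ) • ((t : ℝ)⁻¹ • x t - w) := by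
      rw [smul_sub, smul_inv_smul₀ ht'.ne']
    rw [e, norm_smul, Real.norm_of_nonneg ht'.le, dist_eq_norm, mul_comm]
    exact (mul_le_mul_iff_left₀ ht').symm
  rw [Metric.tendsto_nhds]
  constructor
  · intro h ε hε
    have h1 := h ε hε
    rw [eventually_nhdsWithin_iff, Metric.eventually_nhds_iff] at h1
    obtain ⟨δ, hδ, h1⟩ := h1
    refine ⟨⟨δ, hδ.le⟩, hδ, fun t ht htδ => (key t ht ε).1 (h1 ?_ ht).le⟩
    rw [NNReal.dist_eq, NNReal.coe_zero, sub_zero, abs_of_nonneg (NNReal.coe_nonneg t)]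
    exact htδ
  · intro h ε hε
    obtain ⟨δ, hδ, h1⟩ := h (ε / 2) (by positivity)
    have h2 : ∀ᶠ t : ℝ≥0 in 𝓝[>] 0, t < δ := mem_nhdsWithin_of_mem_nhds (Iio_mem_nhds hδ)
    filter_upwards [h2, self_mem_nhdsWithin] with t h3 h4
    have := (key t h4 (ε / 2)).2 (h1 t h4 h3)
    linarith

theorem IsResolventFamily.tendsto_quotient (h : IsResolventFamily A J) {u w : H}
    (hu : (u, w) ∈ A) :
    Tendsto (fun t : ℝ≥0 => (t : ℝ)⁻¹ • (h.semigroup t u - u)) (𝓝[>] 0) (𝓝 w) := by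
  rw [tendsto_inv_smul_iff]
  intro ε hε
  obtain ⟨v, ⟨z, hz⟩, hv⟩ := h.dense.exists_dist_lt w (by positivity : (0 : ℝ) < ε / 4)
  refine ⟨⟨ε / 2 / (‖z‖ + 1), by positivity⟩, ?_, fun t ht htδ => ?_⟩
  · exact (by positivity : (0 : ℝ) < ε / 2 / (‖z‖ + 1))
  refine (h.norm_semigroup_sub_sub_le hu hz t).trans (mul_le_mul_of_nonneg_right ?_ t.2)
  have h1 : (t : ℝ) < ε / 2 / (‖z‖ + 1) := htδ
  rw [lt_div_iff₀ (by positivity)] at h1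
  rw [dist_eq_norm] at hv
  have h2 : (t : ℝ) * ‖z‖ ≤ t * (‖z‖ + 1) := mul_le_mul_of_nonneg_left (by simp) t.2
  linarith

theorem IsResolventFamily.isSemigroupGeneratedBy (h : IsResolventFamily A J) :
    IsSemigroupGeneratedBy A h.semigroup where
  zero := h.semigroup_zero
  add := h.semigroup_add
  continuous u := by
    refine tendsto_of_dense_of_norm_le (S := ContinuousLinearMap.id ℝ H)
      (fun t => ContinuousLinearMap.opNorm_le_bound _ zero_le_one fun f => by
        simpa using h.norm_semigroup_apply_le t f)
      ContinuousLinearMap.norm_id_le h.dense ?_ u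
    rintro u ⟨w, hw⟩
    rw [tendsto_iff_norm_sub_tendsto_zero]
    refine squeeze_zero (fun _ => norm_nonneg _) (fun t => h.norm_semigroup_sub_le hw t) ?_
    have : Tendsto (fun t : ℝ≥0 => ‖w‖ * (t : ℝ)) (𝓝 0) (𝓝 (‖w‖ * ((0 : ℝ≥0) : ℝ))) :=
      (NNReal.continuous_coe.tendsto 0).const_mul _
    simpa using this
  generator u w := by
    refine ⟨h.tendsto_quotient, fun hu => ?_⟩
    -- With `v = (1 - A)⁻¹ (u - w)`, the vector `u - v` has right derivative `u - v` at `0`. Its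
    -- orbit would then start to grow like `e^t`, which a contraction semigroup forbids unless `u =
    -- v`.
    have h0 := h.mem 0 (u - w)
    set v := J 0 (u - w) with hv
    have h1 := (hu.sub (h.tendsto_quotient h0))
    have h2 : Tendsto (fun t : ℝ≥0 => (t : ℝ)⁻¹ • (h.semigroup t (u - v) - (u - v))) (𝓝[>] 0)
        (𝓝 (u - v)) := by
      have e : w - (((0 : ℕ) : ℝ) + 1) • (v - (u - w)) = u - v := by
        simp only [CharP.cast_eq_zero, zero_add, one_smul]
        abel
      rw [e] at h1
      refine h1.congr fun t => ?_
      rw [map_sub]; module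
    have h3 : u - v = 0 := by
      by_contra hne
      have hpos : 0 < ‖u - v‖ := norm_pos_iff.2 hne
      obtain ⟨δ, hδ, h3⟩ := tendsto_inv_smul_iff.1 h2 (‖u - v‖ / 2) (by positivity)
      obtain ⟨t, ht, htδ⟩ := exists_between hδ
      have h4 := h3 t ht htδ
      have ht' : (0 : ℝ) < t := ht
      have h5 := h.norm_semigroup_apply_le t (u - v)
      have h6 : ‖(1 + (t : ℝ)) • (u - v)‖ = (1 + t) * ‖u - v‖ := by
        rw [norm_smul, Real.norm_of_nonneg (by positivity)]
      have h7 : (1 + (t : ℝ)) • (u - v) = h.semigroup t (u - v) -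
        (h.semigroup t (u - v) - (u - v) - (t : ℝ) • (u - v)) := by module
      have h8 := norm_sub_le (h.semigroup t (u - v))
        (h.semigroup t (u - v) - (u - v) - (t : ℝ) • (u - v))
      rw [← h7, h6] at h8
      nlinarith
    rw [sub_eq_zero] at h3
    rw [← h3] at h0
    simpa using h0

/-! ### Orbits of an arbitrary semigroup with a given generator -/

namespace IsSemigroupGeneratedBy

variable {S : ℝ≥0 → H →L[ℝ] H}

omit [CompleteSpace H] in
theorem add_apply (hS : IsSemigroupGeneratedBy A S) (s t : ℝ≥0) (u : H) :
    S (s + t) u = S s (S t u) := by rw [hS.add]; rfl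

omit [CompleteSpace H] in
theorem mem_apply (hS : IsSemigroupGeneratedBy A S) {u w : H} (hu : (u, w) ∈ A) (t : ℝ≥0) :
    (S t u, S t w) ∈ A := by
  rw [hS.generator] at hu ⊢
  refine (((S t).continuous.tendsto _).comp hu).congr fun s => ?_
  simp only [Function.comp, map_smul, map_sub]
  rw [← hS.add_apply, ← hS.add_apply, add_comm]

/-- Unboundedness near `0` would give `tₙ → 0` with `‖S tₙ‖ → ∞`, against Banach–Steinhaus. The
definition postulates no bound, and uniqueness has to compare with every semigroup satisfying it. -/
theorem exists_norm_le_near_zero (hS : IsSemigroupGeneratedBy A S) :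
    ∃ δ > 0, ∃ M : ℝ, ∀ t ≤ δ, ‖S t‖ ≤ M := by
  by_contra! hcon
  have h1 : ∀ n : ℕ, ∃ t : ℝ≥0, t ≤ 1 / ((n : ℝ≥0) + 1) ∧ (n : ℝ) < ‖S t‖ :=
    fun n => hcon _ (by positivity) n
  choose t ht1 ht2 using h1
  have ht : Tendsto t atTop (𝓝 0) :=
    tendsto_of_tendsto_of_tendsto_of_le_of_le tendsto_const_nhds
      tendsto_one_div_add_atTop_nhds_zero_nat (fun _ => zero_le) ht1
  obtain ⟨C, hC⟩ := banach_steinhaus (g := fun n => S (t n)) fun u => by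
    have h2 := ((hS.continuous u).comp ht).norm.bddAbove_range
    obtain ⟨C, hC⟩ := h2
    exact ⟨C, fun i => hC ⟨i, rfl⟩⟩
  obtain ⟨n, hn⟩ := exists_nat_gt C
  exact absurd (hC n) (not_le.2 (hn.trans (ht2 n)))

theorem exists_norm_le (hS : IsSemigroupGeneratedBy A S) (T : ℝ≥0) :
    ∃ M : ℝ, ∀ t ≤ T, ‖S t‖ ≤ M := by
  obtain ⟨δ, hδ, M, hM⟩ := hS.exists_norm_le_near_zero
  have key : ∀ k : ℕ, ∃ M : ℝ, ∀ t ≤ k * δ, ‖S t‖ ≤ M := by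
    intro k
    induction k with
    | zero =>
      refine ⟨M, fun t ht => hM t (ht.trans ?_)⟩
      simp
    | succ k ih =>
      obtain ⟨M', hM'⟩ := ih
      have hM0 : 0 ≤ M := (norm_nonneg _).trans (hM 0 zero_le)
      have hM0' : 0 ≤ M' := (norm_nonneg _).trans (hM' 0 zero_le)
      refine ⟨max M (M' * M), fun t ht => ?_⟩
      rcases le_total t δ with h1 | h1
      · exact (hM t h1).trans (le_max_left _ _)
      · refine le_trans ?_ (le_max_right _ _)
        have e : t = (t - δ) + δ := (tsub_add_cancel_of_le h1).symm
        rw [e, hS.add]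
        refine (ContinuousLinearMap.opNorm_comp_le _ _).trans
          (mul_le_mul (hM' _ ?_) (hM _ le_rfl) (norm_nonneg _) hM0')
        rw [tsub_le_iff_right]
        refine ht.trans (le_of_eq ?_)
        push_cast; ring
  obtain ⟨k, hk⟩ := exists_nat_ge (T / δ)
  obtain ⟨M', hM'⟩ := key k
  exact ⟨M', fun t ht => hM' t (ht.trans ((div_le_iff₀ hδ).1 hk))⟩

/-- Time is extended to `ℝ` through `toNNReal`, constant for negative times, so that calculus on the
real line applies. -/
theorem continuous_apply (hS : IsSemigroupGeneratedBy A S) (u : H) :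
    Continuous fun t : ℝ => S t.toNNReal u := by
  have key : Continuous fun t : ℝ≥0 => S t u := by
    rw [Metric.continuous_iff]
    intro t ε hε
    obtain ⟨M, hM⟩ := hS.exists_norm_le (t + 1)
    have hM0 : 0 ≤ M := (norm_nonneg _).trans (hM 0 zero_le)
    obtain ⟨δ, hδ, h1⟩ := Metric.eventually_nhds_iff.1
      (Metric.tendsto_nhds.1 (hS.continuous u) (ε / (M + 1)) (by positivity))
    have h2 : ∀ s r : ℝ≥0, s ≤ r → s ≤ t + 1 → dist r s < δ → dist (S r u) (S s u) < ε := by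
      intro s r hsr hs hd
      have e : r = s + (r - s) := (add_tsub_cancel_of_le hsr).symm
      rw [e, hS.add_apply, dist_eq_norm, ← map_sub]
      have h3 : dist (S (r - s) u) u < ε / (M + 1) := by
        apply h1
        rw [NNReal.dist_eq, NNReal.coe_sub hsr, NNReal.coe_zero, sub_zero, ← NNReal.dist_eq]
        exact hd
      rw [dist_eq_norm, lt_div_iff₀ (by positivity)] at h3
      refine ((S s).le_of_opNorm_le (hM s hs) _).trans_lt (lt_of_le_of_lt ?_ h3)
      rw [mul_comm]
      exact mul_le_mul_of_nonneg_left (by simp) (norm_nonneg _)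
    refine ⟨min δ 1, by positivity, fun s hs => ?_⟩
    have hs1 : dist s t < δ := hs.trans_le (min_le_left _ _)
    have hs2 : dist s t < 1 := hs.trans_le (min_le_right _ _)
    rcases le_total s t with h3 | h3
    · rw [dist_comm]
      exact h2 s t h3 (h3.trans (by simp)) (by rwa [dist_comm])
    · exact h2 t s h3 (by simp) hs1
  exact key.comp continuous_real_toNNReal

omit [CompleteSpace H] in
theorem hasDerivWithinAt (hS : IsSemigroupGeneratedBy A S) {u w : H} (hu : (u, w) ∈ A) {s : ℝ}
    (hs : 0 ≤ s) :
    HasDerivWithinAt (fun t : ℝ => S t.toNNReal u) (S s.toNNReal w) (Set.Ici s) s := by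
  rw [hasDerivWithinAt_iff_tendsto_slope, Set.Ici_sdiff_left]
  have h1 := (hS.generator u w).1 hu
  have h2 : Tendsto (fun r : ℝ => (r - s).toNNReal) (𝓝[>] s) (𝓝[>] 0) := by
    refine tendsto_nhdsWithin_iff.2 ⟨?_, ?_⟩
    · have : Tendsto (fun r : ℝ => (r - s).toNNReal) (𝓝 s) (𝓝 (s - s).toNNReal) :=
        (continuous_real_toNNReal.comp (continuous_id.sub continuous_const)).tendsto s
      rw [sub_self, Real.toNNReal_zero] at this
      exact this.mono_left nhdsWithin_le_nhds
    · filter_upwards [self_mem_nhdsWithin] with r hr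
      exact Real.toNNReal_pos.2 (sub_pos.2 hr)
  refine ((((S s.toNNReal).continuous.tendsto w).comp h1).comp h2).congr' ?_
  filter_upwards [self_mem_nhdsWithin] with r hr
  have hr' : s < r := hr
  have e : r.toNNReal = s.toNNReal + (r - s).toNNReal := by
    rw [← Real.toNNReal_add hs (sub_nonneg.2 hr'.le)]; simp
  simp only [Function.comp, slope, vsub_eq_sub, map_smul, map_sub]
  rw [e, hS.add_apply, Real.coe_toNNReal _ (sub_nonneg.2 hr'.le)]

end IsSemigroupGeneratedBy

/-- For a semigroup of contractions the orbits in the domain of the generator are differentiable. -/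
theorem IsSemigroupGeneratedBy.hasDerivAt {S : ℝ≥0 → H →L[ℝ] H} (hS : IsSemigroupGeneratedBy A S)
    (hn : ∀ t u, ‖S t u‖ ≤ ‖u‖) {u w : H} (hu : (u, w) ∈ A) {s : ℝ} (hs : 0 < s) :
    HasDerivAt (fun t : ℝ => S t.toNNReal u) (S s.toNNReal w) s := by
  refine (hasDerivAt_iff_tendsto_slope_left_right.2 ⟨?_, ?_⟩)
  · have h1 := (hS.generator u w).1 hu
    have h2 : Tendsto (fun r : ℝ => (s - r).toNNReal) (𝓝[<] s) (𝓝[>] 0) := by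
      refine tendsto_nhdsWithin_iff.2 ⟨?_, ?_⟩
      · have : Tendsto (fun r : ℝ => (s - r).toNNReal) (𝓝 s) (𝓝 (s - s).toNNReal) :=
          (continuous_real_toNNReal.comp (continuous_const.sub continuous_id)).tendsto s
        rw [sub_self, Real.toNNReal_zero] at this
        exact this.mono_left nhdsWithin_le_nhds
      · filter_upwards [self_mem_nhdsWithin] with r hr
        exact Real.toNNReal_pos.2 (sub_pos.2 hr)
    have h3 := h1.comp h2
    have h4 : Tendsto (fun r : ℝ => S r.toNNReal w) (𝓝[<] s) (𝓝 (S s.toNNReal w)) :=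
      ((hS.continuous_apply w).tendsto s).mono_left nhdsWithin_le_nhds
    -- The left difference quotient is `S r` applied to a quotient at `0`, with `r` itself moving;
    -- contractivity lets the two limits be taken together.
    have h5 : Tendsto (fun r : ℝ => S r.toNNReal
        (((s - r).toNNReal : ℝ)⁻¹ • (S (s - r).toNNReal u - u) - w)) (𝓝[<] s) (𝓝 0) := by
      rw [tendsto_zero_iff_norm_tendsto_zero]
      exact squeeze_zero (fun _ => norm_nonneg _) (fun r => hn _ _)
        (tendsto_iff_norm_sub_tendsto_zero.1 h3)
    have h6 := h5.add h4
    rw [zero_add] at h6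
    refine h6.congr' ?_
    filter_upwards [Ioo_mem_nhdsLT hs] with r hr
    have e : s.toNNReal = r.toNNReal + (s - r).toNNReal := by
      rw [← Real.toNNReal_add hr.1.le (sub_nonneg.2 hr.2.le)]; simp
    rw [map_sub, sub_add_cancel, slope_comm]
    simp only [slope, vsub_eq_sub, map_smul, map_sub]
    rw [e, hS.add_apply, Real.coe_toNNReal _ (sub_nonneg.2 hr.2.le)]
  · have h1 := hS.hasDerivWithinAt hu hs.le
    rwa [hasDerivWithinAt_iff_tendsto_slope, Set.Ici_sdiff_left] at h1

end HilleYosida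

/-! ### Uniqueness, and properties of `expSemigroup` -/

section ExpSemigroup

variable {H : Type*} [NormedAddCommGroup H] [NormedSpace ℝ H] [CompleteSpace H]
  {A : Set (H × H)} {J : ℕ → H →L[ℝ] H}

theorem IsSemigroupGeneratedBy.tendsto_apply_apply {S : ℝ≥0 → H →L[ℝ] H}
    (hS : IsSemigroupGeneratedBy A S) (hn : ∀ t u, ‖S t u‖ ≤ ‖u‖) {ι : Type*} {l : Filter ι}
    {s : ι → ℝ} {x : ι → H} {r : ℝ} {y : H} (hs : Tendsto s l (𝓝 r)) (hx : Tendsto x l (𝓝 y)) :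
    Tendsto (fun i => S (s i).toNNReal (x i)) l (𝓝 (S r.toNNReal y)) := by
  have h1 := ((hS.continuous_apply y).tendsto r).comp hs
  have h2 : Tendsto (fun i => S (s i).toNNReal (x i - y)) l (𝓝 0) := by
    rw [tendsto_zero_iff_norm_tendsto_zero]
    exact squeeze_zero (fun _ => norm_nonneg _) (fun i => hn _ _)
      (tendsto_iff_norm_sub_tendsto_zero.1 hx)
  have h3 := h2.add h1
  rw [zero_add] at h3
  refine h3.congr fun i => ?_
  simp only [Function.comp, map_sub, sub_add_cancel]

/-- On the domain, `r ↦ S (t - r) (T r u)` has zero right derivative on `[0, t)`, so its end values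
`S t u` and `T t u` agree; density does the rest. -/
theorem IsSemigroupGeneratedBy.unique {S T : ℝ≥0 → H →L[ℝ] H} (hS : IsSemigroupGeneratedBy A S)
    (hn : ∀ t u, ‖S t u‖ ≤ ‖u‖) (hd : Dense {u | ∃ w, (u, w) ∈ A})
    (hT : IsSemigroupGeneratedBy A T) (t : ℝ≥0) : T t = S t := by
  have key : ∀ u ∈ {u | ∃ w, (u, w) ∈ A}, T t u = S t u := by
    rintro u ⟨w, hu⟩
    have hc : ∀ r : ℝ, Tendsto (fun r : ℝ => (t : ℝ) - r) (𝓝 r) (𝓝 (t - r)) := fun r =>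
      (continuous_const.sub continuous_id).tendsto r
    have h1 := constant_of_has_deriv_right_zero
      (f := fun r : ℝ => S ((t : ℝ) - r).toNNReal (T r.toNNReal u)) (a := 0) (b := t)
      (continuous_iff_continuousAt.2 fun r => hS.tendsto_apply_apply hn (hc r)
        ((hT.continuous_apply u).tendsto r)).continuousOn ?_ t ⟨t.2, le_rfl⟩
    · simp only [sub_self, sub_zero, Real.toNNReal_zero, Real.toNNReal_coe, hS.zero, hT.zero,
        ContinuousLinearMap.id_apply] at h1
      exact h1
    intro r hr
    rw [hasDerivWithinAt_iff_tendsto_slope, Set.Ici_sdiff_left]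
    have h2 := hT.hasDerivWithinAt hu hr.1
    rw [hasDerivWithinAt_iff_tendsto_slope, Set.Ici_sdiff_left] at h2
    have h3 : HasDerivAt (fun q : ℝ => S ((t : ℝ) - q).toNNReal (T r.toNNReal u))
        (-(S ((t : ℝ) - r).toNNReal (T r.toNNReal w))) r := by
      have h4 := hS.hasDerivAt hn (hT.mem_apply hu r.toNNReal) (sub_pos.2 hr.2)
      have h5 := h4.scomp r ((hasDerivAt_id r).const_sub (t : ℝ))
      rw [neg_one_smul] at h5
      exact h5
    have h6 : Tendsto (slope (fun q : ℝ => S ((t : ℝ) - q).toNNReal (T r.toNNReal u)) r)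
        (𝓝[>] r) (𝓝 (-(S ((t : ℝ) - r).toNNReal (T r.toNNReal w)))) := by
      have := h3.hasDerivWithinAt (s := Set.Ici r)
      rwa [hasDerivWithinAt_iff_tendsto_slope, Set.Ici_sdiff_left] at this
    -- Product rule: one term differentiates `T r u`, the other `S (t - r)`, and they cancel because
    -- `T r` maps the generator's graph to itself.
    have h7 := (hS.tendsto_apply_apply hn ((hc r).mono_left nhdsWithin_le_nhds) h2).add h6
    rw [add_neg_cancel] at h7
    refine h7.congr fun q => ?_
    simp only [slope, vsub_eq_sub, map_smul, map_sub]
    module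
  ext u
  exact congrFun (Continuous.ext_on hd (T t).continuous (S t).continuous key) u

namespace IsResolventFamily

theorem expSemigroup_generatedBy (h : IsResolventFamily A J) :
    IsSemigroupGeneratedBy A (expSemigroup A) :=
  Classical.epsilon_spec (p := IsSemigroupGeneratedBy A) ⟨_, h.isSemigroupGeneratedBy⟩

/-- Uniqueness pins down the `epsilon` choice, so whatever survives the limit of Yosida semigroups
holds for it. -/
theorem expSemigroup_eq (h : IsResolventFamily A J) (t : ℝ≥0) :
    expSemigroup A t = h.semigroup t :=
  h.isSemigroupGeneratedBy.unique h.norm_semigroup_apply_le h.dense h.expSemigroup_generatedBy t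

theorem norm_expSemigroup_apply_le (h : IsResolventFamily A J) (t : ℝ≥0) (u : H) :
    ‖expSemigroup A t u‖ ≤ ‖u‖ := by
  rw [h.expSemigroup_eq]; exact h.norm_semigroup_apply_le t u

theorem tendsto_expSemigroup (h : IsResolventFamily A J) (t : ℝ≥0) (u : H) :
    Tendsto (fun n => yosidaExp J n t u) atTop (𝓝 (expSemigroup A t u)) := by
  rw [h.expSemigroup_eq]; exact h.tendsto_semigroup t u

/-- A closed convex cone that is invariant under the resolvents is invariant under the
semigroup. -/
theorem expSemigroup_mem_cone (h : IsResolventFamily A J) {K : Set H} (hK : IsClosed K)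
    (h0 : 0 ∈ K) (hadd : ∀ u ∈ K, ∀ v ∈ K, u + v ∈ K)
    (hsmul : ∀ c : ℝ, 0 ≤ c → ∀ u ∈ K, c • u ∈ K) (hJ : ∀ n, ∀ u ∈ K, J n u ∈ K) (t : ℝ≥0) {u : H}
    (hu : u ∈ K) : expSemigroup A t u ∈ K := by
  refine hK.mem_of_tendsto (h.tendsto_expSemigroup t u) (Eventually.of_forall fun n => ?_)
  rw [yosidaExp_eq, smul_apply]
  refine hsmul _ (Real.exp_pos _).le _ ?_
  set c : ℝ := (t : ℝ) * ((n : ℝ) + 1) with hc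
  have hc0 : 0 ≤ c := by positivity
  have h1 := (NormedSpace.exp_series_hasSum_exp' (𝕂 := ℝ) (c • J n)).mapL
    (ContinuousLinearMap.apply ℝ H u)
  refine hK.mem_of_tendsto h1 (Eventually.of_forall fun s => ?_)
  have hpow : ∀ k : ℕ, ((c • J n) ^ k) u ∈ K := by
    intro k
    induction k with
    | zero => simpa using hu
    | succ k ih =>
      rw [pow_succ']
      exact hsmul c hc0 _ (hJ n _ ih)
  classical
  induction s using Finset.induction_on with
  | empty => simpa using h0
  | insert a s ha ih =>
    rw [Finset.sum_insert ha]
    refine hadd _ ?_ _ ih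
    exact hsmul _ (by positivity) _ (hpow a)

theorem expSemigroup_apply_of_fixed (h : IsResolventFamily A J) {u : H} (hu : ∀ n, J n u = u)
    (t : ℝ≥0) : expSemigroup A t u = u := by
  refine tendsto_nhds_unique (h.tendsto_expSemigroup t u) ?_
  have h1 : ∀ n, yosidaExp J n t u = u := fun n => by
    have h2 := norm_yosidaExp_sub_le h.norm_le n t.2 u
    have h3 : yosida J n u = 0 := by
      simp [yosida, hu]
    rw [h3, norm_zero, zero_mul] at h2
    exact sub_eq_zero.1 (norm_le_zero_iff.1 h2)
  simp only [h1]
  exact tendsto_const_nhds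

end IsResolventFamily

theorem IsResolventFamily.expSemigroup_symm {H : Type*} [NormedAddCommGroup H]
    [InnerProductSpace ℝ H] [CompleteSpace H] {A : Set (H × H)} {J : ℕ → H →L[ℝ] H}
    (h : IsResolventFamily A J) (hJ : ∀ n u v, inner ℝ (J n u) v = inner ℝ u (J n v)) (t : ℝ≥0)
    (u v : H) : inner ℝ (expSemigroup A t u) v = inner ℝ u (expSemigroup A t v) := by
  have h2 : ∀ n, IsSelfAdjoint ((t : ℝ) • yosida J n) := fun n => by
    rw [ContinuousLinearMap.isSelfAdjoint_iff_isSymmetric]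
    intro x y
    have := hJ n x y
    simp only [yosida, ContinuousLinearMap.coe_coe, smul_apply, sub_apply, one_apply_eq_self,
      inner_smul_left, inner_smul_right, inner_sub_left, inner_sub_right, this]
    simp
  have h3 : ∀ n, inner ℝ (yosidaExp J n t u) v = inner ℝ u (yosidaExp J n t v) := fun n =>
    (ContinuousLinearMap.isSelfAdjoint_iff_isSymmetric.1 (h2 n).exp) u v
  have h4 := (h.tendsto_expSemigroup t u).inner (𝕜 := ℝ) (tendsto_const_nhds (x := v))
  have h5 := (tendsto_const_nhds (x := u)).inner (𝕜 := ℝ) (h.tendsto_expSemigroup t v)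
  simp only [h3] at h4
  exact tendsto_nhds_unique h4 h5

end ExpSemigroup

namespace DirichletForm

variable {X : Type*} [MeasurableSpace X] {μ : Measure X}

/-! ### The form domain as a Hilbert space and the resolvent -/

/-- `Dom ℰ` with the inner product `ℰ(u, v) + (n + 1) ⟨u, v⟩`. -/
def FormSpace (E : DirichletForm μ) (_n : ℕ) : Type _ := E.domain

namespace FormSpace

variable (E : DirichletForm μ) (n : ℕ)

instance : AddCommGroup (FormSpace E n) := inferInstanceAs (AddCommGroup E.domain)

instance : Module ℝ (FormSpace E n) := inferInstanceAs (Module ℝ E.domain)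

/-- The inclusion of `Dom ℰ` into `L²`. -/
def incl : FormSpace E n →ₗ[ℝ] Lp ℝ 2 μ := E.domain.subtype

/-- The form on `FormSpace`. -/
def bilin : FormSpace E n →ₗ[ℝ] FormSpace E n →ₗ[ℝ] ℝ := E.form

/-- The inner product `ℰ(u, v) + (n + 1) ⟨u, v⟩`. -/
abbrev innerCore : InnerProductSpace.Core ℝ (FormSpace E n) where
  inner u v := bilin E n u v + ((n : ℝ) + 1) * inner ℝ (incl E n u) (incl E n v)
  conj_inner_symm u v := by
    have h1 : bilin E n v u = bilin E n u v := E.symm v u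
    rw [conj_trivial, h1, real_inner_comm]
  re_inner_nonneg u := by
    have h1 : 0 ≤ bilin E n u u := E.nonneg u
    have h2 : 0 ≤ inner ℝ (incl E n u) (incl E n u) := real_inner_self_nonneg
    simp only [RCLike.re_to_real]
    positivity
  add_left u v w := by
    simp only [map_add, LinearMap.add_apply, inner_add_left]; ring
  smul_left u v r := by
    simp only [map_smul, LinearMap.smul_apply, inner_smul_left, smul_eq_mul, conj_trivial]; ring
  definite u h := by
    have h1 : 0 ≤ bilin E n u u := E.nonneg u
    have h2 : 0 ≤ inner ℝ (incl E n u) (incl E n u) := real_inner_self_nonneg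
    have h3 : inner ℝ (incl E n u) (incl E n u) = 0 := by
      have h' : bilin E n u u + ((n : ℝ) + 1) * inner ℝ (incl E n u) (incl E n u) = 0 := h
      have h4 : (0 : ℝ) < (n : ℝ) + 1 := by positivity
      nlinarith
    exact Subtype.ext (inner_self_eq_zero.1 h3)

instance : NormedAddCommGroup (FormSpace E n) :=
  @InnerProductSpace.Core.toNormedAddCommGroup ℝ _ _ _ _ (innerCore E n)

instance : InnerProductSpace ℝ (FormSpace E n) := InnerProductSpace.ofCore (innerCore E n).toCore

theorem inner_def (u v : FormSpace E n) : inner ℝ u v =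
    bilin E n u v + ((n : ℝ) + 1) * inner ℝ (incl E n u) (incl E n v) := rfl

theorem norm_sq (u : FormSpace E n) :
    ‖u‖ ^ 2 = bilin E n u u + ((n : ℝ) + 1) * ‖incl E n u‖ ^ 2 := by
  rw [← real_inner_self_eq_norm_sq, inner_def, real_inner_self_eq_norm_sq]

theorem norm_incl_le (u : FormSpace E n) : ‖incl E n u‖ ≤ ‖u‖ := by
  refine le_of_sq_le_sq ?_ (norm_nonneg _)
  rw [norm_sq]
  have h1 : 0 ≤ bilin E n u u := E.nonneg u
  have h2 : 0 ≤ (n : ℝ) * ‖incl E n u‖ ^ 2 := by positivity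
  linarith

/-- The bounded inclusion of `Dom ℰ` into `L²`. -/
def inclL : FormSpace E n →L[ℝ] Lp ℝ 2 μ :=
  (incl E n).mkContinuous 1 fun u => by simpa using norm_incl_le E n u

theorem inclL_apply (u : FormSpace E n) : inclL E n u = incl E n u := rfl

instance : CompleteSpace (FormSpace E n) := by
  refine Metric.complete_of_cauchySeq_tendsto fun u hu => ?_
  have hn : (1 : ℝ) ≤ (n : ℝ) + 1 := by simp
  obtain ⟨v, hv⟩ := E.closed u fun ε hε => by
    obtain ⟨N, hN⟩ := Metric.cauchySeq_iff.1 hu (√ε) (Real.sqrt_pos.2 hε)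
    refine ⟨N, fun k hk l hl => ?_⟩
    have h1 := hN k hk l hl
    rw [dist_eq_norm, Real.lt_sqrt (norm_nonneg _), norm_sq] at h1
    refine lt_of_le_of_lt ?_ h1
    refine add_le_add le_rfl ?_
    exact le_mul_of_one_le_left (sq_nonneg _) hn
  obtain ⟨v', hv'⟩ : ∃ v' : FormSpace E n, v' = v := ⟨v, rfl⟩
  rw [← hv'] at hv
  refine ⟨v', ?_⟩
  rw [tendsto_iff_norm_sub_tendsto_zero]
  have h1 : Tendsto (fun k => ‖u k - v'‖ ^ 2) atTop (𝓝 0) := by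
    have h2 := hv.const_mul ((n : ℝ) + 1)
    rw [mul_zero] at h2
    refine squeeze_zero (fun _ => sq_nonneg _) (fun k => ?_) h2
    rw [norm_sq, mul_add]
    refine add_le_add ?_ le_rfl
    exact le_mul_of_one_le_left (E.nonneg _) hn
  have h2 := h1.sqrt
  simpa [Real.sqrt_sq] using h2

end FormSpace

open FormSpace

variable (E : DirichletForm μ)

/-- The element `(n + 1) (n + 1 - Δ)⁻¹ f` of the form domain. -/
def resolventDom (n : ℕ) : Lp ℝ 2 μ →ₗ[ℝ] E.domain :=
  ((n : ℝ) + 1) • (ContinuousLinearMap.adjoint (inclL E n)).toLinearMap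

/-- The operator `J n = (n + 1) (n + 1 - Δ)⁻¹` on `L²`. -/
def resolvent (n : ℕ) : Lp ℝ 2 μ →L[ℝ] Lp ℝ 2 μ :=
  ((n : ℝ) + 1) • (inclL E n).comp (ContinuousLinearMap.adjoint (inclL E n))

theorem coe_resolventDom (n : ℕ) (f : Lp ℝ 2 μ) :
    (E.resolventDom n f : Lp ℝ 2 μ) = E.resolvent n f := rfl

/-- The adjoint of the inclusion `Dom ℰ → L²` sends `f` to the Riesz representative of `⟨f, ·⟩` for
`ℰ + (n + 1)⟨·, ·⟩`; this is the weak form of `(n + 1 - Δ) u = f`. -/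
theorem form_resolventDom (n : ℕ) (f : Lp ℝ 2 μ) (v : E.domain) :
    E.form (E.resolventDom n f) v + ((n : ℝ) + 1) * inner ℝ (E.resolvent n f) (v : Lp ℝ 2 μ) =
      ((n : ℝ) + 1) * inner ℝ f (v : Lp ℝ 2 μ) := by
  have h1 : ∀ v : FormSpace E n,
      inner ℝ (((n : ℝ) + 1) • ContinuousLinearMap.adjoint (inclL E n) f) v =
        ((n : ℝ) + 1) * inner ℝ f (inclL E n v) := fun v => by
    rw [inner_smul_left, ContinuousLinearMap.adjoint_inner_left]; simp
  exact h1 v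

theorem resolvent_symm (n : ℕ) (f g : Lp ℝ 2 μ) :
    inner ℝ (E.resolvent n f) g = inner ℝ f (E.resolvent n g) := by
  simp only [resolvent, smul_apply, ContinuousLinearMap.comp_apply, inner_smul_left,
    inner_smul_right, conj_trivial]
  rw [← ContinuousLinearMap.adjoint_inner_left, ContinuousLinearMap.adjoint_inner_right]

theorem eq_zero_of_form_add (n : ℕ) (u : E.domain)
    (h : E.form u u + ((n : ℝ) + 1) * inner ℝ (u : Lp ℝ 2 μ) (u : Lp ℝ 2 μ) = 0) : u = 0 :=
  (innerCore E n).definite u h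

theorem resolvent_eq_of_forall (n : ℕ) (f : Lp ℝ 2 μ) (u : E.domain)
    (h : ∀ v : E.domain, E.form u v + ((n : ℝ) + 1) * inner ℝ (u : Lp ℝ 2 μ) (v : Lp ℝ 2 μ) =
      ((n : ℝ) + 1) * inner ℝ f (v : Lp ℝ 2 μ)) : E.resolvent n f = u := by
  rw [← coe_resolventDom]
  congr 1
  rw [← sub_eq_zero]
  apply E.eq_zero_of_form_add n
  have h1 := E.form_resolventDom n f (E.resolventDom n f - u)
  have h2 := h (E.resolventDom n f - u)
  rw [← coe_resolventDom] at h1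
  set z := E.resolventDom n f - u with hz
  have e1 : E.form z z = E.form (E.resolventDom n f) z - E.form u z := by
    rw [← LinearMap.sub_apply, ← map_sub, hz]
  have e2 : inner ℝ (z : Lp ℝ 2 μ) (z : Lp ℝ 2 μ) =
      inner ℝ (E.resolventDom n f : Lp ℝ 2 μ) (z : Lp ℝ 2 μ) - inner ℝ (u : Lp ℝ 2 μ) (z : Lp ℝ 2 μ) := by
    rw [← inner_sub_left]; rfl
  rw [e1, e2]
  linarith

theorem norm_resolvent_apply_le (n : ℕ) (f : Lp ℝ 2 μ) : ‖E.resolvent n f‖ ≤ ‖f‖ := by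
  have h1 := E.form_resolventDom n f (E.resolventDom n f)
  have h2 := E.nonneg (E.resolventDom n f)
  rw [coe_resolventDom, real_inner_self_eq_norm_sq] at h1
  have h3 := real_inner_le_norm f (E.resolvent n f)
  have h4 : (0 : ℝ) < (n : ℝ) + 1 := by positivity
  have h5 : ‖E.resolvent n f‖ ^ 2 ≤ ‖f‖ * ‖E.resolvent n f‖ := by nlinarith
  rcases (norm_nonneg (E.resolvent n f)).eq_or_lt with h6 | h6
  · rw [← h6]; exact norm_nonneg _
  · nlinarith

theorem isResolventFamily : IsResolventFamily E.generator E.resolvent where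
  mem n f := by
    refine ⟨E.resolventDom n f, rfl, fun φ => ?_⟩
    have h1 := E.form_resolventDom n f φ
    rw [inner_smul_left, inner_sub_left, conj_trivial]
    linarith
  eq n u w hu := by
    obtain ⟨u', rfl, h⟩ := hu
    refine E.resolvent_eq_of_forall n _ u' fun v => ?_
    have hn : ((n : ℝ) + 1) ≠ 0 := by positivity
    rw [h, inner_sub_left, inner_smul_left, conj_trivial, mul_sub, mul_inv_cancel_left₀ hn]
    ring
  norm_le n := ContinuousLinearMap.opNorm_le_bound _ zero_le_one fun f => by
    simpa using E.norm_resolvent_apply_le n f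
  dense := by
    have h1 : Dense ((LinearMap.range (E.resolvent 0).toLinearMap : Submodule ℝ (Lp ℝ 2 μ)) :
        Set (Lp ℝ 2 μ)) := by
      rw [Submodule.dense_iff_topologicalClosure_eq_top, Submodule.topologicalClosure_eq_top_iff,
        Submodule.eq_bot_iff]
      -- With `ι` the inclusion, `g` orthogonal to the range gives `‖ι* g‖² = ⟨ι ι* g, g⟩ = 0`, so
      -- `g` is orthogonal to the dense form domain.
      intro g hg
      have h2 : inner ℝ (E.resolvent 0 g) g = 0 := hg _ ⟨g, rfl⟩
      have h3 : ContinuousLinearMap.adjoint (inclL E 0) g = 0 := by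
        rw [← inner_self_eq_zero (𝕜 := ℝ), ContinuousLinearMap.adjoint_inner_left,
          real_inner_comm]
        simpa [resolvent] using h2
      have h4 : ∀ v ∈ (E.domain : Set (Lp ℝ 2 μ)), inner ℝ g v = 0 := fun v hv => by
        have h5 : ∀ v : FormSpace E 0, inner ℝ g (inclL E 0 v) = 0 := fun v => by
          rw [← ContinuousLinearMap.adjoint_inner_left, h3, inner_zero_left]
        exact h5 (⟨v, hv⟩ : E.domain)
      exact E.dense.eq_zero_of_inner_left (𝕜 := ℝ) h4
    refine h1.mono ?_
    rintro _ ⟨f, rfl⟩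
    exact ⟨_, E.resolventDom 0 f, rfl, fun φ => by
      have h1 := E.form_resolventDom 0 f φ
      have : E.form (E.resolventDom 0 f) φ =
        -inner ℝ (((0 : ℕ) + 1 : ℝ) • (E.resolvent 0 f - f)) (φ : Lp ℝ 2 μ) := by
        rw [inner_smul_left, inner_sub_left, conj_trivial]
        linarith
      exact this⟩

/-! ### Positivity -/

/-- `J n f` is the unique minimizer of `ℰ(v, v) + (n + 1)‖v - f‖²`: expanded around it, the
functional has no first-order term and a definite second-order one. -/
theorem resolvent_eq_of_minimizer (n : ℕ) (f : Lp ℝ 2 μ) (v : E.domain)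
    (h1 : E.form v v ≤ E.form (E.resolventDom n f) (E.resolventDom n f))
    (h2 : ‖(v : Lp ℝ 2 μ) - f‖ ≤ ‖E.resolvent n f - f‖) : E.resolvent n f = v := by
  set u := E.resolventDom n f with hu
  have h3 := E.form_resolventDom n f (v - u)
  rw [← coe_resolventDom, ← hu] at h3
  have h4 : E.form v v = E.form u u + 2 * E.form u (v - u) + E.form (v - u) (v - u) := by
    have e : v = u + (v - u) := by abel
    nth_rewrite 1 2 [e]
    simp only [map_add, LinearMap.add_apply]
    rw [E.symm (v - u) u]; ring
  have h5 : ‖(v : Lp ℝ 2 μ) - f‖ ^ 2 = ‖(u : Lp ℝ 2 μ) - f‖ ^ 2 +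
      2 * (inner ℝ (u : Lp ℝ 2 μ) ((v - u : E.domain) : Lp ℝ 2 μ) -
        inner ℝ f ((v - u : E.domain) : Lp ℝ 2 μ)) + ‖((v - u : E.domain) : Lp ℝ 2 μ)‖ ^ 2 := by
    have e : (v : Lp ℝ 2 μ) - f = ((u : Lp ℝ 2 μ) - f) + ((v - u : E.domain) : Lp ℝ 2 μ) := by
      push_cast; abel
    rw [e, norm_add_sq_real, inner_sub_left]
  have h6 : ‖(v : Lp ℝ 2 μ) - f‖ ^ 2 ≤ ‖(u : Lp ℝ 2 μ) - f‖ ^ 2 :=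
    pow_le_pow_left₀ (norm_nonneg _) h2 2
  have h7 := E.nonneg (v - u)
  have h8 : (0 : ℝ) < (n : ℝ) + 1 := by positivity
  have h9 : v - u = 0 := by
    apply E.eq_zero_of_form_add n
    rw [real_inner_self_eq_norm_sq]
    refine le_antisymm ?_ (by positivity)
    have h10 := mul_le_mul_of_nonneg_left h6 h8.le
    rw [h5] at h10
    nlinarith
  rw [sub_eq_zero] at h9
  rw [h9, hu, coe_resolventDom]

/-- Clipping `J n f` to `[0, 1]` does not increase the energy, and brings it no farther from `f`,
whose values are in `[0, 1]`. By uniqueness of the minimizer the clipping changes nothing. -/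
theorem resolvent_nonneg_of_le_one (n : ℕ) {f : Lp ℝ 2 μ} (h : ∀ᵐ x ∂μ, 0 ≤ f x ∧ f x ≤ 1) :
    0 ≤ E.resolvent n f := by
  obtain ⟨v, hv, hE⟩ := E.markov (E.resolventDom n f)
  have h1 : E.resolvent n f = v := by
    refine E.resolvent_eq_of_minimizer n f v hE (Lp.norm_le_norm_of_ae_le ?_)
    filter_upwards [h, hv, Lp.coeFn_sub (v : Lp ℝ 2 μ) f, Lp.coeFn_sub (E.resolvent n f) f]
      with x h1 h2 h3 h4
    rw [h3, h4, Pi.sub_apply, Pi.sub_apply, h2, coe_resolventDom, Real.norm_eq_abs,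
      Real.norm_eq_abs]
    generalize E.resolvent n f x = a
    obtain ⟨h5, h6⟩ := h1
    rcases le_total a 0 with h7 | h7
    · rw [max_eq_right h7, min_eq_left zero_le_one, abs_sub_comm, abs_sub_comm a,
        abs_of_nonneg (by linarith), abs_of_nonneg (by linarith)]
      linarith
    · rw [max_eq_left h7]
      rcases le_total a 1 with h8 | h8
      · rw [min_eq_left h8]
      · rw [min_eq_right h8, abs_of_nonneg (by linarith), abs_of_nonneg (by linarith)]
        linarith
  rw [h1, ← Lp.coeFn_nonneg]
  filter_upwards [hv] with x hx
  rw [hx, Pi.zero_apply]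
  exact le_min (le_max_right _ _) zero_le_one

theorem inner_nonneg_of_nonneg {f g : Lp ℝ 2 μ} (hf : 0 ≤ f) (hg : 0 ≤ g) :
    0 ≤ inner ℝ f g := by
  rw [L2.inner_def]
  refine integral_nonneg_of_ae ?_
  filter_upwards [(Lp.coeFn_nonneg f).2 hf, (Lp.coeFn_nonneg g).2 hg] with x h1 h2
  exact mul_nonneg h2 h1

theorem nonneg_of_forall_inner [IsFiniteMeasure μ] {f : Lp ℝ 2 μ}
    (h : ∀ B (hB : MeasurableSet B),
      0 ≤ inner ℝ (indicatorConstLp 2 hB (measure_ne_top μ B) (1 : ℝ)) f) : 0 ≤ f := by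
  rw [← Lp.coeFn_nonneg]
  refine ae_nonneg_of_forall_setIntegral_nonneg
    ((Lp.memLp f).integrable (by norm_num)) fun B hB _ => ?_
  have := h B hB
  rwa [L2.inner_indicatorConstLp_one] at this

/-- By symmetry `⟨1_B, J n f⟩ = ⟨J n 1_B, f⟩`, so the case of values in `[0, 1]` suffices. -/
theorem resolvent_nonneg [IsFiniteMeasure μ] (n : ℕ) {f : Lp ℝ 2 μ} (hf : 0 ≤ f) :
    0 ≤ E.resolvent n f := by
  refine nonneg_of_forall_inner fun B hB => ?_
  rw [← E.resolvent_symm]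
  refine inner_nonneg_of_nonneg (E.resolvent_nonneg_of_le_one n ?_) hf
  filter_upwards [indicatorConstLp_coeFn (p := 2) (hs := hB) (hμs := measure_ne_top μ B)
    (c := (1 : ℝ))] with x hx
  rw [hx]
  by_cases h : x ∈ B <;> simp [h]

end DirichletForm

namespace DirichletForm

variable {X : Type*} [MeasurableSpace X] {μ : Measure X}

open FormSpace

variable (E : DirichletForm μ)

/-! ### Bounded elements of the form domain are an algebra -/

/-- An `L²` limit of a sequence that is bounded in the form domain belongs to the form domain. -/
theorem mem_domain_of_tendsto {u : ℕ → FormSpace E 0} {C : ℝ} (hC : ∀ n, ‖u n‖ ≤ C)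
    {f : Lp ℝ 2 μ} (hf : Tendsto (fun n => inclL E 0 (u n)) atTop (𝓝 f)) : f ∈ E.domain := by
  let φ : ℕ → WeakDual ℝ (FormSpace E 0) := fun n =>
    WeakDual.toStrongDual.symm (InnerProductSpace.toDual ℝ (FormSpace E 0) (u n))
  have hφ : ∀ n, φ n ∈ WeakDual.toStrongDual ⁻¹'
      Metric.closedBall (0 : StrongDual ℝ (FormSpace E 0)) C := fun n => by
    rw [Set.mem_preimage, Metric.mem_closedBall]
    refine (dist_zero_right (InnerProductSpace.toDual ℝ (FormSpace E 0) (u n))).trans_le ?_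
    exact ((InnerProductSpace.toDual ℝ (FormSpace E 0)).norm_map (u n)).trans_le (hC n)
  -- Banach–Alaoglu. A limit along a free ultrafilter replaces a weakly convergent subsequence, so
  -- no separability is required.
  have hcomp := WeakDual.isCompact_closedBall (𝕜 := ℝ) (0 : StrongDual ℝ (FormSpace E 0)) C
  let U : Ultrafilter ℕ := hyperfilter ℕ
  obtain ⟨ψ, -, hψ⟩ := hcomp.ultrafilter_le_nhds (U.map φ) (by
    rw [Ultrafilter.coe_map, le_principal_iff]
    exact (Eventually.of_forall hφ : ∀ᶠ n in (U : Filter ℕ), φ n ∈ _))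
  set v := (InnerProductSpace.toDual ℝ (FormSpace E 0)).symm (WeakDual.toStrongDual ψ) with hv
  have hU : (U : Filter ℕ) ≤ atTop := Nat.hyperfilter_le_atTop
  have h1 : ∀ w : Lp ℝ 2 μ, inner ℝ (inclL E 0 v) w = inner ℝ f w := by
    intro w
    have h2 : Tendsto (fun n => inner ℝ (inclL E 0 (u n)) w) U (𝓝 (inner ℝ f w)) :=
      (hf.inner tendsto_const_nhds).mono_left hU
    have h3 : Tendsto (fun n => φ n (ContinuousLinearMap.adjoint (inclL E 0) w)) U
        (𝓝 (ψ (ContinuousLinearMap.adjoint (inclL E 0) w))) :=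
      ((WeakDual.eval_continuous (𝕜 := ℝ) (E := FormSpace E 0)
        (ContinuousLinearMap.adjoint (inclL E 0) w)).tendsto ψ).comp hψ
    have h4 : ψ (ContinuousLinearMap.adjoint (inclL E 0) w) = inner ℝ (inclL E 0 v) w := by
      rw [← ContinuousLinearMap.adjoint_inner_right, hv, InnerProductSpace.toDual_symm_apply]
      rfl
    have h5 : ∀ n, φ n (ContinuousLinearMap.adjoint (inclL E 0) w) =
        inner ℝ (inclL E 0 (u n)) w := fun n => by
      rw [← ContinuousLinearMap.adjoint_inner_right]
      rfl
    simp only [h5, h4] at h3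
    exact tendsto_nhds_unique h3 h2
  have h6 : inclL E 0 v = f := ext_inner_right ℝ h1
  rw [← h6]
  exact Subtype.property (p := (· ∈ E.domain)) v

theorem exists_truncation (u : E.domain) {r : ℝ} (hr : 0 < r) : ∃ v : E.domain,
    (∀ᵐ x ∂μ, (v : Lp ℝ 2 μ) x = min (max ((u : Lp ℝ 2 μ) x) 0) r) ∧ E.form v v ≤ E.form u u := by
  obtain ⟨v, hv, hE⟩ := E.markov (r⁻¹ • u)
  refine ⟨r • v, ?_, ?_⟩
  · filter_upwards [hv, Lp.coeFn_smul r (v : Lp ℝ 2 μ), Lp.coeFn_smul r⁻¹ (u : Lp ℝ 2 μ)]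
      with x h1 h2 h3
    rw [Submodule.coe_smul, h2, Pi.smul_apply, h1, Submodule.coe_smul, h3, Pi.smul_apply,
      smul_eq_mul, smul_eq_mul, mul_min_of_nonneg _ _ hr.le, mul_max_of_nonneg _ _ hr.le,
      mul_inv_cancel_left₀ hr.ne', mul_zero, mul_one]
  · simp only [map_smul, LinearMap.smul_apply, smul_eq_mul] at hE ⊢
    have h1 := mul_le_mul_of_nonneg_left hE (mul_nonneg hr.le hr.le)
    have e : r * r * (r⁻¹ * (r⁻¹ * E.form u u)) = E.form u u := by field_simp
    rw [e] at h1
    linarith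

theorem form_sub_le (u v : E.domain) :
    E.form (u - v) (u - v) ≤ 2 * E.form u u + 2 * E.form v v := by
  have h := E.nonneg (u + v)
  simp only [map_add, map_sub, LinearMap.add_apply, LinearMap.sub_apply] at h ⊢
  linarith

/-- For `u ≥ 0` one has `(u - r)⁺ = u - u ∧ r`; the factor `4` is the bound `2 + 2` from
`form_sub_le`. -/
theorem exists_sub_posPart (u : E.domain) (hu : ∀ᵐ x ∂μ, 0 ≤ (u : Lp ℝ 2 μ) x) {r : ℝ}
    (hr : 0 ≤ r) : ∃ v : E.domain,
    (∀ᵐ x ∂μ, (v : Lp ℝ 2 μ) x = max ((u : Lp ℝ 2 μ) x - r) 0) ∧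
      E.form v v ≤ 4 * E.form u u := by
  rcases hr.eq_or_lt with rfl | hr
  · refine ⟨u, ?_, by linarith [E.nonneg u]⟩
    filter_upwards [hu] with x hx
    rw [sub_zero, max_eq_left hx]
  obtain ⟨w, hw, hE⟩ := E.exists_truncation u hr
  refine ⟨u - w, ?_, by linarith [E.form_sub_le u w]⟩
  filter_upwards [hu, hw, Lp.coeFn_sub (u : Lp ℝ 2 μ) w] with x h1 h2 h3
  rw [Submodule.coe_sub, h3, Pi.sub_apply, h2, max_eq_left h1]
  rcases le_total ((u : Lp ℝ 2 μ) x) r with h | h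
  · rw [min_eq_left h, max_eq_right (by linarith), sub_self]
  · rw [min_eq_right h, max_eq_left (by linarith)]

/-- The sum is a Riemann sum for `x² = 2 ∫₀¹ (x - r)⁺ dr`. After telescoping `x²` over the grid of
step `d = 1/(n + 1)`, each of the `n + 1` cells costs at most `d²`. -/
theorem abs_sq_sub_sum_le {x : ℝ} (hx0 : 0 ≤ x) (hx1 : x ≤ 1) (n : ℕ) :
    |x ^ 2 - ∑ k ∈ Finset.range (n + 1), 2 / ((n : ℝ) + 1) * max (x - k / ((n : ℝ) + 1)) 0| ≤
      1 / ((n : ℝ) + 1) := by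
  have hn : (0 : ℝ) < (n : ℝ) + 1 := by positivity
  set d : ℝ := 1 / ((n : ℝ) + 1) with hd
  have hd0 : 0 < d := by positivity
  have hdn : ((n : ℝ) + 1) * d = 1 := by rw [hd]; field_simp
  set a : ℕ → ℝ := fun k => max (x - k * d) 0 with ha
  have h1 : x ^ 2 = ∑ k ∈ Finset.range (n + 1), (a k ^ 2 - a (k + 1) ^ 2) := by
    rw [Finset.sum_range_sub']
    have h2 : a 0 = x := by simp [ha, hx0]
    have h3 : a (n + 1) = 0 := by
      simp only [ha]
      push_cast
      rw [hdn, max_eq_right (by linarith)]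
    rw [h2, h3]; ring
  have h4 : ∀ k : ℕ, 2 / ((n : ℝ) + 1) * max (x - k / ((n : ℝ) + 1)) 0 = 2 * d * a k := by
    intro k
    simp only [ha, hd]
    rw [div_eq_mul_one_div (k : ℝ), div_eq_mul_one_div (2 : ℝ)]
  simp only [h4]
  rw [h1, ← Finset.sum_sub_distrib]
  refine (Finset.abs_sum_le_sum_abs _ _).trans ?_
  have h5 : ∀ k ∈ Finset.range (n + 1), |a k ^ 2 - a (k + 1) ^ 2 - 2 * d * a k| ≤ d ^ 2 := by
    intro k _
    have e : ((k + 1 : ℕ) : ℝ) * d = k * d + d := by push_cast; ring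
    simp only [ha]
    rw [e]
    generalize (k : ℝ) * d = y
    rcases le_total x y with h | h
    · rw [max_eq_right (by linarith), max_eq_right (by linarith)]
      simp; positivity
    · rw [max_eq_left (by linarith)]
      rcases le_total x (y + d) with h' | h'
      · rw [max_eq_right (by linarith), abs_le]
        constructor <;> nlinarith
      · rw [max_eq_left (by linarith), abs_le]
        constructor <;> nlinarith
  refine (Finset.sum_le_sum h5).trans ?_
  rw [Finset.sum_const, Finset.card_range, nsmul_eq_mul]
  push_cast
  nlinarith

/-- The Riemann sums of `2 ∫₀¹ (u - r)⁺ dr` converge to `u²` in `L²`. Their coefficients add up to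
`2` and the `(u - r)⁺` are uniformly bounded in the form norm, so the limit stays in the domain.
Only the unit contraction is used. -/
theorem exists_sq_of_mem_Icc [IsProbabilityMeasure μ] (u : E.domain)
    (hu : ∀ᵐ x ∂μ, 0 ≤ (u : Lp ℝ 2 μ) x ∧ (u : Lp ℝ 2 μ) x ≤ 1) :
    ∃ v : E.domain, ∀ᵐ x ∂μ, (v : Lp ℝ 2 μ) x = (u : Lp ℝ 2 μ) x ^ 2 := by
  have h0 : ∀ᵐ x ∂μ, 0 ≤ (u : Lp ℝ 2 μ) x := hu.mono fun x hx => hx.1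
  choose w hw hwE using fun (n k : ℕ) =>
    E.exists_sub_posPart u h0 (r := (k : ℝ) / ((n : ℝ) + 1)) (by positivity)
  let s : ℕ → E.domain := fun n => ∑ k ∈ Finset.range (n + 1), (2 / ((n : ℝ) + 1)) • w n k
  have hm : MemLp (fun x => (u : Lp ℝ 2 μ) x ^ 2) 2 μ := by
    refine MemLp.of_bound ((Lp.aestronglyMeasurable _).pow 2) 1 ?_
    filter_upwards [hu] with x hx
    rw [Real.norm_eq_abs, abs_of_nonneg (sq_nonneg _)]
    exact pow_le_one₀ hx.1 hx.2
  have hs : ∀ n, ‖(s n : Lp ℝ 2 μ) - hm.toLp‖ ≤ 1 / ((n : ℝ) + 1) := by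
    intro n
    have hsum : ∀ᵐ x ∂μ, (s n : Lp ℝ 2 μ) x =
        ∑ k ∈ Finset.range (n + 1), 2 / ((n : ℝ) + 1) * (w n k : Lp ℝ 2 μ) x := by
      have e : (s n : Lp ℝ 2 μ) =
          ∑ k ∈ Finset.range (n + 1), (2 / ((n : ℝ) + 1)) • (w n k : Lp ℝ 2 μ) := by
        simp [s]
      rw [e]
      have h3 : ∀ᵐ x ∂μ, ∀ k, ((2 / ((n : ℝ) + 1)) • (w n k : Lp ℝ 2 μ) : Lp ℝ 2 μ) x =
          2 / ((n : ℝ) + 1) * (w n k : Lp ℝ 2 μ) x :=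
        ae_all_iff.2 fun k => Lp.coeFn_smul _ _
      filter_upwards [Lp.coeFn_finsetSum (Finset.range (n + 1))
        (fun k => (2 / ((n : ℝ) + 1)) • (w n k : Lp ℝ 2 μ)), h3] with x h4 h5
      rw [h4, Finset.sum_apply]
      exact Finset.sum_congr rfl fun k _ => h5 k
    have h6 : ∀ᵐ x ∂μ, ‖((s n : Lp ℝ 2 μ) - hm.toLp : Lp ℝ 2 μ) x‖ ≤ 1 / ((n : ℝ) + 1) := by
      filter_upwards [hsum, hu, ae_all_iff.2 (hw n), hm.coeFn_toLp,
        Lp.coeFn_sub (s n : Lp ℝ 2 μ) hm.toLp] with x h1 h2 h3 h4 h5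
      rw [h5, Pi.sub_apply, h4, h1, Real.norm_eq_abs, abs_sub_comm]
      simp only [h3]
      exact abs_sq_sub_sum_le h2.1 h2.2 n
    have h7 := Lp.norm_le_of_ae_bound (by positivity) h6
    have h8 : measureUnivNNReal μ = 1 := by
      rw [← ENNReal.coe_inj, coe_measureUnivNNReal, measure_univ, ENNReal.coe_one]
    simpa [h8] using h7
  have hbound : ∀ n, ∀ k, E.form (w n k) (w n k) + ((0 : ℕ) + 1 : ℝ) * ‖(w n k : Lp ℝ 2 μ)‖ ^ 2 ≤
      4 * E.form u u + ‖(u : Lp ℝ 2 μ)‖ ^ 2 := by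
    intro n k
    have h1 : ‖(w n k : Lp ℝ 2 μ)‖ ≤ ‖(u : Lp ℝ 2 μ)‖ := by
      refine Lp.norm_le_norm_of_ae_le ?_
      filter_upwards [hw n k, hu] with x h1 h2
      have h3 : (0 : ℝ) ≤ (k : ℝ) / ((n : ℝ) + 1) := by positivity
      rw [h1, Real.norm_eq_abs, Real.norm_eq_abs, abs_of_nonneg (le_max_right _ _),
        abs_of_nonneg h2.1]
      exact max_le (by linarith) h2.1
    have h2 := pow_le_pow_left₀ (norm_nonneg _) h1 2
    have h3 := hwE n k
    simp only [CharP.cast_eq_zero, zero_add, one_mul]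
    linarith
  set C := √(4 * E.form u u + ‖(u : Lp ℝ 2 μ)‖ ^ 2) with hC
  have hC0 : 0 ≤ C := Real.sqrt_nonneg _
  have hwV : ∀ n k, ∀ z : FormSpace E 0, z = w n k → ‖z‖ ≤ C := by
    intro n k z hz
    refine Real.le_sqrt_of_sq_le ?_
    rw [FormSpace.norm_sq, hz]
    exact hbound n k
  have hsV : ∀ n, ∀ z : FormSpace E 0, z = s n → ‖z‖ ≤ 2 * C := by
    intro n z hz
    obtain ⟨y, hy⟩ : ∃ y : ℕ → FormSpace E 0, y = w n := ⟨w n, rfl⟩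
    have e : z = ∑ k ∈ Finset.range (n + 1), (2 / ((n : ℝ) + 1)) • y k := by
      rw [hz, hy]; rfl
    rw [e]
    refine (norm_sum_le _ _).trans ?_
    have h1 : ∀ k ∈ Finset.range (n + 1), ‖(2 / ((n : ℝ) + 1)) • y k‖ ≤ 2 / ((n : ℝ) + 1) * C := by
      intro k _
      rw [norm_smul, Real.norm_of_nonneg (by positivity)]
      exact mul_le_mul_of_nonneg_left (hwV n k _ (by rw [hy])) (by positivity)
    refine (Finset.sum_le_sum h1).trans (le_of_eq ?_)
    rw [Finset.sum_const, Finset.card_range, nsmul_eq_mul]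
    push_cast
    field_simp
  have hmem : hm.toLp ∈ E.domain := by
    refine E.mem_domain_of_tendsto (u := s) (C := 2 * C) (fun n => hsV n _ rfl) ?_
    rw [tendsto_iff_norm_sub_tendsto_zero]
    exact squeeze_zero (fun _ => norm_nonneg _) hs tendsto_one_div_add_atTop_nhds_zero_nat
  exact ⟨⟨_, hmem⟩, hm.coeFn_toLp⟩

theorem exists_sq_of_nonneg [IsProbabilityMeasure μ] (u : E.domain) {M : ℝ}
    (hu : ∀ᵐ x ∂μ, 0 ≤ (u : Lp ℝ 2 μ) x ∧ (u : Lp ℝ 2 μ) x ≤ M) :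
    ∃ v : E.domain, ∀ᵐ x ∂μ, (v : Lp ℝ 2 μ) x = (u : Lp ℝ 2 μ) x ^ 2 := by
  set N := max M 1 with hN
  have hN0 : 0 < N := lt_max_of_lt_right one_pos
  obtain ⟨v, hv⟩ := E.exists_sq_of_mem_Icc (N⁻¹ • u) (by
    filter_upwards [hu, Lp.coeFn_smul N⁻¹ (u : Lp ℝ 2 μ)] with x h1 h2
    rw [Submodule.coe_smul, h2, Pi.smul_apply, smul_eq_mul]
    refine ⟨mul_nonneg (by positivity) h1.1, ?_⟩
    rw [inv_mul_le_iff₀ hN0, mul_one]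
    exact h1.2.trans (le_max_left _ _))
  refine ⟨(N ^ 2) • v, ?_⟩
  filter_upwards [hv, Lp.coeFn_smul N⁻¹ (u : Lp ℝ 2 μ), Lp.coeFn_smul (N ^ 2) (v : Lp ℝ 2 μ)]
    with x h1 h2 h3
  rw [Submodule.coe_smul, h3, Pi.smul_apply, h1, Submodule.coe_smul, h2, Pi.smul_apply,
    smul_eq_mul, smul_eq_mul]
  field_simp

theorem exists_sq [IsProbabilityMeasure μ] (u : E.domain) (hu : E.IsBdd u) :
    ∃ v : E.domain, ∀ᵐ x ∂μ, (v : Lp ℝ 2 μ) x = (u : Lp ℝ 2 μ) x ^ 2 := by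
  obtain ⟨M, hM⟩ := hu
  set N := max M 1 with hN
  have hN0 : 0 < N := lt_max_of_lt_right one_pos
  obtain ⟨p, hp, -⟩ := E.exists_truncation u hN0
  obtain ⟨q, hq, -⟩ := E.exists_truncation (-u) hN0
  obtain ⟨v, hv⟩ := E.exists_sq_of_nonneg p (M := N) (hp.mono fun x hx => by
    rw [hx]; exact ⟨le_min (le_max_right _ _) hN0.le, min_le_right _ _⟩)
  obtain ⟨w, hw⟩ := E.exists_sq_of_nonneg q (M := N) (hq.mono fun x hx => by
    rw [hx]; exact ⟨le_min (le_max_right _ _) hN0.le, min_le_right _ _⟩)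
  refine ⟨v + w, ?_⟩
  filter_upwards [hM, hp, hq, hv, hw, Lp.coeFn_neg (u : Lp ℝ 2 μ),
    Lp.coeFn_add (v : Lp ℝ 2 μ) w] with x h1 h2 h3 h4 h5 h6 h7
  rw [Submodule.coe_neg, h6, Pi.neg_apply] at h3
  rw [Submodule.coe_add, h7, Pi.add_apply, h4, h5, h2, h3]
  have h8 := abs_le.1 (h1.trans (le_max_left M 1))
  rw [← hN] at h8
  rcases le_total ((u : Lp ℝ 2 μ) x) 0 with h | h
  · rw [max_eq_right h, max_eq_left (by linarith), min_eq_left hN0.le,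
      min_eq_left (by linarith)]
    ring
  · rw [max_eq_left h, max_eq_right (by linarith), min_eq_left hN0.le,
      min_eq_left (by linarith)]
    ring

theorem IsBdd.add {E : DirichletForm μ} {u v : E.domain} (hu : E.IsBdd u) (hv : E.IsBdd v) :
    E.IsBdd (u + v) := by
  obtain ⟨M, hM⟩ := hu
  obtain ⟨N, hN⟩ := hv
  refine ⟨M + N, ?_⟩
  filter_upwards [hM, hN, Lp.coeFn_add (u : Lp ℝ 2 μ) v] with x h1 h2 h3
  rw [Submodule.coe_add, h3]
  exact (abs_add_le _ _).trans (add_le_add h1 h2)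

/-- Polarization. This supplies the products that `CarreDuChamp.formula` takes as given elements of
the domain. -/
theorem exists_mul [IsProbabilityMeasure μ] (u v : E.domain) (hu : E.IsBdd u) (hv : E.IsBdd v) :
    ∃ w : E.domain, ∀ᵐ x ∂μ, (w : Lp ℝ 2 μ) x = (u : Lp ℝ 2 μ) x * (v : Lp ℝ 2 μ) x := by
  obtain ⟨a, ha⟩ := E.exists_sq (u + v) (hu.add hv)
  obtain ⟨b, hb⟩ := E.exists_sq u hu
  obtain ⟨c, hc⟩ := E.exists_sq v hv
  refine ⟨(1 / 2 : ℝ) • (a - (b + c)), ?_⟩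
  filter_upwards [ha, hb, hc, Lp.coeFn_add (u : Lp ℝ 2 μ) v, Lp.coeFn_add (b : Lp ℝ 2 μ) c,
    Lp.coeFn_sub (a : Lp ℝ 2 μ) ((b + c : E.domain) : Lp ℝ 2 μ),
    Lp.coeFn_smul (1 / 2 : ℝ) ((a - (b + c) : E.domain) : Lp ℝ 2 μ)] with x h1 h2 h3 h4 h5 h6 h7
  rw [Submodule.coe_smul, h7, Pi.smul_apply, Submodule.coe_sub, h6, Pi.sub_apply,
    Submodule.coe_add, h5, Pi.add_apply, h1, h2, h3, Submodule.coe_add, h4, Pi.add_apply,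
    smul_eq_mul]
  ring

/-! ### Conservativeness -/

/-- A core function within `1/2` of `1` exceeds `1/2` everywhere, so its truncation at `1/2` is
constant. Locality with both the closed set and its neighbourhood equal to `X` kills the energy
against constants. -/
theorem exists_one [MetricSpace X] [CompactSpace X] [BorelSpace X] [IsProbabilityMeasure μ]
    {E : DirichletForm μ} (hreg : E.IsRegular) (hloc : E.IsStrictlyLocal) :
    ∃ e : E.domain, (∀ᵐ x ∂μ, (e : Lp ℝ 2 μ) x = 1) ∧ ∀ u : E.domain, E.form u e = 0 := by
  obtain ⟨φ, hφ, hd⟩ := hreg.dense_continuous.exists_dist_lt (1 : C(X, ℝ))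
    (by norm_num : (0 : ℝ) < 1 / 2)
  obtain ⟨e, he, -⟩ := E.exists_truncation (E.coreToDomain ⟨φ, hφ⟩)
    (by norm_num : (0 : ℝ) < 1 / 2)
  have h1 : ∀ᵐ x ∂μ, (((2 : ℝ) • e : E.domain) : Lp ℝ 2 μ) x = 1 := by
    filter_upwards [he, Lp.coeFn_smul (2 : ℝ) (e : Lp ℝ 2 μ),
      ContinuousMap.coeFn_toLp (p := 2) (𝕜 := ℝ) μ φ] with x h2 h3 h4
    have h5 : ((E.coreToDomain ⟨φ, hφ⟩ : E.domain) : Lp ℝ 2 μ) x = φ x := h4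
    have h6 := (ContinuousMap.dist_lt_iff (by norm_num)).1 hd x
    rw [Real.dist_eq, abs_lt, ContinuousMap.one_apply] at h6
    rw [Submodule.coe_smul, h3, Pi.smul_apply, h2, h5, max_eq_left (by linarith),
      min_eq_right (by linarith)]
    norm_num
  exact ⟨_, h1, fun u => hloc u _ Set.univ Set.univ 1 isClosed_univ isOpen_univ subset_rfl
    (by simp) (h1.mono fun x hx _ => hx)⟩

end DirichletForm

/-! ### Symmetric Markov operators -/

section Markov

variable {X : Type*} [MeasurableSpace X] {μ : Measure X}

/-- Multiplication of `L²` functions by a bounded function. -/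
def mulL2 {a : X → ℝ} (ha : MemLp a ∞ μ) : Lp ℝ 2 μ →L[ℝ] Lp ℝ 2 μ :=
  (ContinuousLinearMap.mul ℝ ℝ).holderL μ ∞ 2 2 ha.toLp

theorem coeFn_mulL2 {a : X → ℝ} (ha : MemLp a ∞ μ) (f : Lp ℝ 2 μ) :
    ∀ᵐ x ∂μ, mulL2 ha f x = a x * f x := by
  filter_upwards [(ContinuousLinearMap.mul ℝ ℝ).coeFn_holder (r := 2) ha.toLp f, ha.coeFn_toLp]
    with x h1 h2
  have h3 : mulL2 ha f x = (ContinuousLinearMap.mul ℝ ℝ) (ha.toLp a x) (f x) := h1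
  rw [h3, h2]
  rfl

theorem inner_L2_eq (f g : Lp ℝ 2 μ) : inner ℝ f g = ∫ x, f x * g x ∂μ := by
  rw [L2.inner_def]
  refine integral_congr_ae (Eventually.of_forall fun x => ?_)
  simp [mul_comm]

theorem integrable_mul_L2 (f g : Lp ℝ 2 μ) : Integrable (fun x => f x * g x) μ :=
  (Lp.memLp f).integrable_mul (Lp.memLp g)

theorem inner_mulL2 {a : X → ℝ} (ha : MemLp a ∞ μ) (f g : Lp ℝ 2 μ) :
    inner ℝ (mulL2 ha f) g = ∫ x, a x * f x * g x ∂μ := by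
  rw [inner_L2_eq]
  refine integral_congr_ae ?_
  filter_upwards [coeFn_mulL2 ha f] with x hx
  rw [hx]

theorem inner_mulL2_comm {a : X → ℝ} (ha : MemLp a ∞ μ) (f g : Lp ℝ 2 μ) :
    inner ℝ (mulL2 ha f) g = inner ℝ f (mulL2 ha g) := by
  rw [real_inner_comm (mulL2 ha g) f, inner_mulL2, inner_mulL2]
  congr 1
  ext x; ring

theorem memLp_top_of_abs_le {f : Lp ℝ 2 μ} {M : ℝ} (h : ∀ᵐ x ∂μ, |f x| ≤ M) : MemLp f ∞ μ :=
  memLp_top_of_bound (Lp.aestronglyMeasurable f) M h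

variable [IsProbabilityMeasure μ]

/-- The constant function `1` in `L²`. -/
def oneL2 (μ : Measure X) [IsProbabilityMeasure μ] : Lp ℝ 2 μ := Lp.const 2 μ (1 : ℝ)

theorem coeFn_oneL2 : ∀ᵐ x ∂μ, oneL2 μ x = 1 := Lp.coeFn_const 2 μ (1 : ℝ)

theorem eq_oneL2 {f : Lp ℝ 2 μ} (h : ∀ᵐ x ∂μ, f x = 1) : f = oneL2 μ := by
  apply Lp.ext
  filter_upwards [h, coeFn_oneL2] with x h1 h2
  rw [h1, h2]

theorem inner_oneL2 (f : Lp ℝ 2 μ) : inner ℝ f (oneL2 μ) = ∫ x, f x ∂μ := by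
  rw [inner_L2_eq]
  refine integral_congr_ae ?_
  filter_upwards [coeFn_oneL2 (μ := μ)] with x hx
  rw [hx, mul_one]

/-- A symmetric, positive and conservative operator on `L²`. -/
structure IsMarkovOperator (T : Lp ℝ 2 μ →L[ℝ] Lp ℝ 2 μ) : Prop where
  symm : ∀ f g, inner ℝ (T f) g = inner ℝ f (T g)
  nonneg : ∀ f, 0 ≤ f → 0 ≤ T f
  one : T (oneL2 μ) = oneL2 μ

namespace IsMarkovOperator

variable {T : Lp ℝ 2 μ →L[ℝ] Lp ℝ 2 μ}

theorem apply_nonneg (hT : IsMarkovOperator T) {f : Lp ℝ 2 μ} (hf : ∀ᵐ x ∂μ, 0 ≤ f x) :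
    ∀ᵐ x ∂μ, 0 ≤ T f x :=
  (Lp.coeFn_nonneg _).2 (hT.nonneg f ((Lp.coeFn_nonneg _).1 hf))

theorem integral_apply (hT : IsMarkovOperator T) (f : Lp ℝ 2 μ) :
    ∫ x, T f x ∂μ = ∫ x, f x ∂μ := by
  rw [← inner_oneL2, ← inner_oneL2, hT.symm, hT.one]

theorem apply_le (hT : IsMarkovOperator T) {f : Lp ℝ 2 μ} {M : ℝ} (hf : ∀ᵐ x ∂μ, f x ≤ M) :
    ∀ᵐ x ∂μ, T f x ≤ M := by
  have h1 := hT.apply_nonneg (f := M • oneL2 μ - f) (by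
    filter_upwards [hf, Lp.coeFn_sub (M • oneL2 μ) f, Lp.coeFn_smul M (oneL2 μ), coeFn_oneL2]
      with x h1 h2 h3 h4
    rw [h2, Pi.sub_apply, h3, Pi.smul_apply, h4, smul_eq_mul]
    linarith)
  rw [map_sub, map_smul, hT.one] at h1
  filter_upwards [h1, Lp.coeFn_sub (M • oneL2 μ) (T f), Lp.coeFn_smul M (oneL2 μ), coeFn_oneL2]
    with x h1 h2 h3 h4
  rw [h2, Pi.sub_apply, h3, Pi.smul_apply, h4, smul_eq_mul] at h1
  linarith

theorem abs_apply_le (hT : IsMarkovOperator T) {f : Lp ℝ 2 μ} {M : ℝ}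
    (hf : ∀ᵐ x ∂μ, |f x| ≤ M) : ∀ᵐ x ∂μ, |T f x| ≤ M := by
  have h1 := hT.apply_le (f := f) (M := M) (hf.mono fun x hx => (abs_le.1 hx).2)
  have h2 := hT.apply_le (f := -f) (M := M) (by
    filter_upwards [hf, Lp.coeFn_neg f] with x h1 h2
    rw [h2, Pi.neg_apply]
    linarith [(abs_le.1 h1).1])
  rw [map_neg] at h2
  filter_upwards [h1, h2, Lp.coeFn_neg (T f)] with x h1 h2 h3
  rw [h3, Pi.neg_apply] at h2
  exact abs_le.2 ⟨by linarith, h1⟩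

/-- The Cauchy–Schwarz inequality for a Markov operator. -/
theorem sq_apply_le (hT : IsMarkovOperator T) {f g : Lp ℝ 2 μ} (hg : ∀ᵐ x ∂μ, g x = f x ^ 2) :
    ∀ᵐ x ∂μ, (T f x) ^ 2 ≤ T g x := by
  -- Positivity applied to `(f - q)²`. Rational `q` keep the exceptional sets countable in number;
  -- at a good point `q` is then moved to the value `T f x`.
  have h1 : ∀ q : ℚ, ∀ᵐ x ∂μ, 0 ≤ T g x - 2 * q * T f x + (q : ℝ) ^ 2 := by
    intro q
    have h2 := hT.apply_nonneg (f := g - (2 * (q : ℝ)) • f + ((q : ℝ) ^ 2) • oneL2 μ) (by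
      filter_upwards [hg, Lp.coeFn_add (g - (2 * (q : ℝ)) • f) (((q : ℝ) ^ 2) • oneL2 μ),
        Lp.coeFn_sub g ((2 * (q : ℝ)) • f), Lp.coeFn_smul (2 * (q : ℝ)) f,
        Lp.coeFn_smul ((q : ℝ) ^ 2) (oneL2 μ), coeFn_oneL2] with x h1 h2 h3 h4 h5 h6
      rw [h2, Pi.add_apply, h3, Pi.sub_apply, h4, h5, Pi.smul_apply, Pi.smul_apply, h1, h6,
        smul_eq_mul, smul_eq_mul]
      nlinarith [sq_nonneg (f x - q)])
    rw [map_add, map_sub, map_smul, map_smul, hT.one] at h2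
    filter_upwards [h2, Lp.coeFn_add (T g - (2 * (q : ℝ)) • T f) (((q : ℝ) ^ 2) • oneL2 μ),
        Lp.coeFn_sub (T g) ((2 * (q : ℝ)) • T f), Lp.coeFn_smul (2 * (q : ℝ)) (T f),
        Lp.coeFn_smul ((q : ℝ) ^ 2) (oneL2 μ), coeFn_oneL2] with x h1 h2 h3 h4 h5 h6
    rw [h2, Pi.add_apply, h3, Pi.sub_apply, h4, h5, Pi.smul_apply, Pi.smul_apply, h6,
        smul_eq_mul, smul_eq_mul] at h1
    linarith
  filter_upwards [ae_all_iff.2 h1] with x hx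
  have h2 : IsClosed {q : ℝ | 0 ≤ T g x - 2 * q * T f x + q ^ 2} :=
    isClosed_le continuous_const (by fun_prop)
  have h3 : T f x ∈ {q : ℝ | 0 ≤ T g x - 2 * q * T f x + q ^ 2} :=
    h2.closure_subset_iff.2 (Set.range_subset_iff.2 hx) (Rat.denseRange_cast (T f x))
  have h4 : 0 ≤ T g x - 2 * T f x * T f x + T f x ^ 2 := h3
  nlinarith

/-- For continuous `v` this is Cauchy–Schwarz followed by symmetry. For general `v` the square is
only in `L¹`, where `T` is not defined; both sides are continuous in `v ∈ L²`, so density of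
continuous functions finishes. -/
theorem integral_mul_sq_apply_le [TopologicalSpace X] [CompactSpace X] [NormalSpace X]
    [BorelSpace X] [SecondCountableTopologyEither X ℝ] [μ.WeaklyRegular]
    (hT : IsMarkovOperator T) {h : Lp ℝ 2 μ} {M : ℝ} (h0 : ∀ᵐ x ∂μ, 0 ≤ h x)
    (hM : ∀ᵐ x ∂μ, |h x| ≤ M) (v : Lp ℝ 2 μ) :
    ∫ x, h x * (T v x) ^ 2 ∂μ ≤ ∫ x, T h x * (v x) ^ 2 ∂μ := by
  have hm := memLp_top_of_abs_le hM
  have hTm := memLp_top_of_abs_le (hT.abs_apply_le hM)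
  have e1 : ∀ v : Lp ℝ 2 μ, ∫ x, h x * (T v x) ^ 2 ∂μ = inner ℝ (mulL2 hm (T v)) (T v) := by
    intro v
    rw [inner_mulL2]
    congr 1; ext x; ring
  have e2 : ∀ v : Lp ℝ 2 μ, ∫ x, T h x * (v x) ^ 2 ∂μ = inner ℝ (mulL2 hTm v) v := by
    intro v
    rw [inner_mulL2]
    congr 1; ext x; ring
  have hclosed : IsClosed {v : Lp ℝ 2 μ |
      inner ℝ (mulL2 hm (T v)) (T v) ≤ inner ℝ (mulL2 hTm v) v} :=
    isClosed_le (by fun_prop) (by fun_prop)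
  have hdense := ContinuousMap.toLp_denseRange (p := 2) ℝ μ ℝ (by norm_num)
  rw [e1, e2]
  refine hclosed.closure_subset_iff.2 (Set.range_subset_iff.2 fun φ => ?_) (hdense v)
  set w : Lp ℝ 2 μ := ContinuousMap.toLp 2 μ ℝ φ with hw
  have hφ := ContinuousMap.coeFn_toLp (p := 2) (𝕜 := ℝ) μ φ
  have hφ2 := ContinuousMap.coeFn_toLp (p := 2) (𝕜 := ℝ) μ (φ ^ 2)
  set w2 : Lp ℝ 2 μ := ContinuousMap.toLp 2 μ ℝ (φ ^ 2) with hw2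
  have hsq : ∀ᵐ x ∂μ, w2 x = w x ^ 2 := by
    filter_upwards [hφ, hφ2] with x h1 h2
    rw [h1, h2]; rfl
  rw [Set.mem_ofPred_eq, ← e1, ← e2]
  calc ∫ x, h x * (T w x) ^ 2 ∂μ ≤ ∫ x, h x * T w2 x ∂μ := by
        refine integral_mono_ae ?_ (integrable_mul_L2 _ _) ?_
        · refine (integrable_mul_L2 (mulL2 hm (T w)) (T w)).congr ?_
          filter_upwards [coeFn_mulL2 hm (T w)] with x hx
          rw [hx]; ring
        · filter_upwards [h0, hT.sq_apply_le hsq] with x h1 h2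
          exact mul_le_mul_of_nonneg_left h2 h1
    _ = ∫ x, T h x * w2 x ∂μ := by rw [← inner_L2_eq, ← inner_L2_eq, hT.symm]
    _ = ∫ x, T h x * (w x) ^ 2 ∂μ := by
        refine integral_congr_ae ?_
        filter_upwards [hsq] with x hx
        rw [hx]

end IsMarkovOperator

end Markov

/-! ### The heat semigroup -/

namespace DirichletForm

variable {X : Type*} [MeasurableSpace X] {μ : Measure X} (E : DirichletForm μ)

theorem heat_generatedBy : IsSemigroupGeneratedBy E.generator E.heat :=
  E.isResolventFamily.expSemigroup_generatedBy

theorem norm_heat_apply_le (t : ℝ≥0) (f : Lp ℝ 2 μ) : ‖E.heat t f‖ ≤ ‖f‖ :=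
  E.isResolventFamily.norm_expSemigroup_apply_le t f

/-- `1 ∈ Dom ℰ` and `ℰ(u, 1) = 0` for all `u ∈ Dom ℰ`. -/
def IsConservative [IsProbabilityMeasure μ] : Prop :=
  ∃ e : E.domain, (e : Lp ℝ 2 μ) = oneL2 μ ∧ ∀ u : E.domain, E.form u e = 0

theorem isConservative [MetricSpace X] [CompactSpace X] [BorelSpace X] [IsProbabilityMeasure μ]
    {E : DirichletForm μ} (hreg : E.IsRegular) (hloc : E.IsStrictlyLocal) : E.IsConservative := by
  obtain ⟨e, he, h⟩ := exists_one hreg hloc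
  exact ⟨e, eq_oneL2 he, h⟩

variable [IsProbabilityMeasure μ] {E}

theorem IsConservative.isMarkovOperator_resolvent (hE : E.IsConservative) (n : ℕ) :
    IsMarkovOperator (E.resolvent n) where
  symm := E.resolvent_symm n
  nonneg _ := E.resolvent_nonneg n
  one := by
    obtain ⟨e, he, h⟩ := hE
    rw [← he]
    refine E.resolvent_eq_of_forall n _ e fun v => ?_
    rw [E.symm, h, zero_add]

theorem IsConservative.isMarkovOperator_heat (hE : E.IsConservative) (t : ℝ≥0) :
    IsMarkovOperator (E.heat t) where
  symm := E.isResolventFamily.expSemigroup_symm (fun n => E.resolvent_symm n) t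
  nonneg _ hf := E.isResolventFamily.expSemigroup_mem_cone (K := Set.Ici 0) isClosed_Ici
    (le_refl (0 : Lp ℝ 2 μ)) (fun _ hu _ hv => Set.mem_Ici.2 (add_nonneg (Set.mem_Ici.1 hu) (Set.mem_Ici.1 hv)))
    (fun c hc u hu => by
      rw [Set.mem_Ici, ← Lp.coeFn_nonneg] at hu ⊢
      filter_upwards [hu, Lp.coeFn_smul c u] with x h1 h2
      rw [h2, Pi.smul_apply]
      exact mul_nonneg hc h1)
    (fun n _ hu => E.resolvent_nonneg n hu) t hf
  one := E.isResolventFamily.expSemigroup_apply_of_fixed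
    (fun n => (hE.isMarkovOperator_resolvent n).one) t

end DirichletForm

/-! ### The derivative of `∫ a_r u_r² dμ` -/

section SquareDerivative

variable {X : Type*} [MeasurableSpace X] {μ : Measure X}

theorem norm_mulL2_self_sub_le {f g : Lp ℝ 2 μ} (hf : MemLp f ∞ μ) (hg : MemLp g ∞ μ)
    (hf1 : ∀ᵐ x ∂μ, |f x| ≤ 1) (hg1 : ∀ᵐ x ∂μ, |g x| ≤ 1) :
    ‖mulL2 hf f - mulL2 hg g‖ ≤ 2 * ‖f - g‖ := by
  refine Lp.norm_le_mul_norm_of_ae_le_mul ?_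
  filter_upwards [hf1, hg1, coeFn_mulL2 hf f, coeFn_mulL2 hg g, Lp.coeFn_sub f g,
    Lp.coeFn_sub (mulL2 hf f) (mulL2 hg g)] with x h1 h2 h3 h4 h5 h6
  rw [h6, h5, Pi.sub_apply, Pi.sub_apply, h3, h4, Real.norm_eq_abs, Real.norm_eq_abs,
    mul_self_sub_mul_self, abs_mul]
  refine mul_le_mul_of_nonneg_right ?_ (abs_nonneg _)
  linarith [abs_add_le (f x) (g x)]

theorem continuous_mulL2_self {u : ℝ → Lp ℝ 2 μ} (hu : ∀ r, MemLp (u r) ∞ μ)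
    (hu1 : ∀ r, ∀ᵐ x ∂μ, |u r x| ≤ 1) (hc : Continuous u) :
    Continuous fun r => mulL2 (hu r) (u r) := by
  rw [continuous_iff_continuousAt]
  intro s
  rw [ContinuousAt, tendsto_iff_norm_sub_tendsto_zero]
  refine squeeze_zero (fun _ => norm_nonneg _)
    (fun r => norm_mulL2_self_sub_le (hu r) (hu s) (hu1 r) (hu1 s)) ?_
  simpa using (tendsto_iff_norm_sub_tendsto_zero.1 (hc.tendsto s)).const_mul 2

/-- Write `a_r = (a_r - a_s) + a_s`. The first part vanishes at `s`, so continuity of `u_r²` is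
enough there; the second is a bounded quadratic form in `u_r` with a fixed multiplier. Thus `u_r²`
need not be differentiable in `L²`. -/
theorem hasDerivAt_inner_mulL2_self {a u : ℝ → Lp ℝ 2 μ} {a' u' : Lp ℝ 2 μ} {s : ℝ}
    (ha : HasDerivAt a a' s) (hu' : HasDerivAt u u' s) (hc : Continuous u)
    (hu : ∀ r, MemLp (u r) ∞ μ) (hu1 : ∀ r, ∀ᵐ x ∂μ, |u r x| ≤ 1) (hm : MemLp (a s) ∞ μ) :
    HasDerivAt (fun r => inner ℝ (a r) (mulL2 (hu r) (u r)))
      (inner ℝ a' (mulL2 (hu s) (u s)) + 2 * inner ℝ (mulL2 hm (u s)) u') s := by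
  have e : ∀ r, inner ℝ (a r) (mulL2 (hu r) (u r)) =
      inner ℝ (a r - a s) (mulL2 (hu r) (u r)) + inner ℝ (mulL2 hm (u r)) (u r) := by
    intro r
    have h1 : inner ℝ (mulL2 hm (u r)) (u r) = inner ℝ (a s) (mulL2 (hu r) (u r)) := by
      rw [inner_mulL2, real_inner_comm, inner_mulL2]
      congr 1; ext x; ring
    rw [h1, inner_sub_left]; ring
  have h1 : HasDerivAt (fun r => inner ℝ (a r - a s) (mulL2 (hu r) (u r)))
      (inner ℝ a' (mulL2 (hu s) (u s))) s := by
    rw [hasDerivAt_iff_tendsto_slope] at ha ⊢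
    have h2 : Tendsto (fun r => mulL2 (hu r) (u r)) (𝓝[≠] s) (𝓝 (mulL2 (hu s) (u s))) :=
      ((continuous_mulL2_self hu hu1 hc).tendsto s).mono_left nhdsWithin_le_nhds
    refine (ha.inner (𝕜 := ℝ) h2).congr fun r => ?_
    simp only [slope, vsub_eq_sub, sub_self, inner_zero_left, sub_zero, smul_eq_mul,
      inner_smul_left, conj_trivial]
  have h2 : HasDerivAt (fun r => inner ℝ (mulL2 hm (u r)) (u r))
      (2 * inner ℝ (mulL2 hm (u s)) u') s := by
    have h3 := ((mulL2 hm).hasFDerivAt.comp_hasDerivAt s hu').inner ℝ hu'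
    have h4 : inner ℝ (mulL2 hm u') (u s) = inner ℝ (mulL2 hm (u s)) u' := by
      rw [inner_mulL2_comm, real_inner_comm]
    refine h3.congr_deriv ?_
    simp only [Function.comp]
    rw [h4]; ring
  exact (h1.add h2).congr_of_eventuallyEq (Eventually.of_forall e)

end SquareDerivative

/-! ### The reverse Poincaré inequality -/

namespace DirichletForm

variable {X : Type*} [MeasurableSpace X] {μ : Measure X} {E : DirichletForm μ}

namespace CarreDuChamp

variable (Γ : E.CarreDuChamp)

theorem coeFn_sqrtGamma (f : E.domain) : ∀ᵐ x ∂μ, Γ.sqrtGamma f x = √(Γ.toMap f f x) :=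
  MemLp.coeFn_toLp _

theorem sq_sqrtGamma (f : E.domain) : ∀ᵐ x ∂μ, Γ.sqrtGamma f x ^ 2 = Γ.toMap f f x := by
  filter_upwards [Γ.coeFn_sqrtGamma f, Γ.nonneg f] with x h1 h2
  rw [h1, Real.sq_sqrt h2]

theorem sqrtGamma_nonneg (f : E.domain) : ∀ᵐ x ∂μ, 0 ≤ Γ.sqrtGamma f x := by
  filter_upwards [Γ.coeFn_sqrtGamma f] with x h1
  rw [h1]
  exact Real.sqrt_nonneg _

theorem integrable_mul_gamma {a : X → ℝ} (ha : MemLp a ∞ μ) (f : E.domain) :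
    Integrable (fun x => a x * Γ.toMap f f x) μ :=
  (Γ.integrable f f).mul_of_top_right ha

variable [IsProbabilityMeasure μ]

/-- The defining formula of the carré du champ in terms of generators. -/
theorem two_mul_integral_mul_gamma {a u : E.domain} {a' u' : Lp ℝ 2 μ}
    (ha : ((a : Lp ℝ 2 μ), a') ∈ E.generator) (hu : ((u : Lp ℝ 2 μ), u') ∈ E.generator)
    {M N : ℝ} (hM : ∀ᵐ x ∂μ, |(a : Lp ℝ 2 μ) x| ≤ M) (hN : ∀ᵐ x ∂μ, |(u : Lp ℝ 2 μ) x| ≤ N)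
    (hma : MemLp (a : Lp ℝ 2 μ) ∞ μ) (hmu : MemLp (u : Lp ℝ 2 μ) ∞ μ) :
    2 * ∫ x, (a : Lp ℝ 2 μ) x * Γ.toMap u u x ∂μ =
      inner ℝ a' (mulL2 hmu (u : Lp ℝ 2 μ)) - 2 * inner ℝ (mulL2 hma (u : Lp ℝ 2 μ)) u' := by
  obtain ⟨p, hp⟩ := E.exists_mul u u ⟨N, hN⟩ ⟨N, hN⟩
  obtain ⟨q, hq⟩ := E.exists_mul u a ⟨N, hN⟩ ⟨M, hM⟩
  -- Here `f = g = u` and `h = a`: the formula reads `2 ℰ(ua, u) - ℰ(a, u²)`, and both energies are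
  -- turned into pairings with the generator.
  rw [← Γ.formula u u a p q q ⟨N, hN⟩ ⟨N, hN⟩ ⟨M, hM⟩ hp hq hq]
  have hp' : mulL2 hmu (u : Lp ℝ 2 μ) = p := by
    apply Lp.ext
    filter_upwards [hp, coeFn_mulL2 hmu (u : Lp ℝ 2 μ)] with x h1 h2
    rw [h1, h2]
  have hq' : mulL2 hma (u : Lp ℝ 2 μ) = q := by
    apply Lp.ext
    filter_upwards [hq, coeFn_mulL2 hma (u : Lp ℝ 2 μ)] with x h1 h2
    rw [h1, h2, mul_comm]
  obtain ⟨a₁, ha₁, ha⟩ := ha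
  obtain ⟨u₁, hu₁, hu⟩ := hu
  obtain rfl : a₁ = a := Subtype.ext ha₁
  obtain rfl : u₁ = u := Subtype.ext hu₁
  rw [hp', hq', E.symm q u₁, hu, ha, real_inner_comm u']
  ring

variable [MetricSpace X] [CompactSpace X] [BorelSpace X]

/-- The squared Bakry–Émery bound integrated against `h`, with the semigroup moved onto `h`. The
dual form avoids applying `P_s` to `Γ(f)`, which is only in `L¹`. -/
theorem integral_mul_gamma_heat_le {C₁ : ℝ} (hBE : Γ.WeakBakryEmery C₁ 0)
    (hE : E.IsConservative) {h : Lp ℝ 2 μ} {M : ℝ} (h0 : ∀ᵐ x ∂μ, 0 ≤ h x)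
    (hM : ∀ᵐ x ∂μ, |h x| ≤ M) (s : ℝ≥0) {f g : E.domain} (hg : (g : Lp ℝ 2 μ) = E.heat s f) :
    ∫ x, h x * Γ.toMap g g x ∂μ ≤ C₁ ^ 2 * ∫ x, E.heat s h x * Γ.toMap f f x ∂μ := by
  have hT := hE.isMarkovOperator_heat s
  have h1 := hT.integral_mul_sq_apply_le h0 hM (Γ.sqrtGamma f)
  have h2 : ∫ x, E.heat s h x * Γ.sqrtGamma f x ^ 2 ∂μ =
      ∫ x, E.heat s h x * Γ.toMap f f x ∂μ := by
    refine integral_congr_ae ?_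
    filter_upwards [Γ.sq_sqrtGamma f] with x hx
    rw [hx]
  rw [← h2]
  refine le_trans ?_ (mul_le_mul_of_nonneg_left h1 (sq_nonneg C₁))
  rw [← integral_const_mul]
  have hm := memLp_top_of_abs_le hM
  refine integral_mono_ae (Γ.integrable_mul_gamma hm g) ?_ ?_
  · refine Integrable.const_mul ((integrable_mul_L2 (mulL2 hm (E.heat s (Γ.sqrtGamma f)))
      (E.heat s (Γ.sqrtGamma f))).congr ?_) _
    filter_upwards [coeFn_mulL2 hm (E.heat s (Γ.sqrtGamma f))] with x hx
    rw [hx]; ring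
  · filter_upwards [h0, Γ.sq_sqrtGamma g, Γ.sqrtGamma_nonneg g, hBE f s g hg] with x h3 h4 h5 h6
    rw [zero_mul, Real.exp_zero, mul_one] at h6
    rw [← h4]
    have h7 := mul_le_mul_of_nonneg_left (pow_le_pow_left₀ h5 h6 2) h3
    refine h7.trans (le_of_eq ?_)
    ring

/-- The integrated reverse Poincaré inequality. -/
theorem integral_mul_gamma_heat_le_integral {C₁ : ℝ} (hC : 0 < C₁) (hBE : Γ.WeakBakryEmery C₁ 0)
    (hE : E.IsConservative) {h h' g g' : Lp ℝ 2 μ} (hh : (h, h') ∈ E.generator)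
    (hg : (g, g') ∈ E.generator) (h0 : ∀ᵐ x ∂μ, 0 ≤ h x) {M : ℝ} (hM : ∀ᵐ x ∂μ, |h x| ≤ M)
    (hg1 : ∀ᵐ x ∂μ, |g x| ≤ 1) (t : ℝ≥0) {w : E.domain} (hw : (w : Lp ℝ 2 μ) = E.heat t g) :
    2 * t / C₁ ^ 2 * ∫ x, h x * Γ.toMap w w x ∂μ ≤ ∫ x, h x ∂μ := by
  set c := ∫ x, h x * Γ.toMap w w x ∂μ with hc
  have hP := E.heat_generatedBy
  have hn := E.norm_heat_apply_le
  set a : ℝ → Lp ℝ 2 μ := fun r => E.heat r.toNNReal h with ha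
  set u : ℝ → Lp ℝ 2 μ := fun r => E.heat ((t : ℝ) - r).toNNReal g with hu
  have hac : Continuous a := hP.continuous_apply h
  have huc : Continuous u := (hP.continuous_apply g).comp (continuous_const.sub continuous_id)
  have hu1 : ∀ r, ∀ᵐ x ∂μ, |u r x| ≤ 1 := fun r => (hE.isMarkovOperator_heat _).abs_apply_le hg1
  have haM : ∀ r, ∀ᵐ x ∂μ, |a r x| ≤ M := fun r => (hE.isMarkovOperator_heat _).abs_apply_le hM
  have hum : ∀ r, MemLp (u r) ∞ μ := fun r => memLp_top_of_abs_le (hu1 r)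
  have ham : ∀ r, MemLp (a r) ∞ μ := fun r => memLp_top_of_abs_le (haM r)
  -- The interpolation `F(r) = ∫ P_r h (P_{t-r} g)² dμ`, with `F(0) ≥ 0` and `F(t) ≤ ∫ h dμ`. Its
  -- derivative is `2 ∫ P_r h Γ(P_{t-r} g) dμ`, at least `(2 / C₁²) c`.
  set F : ℝ → ℝ := fun r => inner ℝ (a r) (mulL2 (hum r) (u r)) with hF
  have hFc : Continuous F := hac.inner (continuous_mulL2_self hum hu1 huc)
  have hderiv : ∀ s : ℝ, 0 < s → s < t → ∃ d, HasDerivAt F d s ∧ 2 / C₁ ^ 2 * c ≤ d := by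
    intro s hs hst
    have h1 : HasDerivAt a (E.heat s.toNNReal h') s := hP.hasDerivAt hn hh hs
    have h2 : HasDerivAt u (-(E.heat ((t : ℝ) - s).toNNReal g')) s := by
      have h4 := hP.hasDerivAt hn hg (sub_pos.2 hst)
      have h5 := h4.scomp s ((hasDerivAt_id s).const_sub (t : ℝ))
      rw [neg_one_smul] at h5
      exact h5
    refine ⟨_, hasDerivAt_inner_mulL2_self h1 h2 huc hum hu1 (ham s), ?_⟩
    have h3 := hP.mem_apply hh s.toNNReal
    have h4 := hP.mem_apply hg ((t : ℝ) - s).toNNReal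
    obtain ⟨p, hp⟩ : ∃ p : E.domain, (p : Lp ℝ 2 μ) = a s := ⟨h3.choose, h3.choose_spec.1⟩
    obtain ⟨q, hq⟩ : ∃ q : E.domain, (q : Lp ℝ 2 μ) = u s := ⟨h4.choose, h4.choose_spec.1⟩
    have h5 := haM s
    have h6 := hu1 s
    have h7 := ham s
    have h8 := hum s
    have h9 : inner ℝ (E.heat s.toNNReal h') (mulL2 (hum s) (u s)) +
        2 * inner ℝ (mulL2 (ham s) (u s)) (-(E.heat ((t : ℝ) - s).toNNReal g')) =
        2 * ∫ x, a s x * Γ.toMap q q x ∂μ := by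
      have h3' : (a s, E.heat s.toNNReal h') ∈ E.generator := h3
      have h4' : (u s, E.heat ((t : ℝ) - s).toNNReal g') ∈ E.generator := h4
      generalize hum s = hums
      generalize ham s = hams
      generalize u s = us at *
      generalize a s = as at *
      subst hp hq
      rw [Γ.two_mul_integral_mul_gamma h3' h4' h5 h6 hams hums, inner_neg_right]
      ring
    rw [h9]
    have h10 : (w : Lp ℝ 2 μ) = E.heat s.toNNReal q := by
      have e : t = s.toNNReal + ((t : ℝ) - s).toNNReal := by
        rw [← Real.toNNReal_add hs.le (sub_nonneg.2 hst.le)]; simp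
      rw [hw, hq]
      nth_rewrite 1 [e]
      exact hP.add_apply _ _ _
    have h11 := Γ.integral_mul_gamma_heat_le hBE hE h0 hM s.toNNReal h10
    have h12 : c ≤ C₁ ^ 2 * ∫ x, a s x * Γ.toMap q q x ∂μ := h11
    have h13 : 0 < C₁ ^ 2 := by positivity
    rw [div_mul_eq_mul_div, div_le_iff₀ h13]
    linarith
  have hmono : MonotoneOn (fun r => F r - 2 / C₁ ^ 2 * c * r) (Set.Icc 0 (t : ℝ)) := by
    refine monotoneOn_of_deriv_nonneg (convex_Icc _ _)
      (hFc.sub (continuous_const.mul continuous_id)).continuousOn ?_ ?_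
    · intro s hs
      rw [interior_Icc] at hs
      obtain ⟨d, hd, -⟩ := hderiv s hs.1 hs.2
      exact (hd.sub ((hasDerivAt_id s).const_mul _)).differentiableAt.differentiableWithinAt
    · intro s hs
      rw [interior_Icc] at hs
      obtain ⟨d, hd, hd'⟩ := hderiv s hs.1 hs.2
      have h1 := (hd.sub ((hasDerivAt_id s).const_mul (2 / C₁ ^ 2 * c))).deriv
      have h2 : deriv (fun r => F r - 2 / C₁ ^ 2 * c * r) s = d - 2 / C₁ ^ 2 * c * 1 := h1
      rw [h2]
      linarith
  have h1 := hmono ⟨le_rfl, t.coe_nonneg⟩ ⟨t.coe_nonneg, le_rfl⟩ t.coe_nonneg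
  simp only [mul_zero, sub_zero] at h1
  have hnn : ∀ r, ∀ᵐ x ∂μ, 0 ≤ a r x := fun r => (hE.isMarkovOperator_heat _).apply_nonneg h0
  have h2 : 0 ≤ F 0 := by
    refine inner_nonneg_of_nonneg ((Lp.coeFn_nonneg _).1 (hnn 0)) ((Lp.coeFn_nonneg _).1 ?_)
    filter_upwards [coeFn_mulL2 (hum 0) (u 0)] with x hx
    rw [hx]
    exact mul_self_nonneg _
  have h3 : F t ≤ ∫ x, h x ∂μ := by
    have h4 : ∫ x, a t x ∂μ = ∫ x, h x ∂μ := (hE.isMarkovOperator_heat _).integral_apply h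
    rw [← h4]
    have h5 : F t = ∫ x, a t x * mulL2 (hum t) (u t) x ∂μ := inner_L2_eq _ _
    rw [h5]
    refine integral_mono_ae (integrable_mul_L2 _ _) ((Lp.memLp (a t)).integrable (by norm_num)) ?_
    filter_upwards [hnn t, hu1 t, coeFn_mulL2 (hum t) (u t)] with x h6 h7 h8
    rw [h8]
    refine mul_le_of_le_one_right h6 ?_
    rw [← abs_mul_abs_self]
    exact mul_le_one₀ h7 (abs_nonneg _) h7
  have h4 : 2 * (t : ℝ) / C₁ ^ 2 * c = 2 / C₁ ^ 2 * c * t := by ring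
  rw [h4]
  linarith

/-- The reverse Poincaré inequality. -/
theorem gamma_heat_le {C₁ : ℝ} (hC : 0 < C₁) (hBE : Γ.WeakBakryEmery C₁ 0)
    (hE : E.IsConservative) {g g' : Lp ℝ 2 μ} (hg : (g, g') ∈ E.generator)
    (hg1 : ∀ᵐ x ∂μ, |g x| ≤ 1) {t : ℝ≥0} (ht : 0 < t) {w : E.domain}
    (hw : (w : Lp ℝ 2 μ) = E.heat t g) :
    ∀ᵐ x ∂μ, Γ.toMap w w x ≤ C₁ ^ 2 / (2 * t) := by
  have ht' : (0 : ℝ) < t := ht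
  set K := C₁ ^ 2 / (2 * (t : ℝ)) with hK
  have hint : Integrable (fun x => K - Γ.toMap w w x) μ :=
    (integrable_const K).sub (Γ.integrable w w)
  have h1 : 0 ≤ᵐ[μ] fun x => K - Γ.toMap w w x := by
    refine ae_nonneg_of_forall_setIntegral_nonneg hint fun B hB _ => ?_
    set b : Lp ℝ 2 μ := indicatorConstLp 2 hB (measure_ne_top μ B) (1 : ℝ) with hb
    have hbx : ∀ᵐ x ∂μ, b x = B.indicator (fun _ => (1 : ℝ)) x := indicatorConstLp_coeFn
    have hb0 : ∀ᵐ x ∂μ, 0 ≤ b x := hbx.mono fun x hx => by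
      rw [hx]; exact Set.indicator_nonneg (fun _ _ => zero_le_one) x
    have hb1 : ∀ᵐ x ∂μ, |b x| ≤ 1 := hbx.mono fun x hx => by
      rw [hx]; by_cases h : x ∈ B <;> simp [h]
    -- The indicator of `B` may lie outside the domain of the generator. Its resolvents lie inside,
    -- keep values in `[0, 1]`, and converge almost everywhere along a subsequence.
    have h2 : ∀ n, 0 ≤ ∫ x, E.resolvent n b x * (K - Γ.toMap w w x) ∂μ := by
      intro n
      have hR := hE.isMarkovOperator_resolvent n
      have h3 := Γ.integral_mul_gamma_heat_le_integral hC hBE hE (E.isResolventFamily.mem n b) hg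
        (hR.apply_nonneg hb0) (hR.abs_apply_le hb1) hg1 t hw
      have h4 : ∫ x, E.resolvent n b x * (K - Γ.toMap w w x) ∂μ =
          K * ∫ x, E.resolvent n b x ∂μ - ∫ x, E.resolvent n b x * Γ.toMap w w x ∂μ := by
        rw [← integral_const_mul, ← integral_sub]
        · congr 1; ext x; ring
        · exact ((Lp.memLp (E.resolvent n b)).integrable (by norm_num)).const_mul _
        · exact Γ.integrable_mul_gamma (memLp_top_of_abs_le (hR.abs_apply_le hb1)) w
      rw [h4, sub_nonneg]
      have h5 := mul_le_mul_of_nonneg_left h3 (by positivity : 0 ≤ K)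
      have h6 : K * (2 * t / C₁ ^ 2 * ∫ x, E.resolvent n b x * Γ.toMap w w x ∂μ) =
          ∫ x, E.resolvent n b x * Γ.toMap w w x ∂μ := by
        rw [hK]; field_simp
      rwa [h6] at h5
    have h3 : TendstoInMeasure μ (fun n => (E.resolvent n b : X → ℝ)) atTop b :=
      tendstoInMeasure_of_tendsto_Lp (E.isResolventFamily.tendsto b)
    obtain ⟨ns, -, hns⟩ := h3.exists_seq_tendsto_ae
    have h4 : Tendsto (fun k => ∫ x, E.resolvent (ns k) b x * (K - Γ.toMap w w x) ∂μ) atTop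
        (𝓝 (∫ x, b x * (K - Γ.toMap w w x) ∂μ)) := by
      refine tendsto_integral_of_dominated_convergence (fun x => ‖K - Γ.toMap w w x‖)
        (fun k => (Lp.aestronglyMeasurable _).mul hint.aestronglyMeasurable) hint.norm
        (fun k => ?_) ?_
      · filter_upwards [(hE.isMarkovOperator_resolvent (ns k)).abs_apply_le hb1] with x hx
        rw [norm_mul]
        exact mul_le_of_le_one_left (norm_nonneg _) hx
      · filter_upwards [hns] with x hx
        exact hx.mul_const _
    have h5 := ge_of_tendsto' h4 fun k => h2 (ns k)
    rw [← integral_indicator hB]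
    refine h5.trans (le_of_eq (integral_congr_ae ?_))
    filter_upwards [hbx] with x hx
    rw [hx]
    by_cases h : x ∈ B <;> simp [h]
  filter_upwards [h1] with x hx
  exact sub_nonneg.1 hx

end CarreDuChamp

end DirichletForm

namespace DirichletForm.CarreDuChamp

variable {X : Type*} [MeasurableSpace X] {μ : Measure X} {E : DirichletForm μ}
  (Γ : E.CarreDuChamp)

/-! ### The carré du champ as a seminorm -/

theorem coeFn_add_smul (u v : E.domain) (q : ℝ) :
    ∀ᵐ x ∂μ, Γ.toMap (u + q • v) (u + q • v) x =
      Γ.toMap u u x + 2 * q * Γ.toMap u v x + q ^ 2 * Γ.toMap v v x := by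
  have he : Γ.toMap (u + q • v) (u + q • v) =
      Γ.toMap u u + ((2 * q) • Γ.toMap u v + (q ^ 2) • Γ.toMap v v) := by
    simp only [map_add, map_smul, LinearMap.add_apply, LinearMap.smul_apply, Γ.symm v u]
    module
  rw [he]
  filter_upwards [AEEqFun.coeFn_add (Γ.toMap u u) ((2 * q) • Γ.toMap u v + (q ^ 2) • Γ.toMap v v),
    AEEqFun.coeFn_add ((2 * q) • Γ.toMap u v) ((q ^ 2) • Γ.toMap v v),
    AEEqFun.coeFn_smul (2 * q) (Γ.toMap u v), AEEqFun.coeFn_smul (q ^ 2) (Γ.toMap v v)]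
    with x h1 h2 h3 h4
  rw [h1, Pi.add_apply, h2, Pi.add_apply, h3, h4, Pi.smul_apply, Pi.smul_apply, smul_eq_mul,
    smul_eq_mul, add_assoc]

theorem coeFn_smul_smul (u : E.domain) (c : ℝ) :
    ∀ᵐ x ∂μ, Γ.toMap (c • u) (c • u) x = c ^ 2 * Γ.toMap u u x := by
  have he : Γ.toMap (c • u) (c • u) = (c ^ 2) • Γ.toMap u u := by
    simp only [map_smul, LinearMap.smul_apply, smul_smul, sq]
  rw [he]
  exact AEEqFun.coeFn_smul (c ^ 2) (Γ.toMap u u)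

/-- Fibrewise reverse triangle inequality: `Γ(u + q v) ≥ 0` for all rational `q` at almost every
point gives a nonpositive discriminant, that is, pointwise Cauchy–Schwarz. -/
theorem sq_sqrtGamma_sub_le (u v : E.domain) :
    ∀ᵐ x ∂μ, (Γ.sqrtGamma u x - Γ.sqrtGamma v x) ^ 2 ≤ Γ.toMap (u - v) (u - v) x := by
  filter_upwards [ae_all_iff.2 fun q : ℚ => Γ.coeFn_add_smul u v q,
    ae_all_iff.2 fun q : ℚ => Γ.nonneg (u + (q : ℝ) • v), Γ.nonneg u, Γ.nonneg v,
    Γ.coeFn_sqrtGamma u, Γ.coeFn_sqrtGamma v] with x h1 h2 ha hb h4 h5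
  have hm := h1 (-1)
  rw [show u + ((-1 : ℚ) : ℝ) • v = u - v by push_cast; rw [neg_one_smul, sub_eq_add_neg]] at hm
  rw [hm, h4, h5]
  generalize Γ.toMap u u x = a at *
  generalize Γ.toMap v v x = b at *
  generalize Γ.toMap u v x = m at *
  have hq : ∀ t : ℝ, 0 ≤ b * (t * t) + 2 * m * t + a := by
    intro t
    have hc : IsClosed {t : ℝ | 0 ≤ b * (t * t) + 2 * m * t + a} :=
      isClosed_le continuous_const (by fun_prop)
    have hr : ∀ q : ℚ, (q : ℝ) ∈ {t : ℝ | 0 ≤ b * (t * t) + 2 * m * t + a} := by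
      intro q
      have h := h2 q
      rw [h1 q] at h
      rw [Set.mem_ofPred_eq]
      linarith
    exact hc.closure_subset_iff.2 (Set.range_subset_iff.2 hr) (Rat.denseRange_cast t)
  have hdis := discrim_le_zero hq
  rw [discrim] at hdis
  have hle : m ≤ √a * √b := by
    rw [← Real.sqrt_mul ha]
    exact Real.le_sqrt_of_sq_le (by nlinarith)
  have sa := Real.sq_sqrt ha
  have sb := Real.sq_sqrt hb
  push_cast
  nlinarith

theorem norm_sqrtGamma_sub_sq_le (u v : E.domain) :
    ‖Γ.sqrtGamma u - Γ.sqrtGamma v‖ ^ 2 ≤ ∫ x, Γ.toMap (u - v) (u - v) x ∂μ := by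
  rw [← real_inner_self_eq_norm_sq, inner_L2_eq]
  refine integral_mono_ae (integrable_mul_L2 _ _) (Γ.integrable _ _) ?_
  filter_upwards [Γ.sq_sqrtGamma_sub_le u v, Lp.coeFn_sub (Γ.sqrtGamma u) (Γ.sqrtGamma v)]
    with x h1 h2
  rw [h2, Pi.sub_apply, ← sq]
  exact h1

theorem tendsto_sqrtGamma {u : ℕ → E.domain} {v : E.domain}
    (h : Tendsto (fun n => E.form (u n - v) (u n - v) + ‖(u n : Lp ℝ 2 μ) - v‖ ^ 2) atTop (𝓝 0)) :
    Tendsto (fun n => Γ.sqrtGamma (u n)) atTop (𝓝 (Γ.sqrtGamma v)) := by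
  obtain ⟨C, hC⟩ := Γ.continuous
  rw [tendsto_iff_norm_sub_tendsto_zero]
  have h1 : Tendsto (fun n => ‖Γ.sqrtGamma (u n) - Γ.sqrtGamma v‖ ^ 2) atTop (𝓝 0) := by
    have h2 := h.const_mul C
    rw [mul_zero] at h2
    exact squeeze_zero (fun _ => sq_nonneg _)
      (fun n => (Γ.norm_sqrtGamma_sub_sq_le (u n) v).trans (hC (u n - v))) h2
  simpa [Real.sqrt_sq] using h1.sqrt

/-- The defining formula with `h = 1`, where the term `ℰ(1, uv)` vanishes. -/
theorem integral_toMap [IsProbabilityMeasure μ] (hE : E.IsConservative) {u v : E.domain}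
    (hu : E.IsBdd u) (hv : E.IsBdd v) : ∫ x, Γ.toMap u v x ∂μ = E.form u v := by
  obtain ⟨e, he, h⟩ := hE
  have he' : ∀ᵐ x ∂μ, (e : Lp ℝ 2 μ) x = 1 := by rw [he]; exact coeFn_oneL2
  obtain ⟨p, hp⟩ := E.exists_mul u v hu hv
  have h1 := Γ.formula u v e p u v hu hv ⟨1, he'.mono fun x hx => by rw [hx, abs_one]⟩ hp
    (he'.mono fun x hx => by rw [hx, mul_one]) (he'.mono fun x hx => by rw [hx, mul_one])
  have h2 : ∫ x, (e : Lp ℝ 2 μ) x * Γ.toMap u v x ∂μ = ∫ x, Γ.toMap u v x ∂μ := by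
    refine integral_congr_ae ?_
    filter_upwards [he'] with x hx
    rw [hx, one_mul]
  rw [h2, E.symm e p, h, E.symm v u] at h1
  linarith

/-! ### The exterior derivative -/

variable [MetricSpace X] [CompactSpace X] [BorelSpace X] [IsProbabilityMeasure μ]

omit Γ in
theorem isBdd_coreToDomain (φ : E.core) : E.IsBdd (E.coreToDomain φ) := by
  refine ⟨‖φ.1‖, ?_⟩
  filter_upwards [ContinuousMap.coeFn_toLp (p := 2) (𝕜 := ℝ) μ φ.1] with x hx
  have h1 : ((E.coreToDomain φ : E.domain) : Lp ℝ 2 μ) x = φ.1 x := hx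
  rw [h1]
  exact φ.1.norm_coe_le_norm x

/-- The bounded Borel function `1`. -/
def oneBorel (X : Type*) [MeasurableSpace X] : boundedBorel X :=
  ⟨fun _ => 1, measurable_const, 1, fun _ => by simp⟩

theorem preD_apply (φ : E.core) : Γ.preD φ = (Γ.tmul φ (oneBorel X) : Γ.PreForm) := rfl

theorem coeFn_fiberInner_tmul_one (φ ψ : E.core) :
    ∀ᵐ x ∂μ, Γ.fiberInner (Γ.tmul φ (oneBorel X)) (Γ.tmul ψ (oneBorel X)) x =
      Γ.toMap (E.coreToDomain φ) (E.coreToDomain ψ) x := by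
  filter_upwards [Γ.coeFn_fiberInner_tmul φ ψ (oneBorel X) (oneBorel X)] with x hx
  rw [hx]
  simp [oneBorel]

theorem inner_preD (hE : E.IsConservative) (φ ψ : E.core) :
    inner ℝ (Γ.preD φ) (Γ.preD ψ) = E.form (E.coreToDomain φ) (E.coreToDomain ψ) := by
  rw [preD_apply, preD_apply, UniformSpace.Completion.inner_coe,
    ← Γ.integral_toMap hE (isBdd_coreToDomain φ) (isBdd_coreToDomain ψ)]
  exact integral_congr_ae (Γ.coeFn_fiberInner_tmul_one φ ψ)

theorem norm_preD_sq (hE : E.IsConservative) (φ : E.core) :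
    ‖Γ.preD φ‖ ^ 2 = E.form (E.coreToDomain φ) (E.coreToDomain φ) := by
  rw [← real_inner_self_eq_norm_sq, Γ.inner_preD hE]

theorem fiberNorm_preD (φ : E.core) : Γ.fiberNorm (Γ.preD φ) = Γ.sqrtGamma (E.coreToDomain φ) := by
  rw [preD_apply, fiberNorm_coe]
  apply Lp.ext
  filter_upwards [MemLp.coeFn_toLp (Γ.memLp_preFiberNorm (Γ.tmul φ (oneBorel X))),
    Γ.coeFn_sqrtGamma (E.coreToDomain φ), Γ.coeFn_fiberInner_tmul_one φ φ] with x h1 h2 h3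
  rw [h2, ← h3]
  exact h1

/-- The graph of `f ↦ f ⊗ 1` on `𝒞`. -/
def preGraph : Submodule ℝ (Lp ℝ 2 μ × Γ.OneForm) :=
  LinearMap.range ((E.domain.subtype.comp E.coreToDomain).prod Γ.preD)

theorem cauchySeq_core {φ : ℕ → E.core} (hE : E.IsConservative)
    (h : CauchySeq fun n => Γ.preD (φ n))
    (h' : CauchySeq fun n => (E.coreToDomain (φ n) : Lp ℝ 2 μ)) :
    ∃ v : E.domain, Tendsto (fun n => E.form (E.coreToDomain (φ n) - v) (E.coreToDomain (φ n) - v) +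
      ‖(E.coreToDomain (φ n) : Lp ℝ 2 μ) - v‖ ^ 2) atTop (𝓝 0) := by
  refine E.closed (fun n => E.coreToDomain (φ n)) fun ε hε => ?_
  obtain ⟨N, hN⟩ := Metric.cauchySeq_iff.1 h (√(ε / 2)) (Real.sqrt_pos.2 (by positivity))
  obtain ⟨N', hN'⟩ := Metric.cauchySeq_iff.1 h' (√(ε / 2)) (Real.sqrt_pos.2 (by positivity))
  refine ⟨max N N', fun m hm n hn => ?_⟩
  have h1 := hN m (le_of_max_le_left hm) n (le_of_max_le_left hn)
  have h2 := hN' m (le_of_max_le_right hm) n (le_of_max_le_right hn)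
  rw [dist_eq_norm, Real.lt_sqrt (norm_nonneg _)] at h1 h2
  rw [← map_sub, Γ.norm_preD_sq hE, map_sub] at h1
  linarith

/-- As `‖∂φ‖² = ℰ(φ, φ)`, closability of `∂` is the closedness of the form. It makes the closed
graph single-valued, without which `extDeriv` would not represent it. -/
theorem closable (hE : E.IsConservative) : ∀ p ∈ Γ.preGraph.topologicalClosure, p.1 = 0 →
    p.2 = 0 := by
  rintro ⟨f, η⟩ hp (rfl : f = 0)
  obtain ⟨x, hx, hlim⟩ := mem_closure_iff_seq_limit.1 hp
  choose φ hφ using hx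
  obtain rfl : (fun n => ((E.coreToDomain (φ n) : Lp ℝ 2 μ), Γ.preD (φ n))) = x := funext hφ
  have h1 : Tendsto (fun n => (E.coreToDomain (φ n) : Lp ℝ 2 μ)) atTop (𝓝 0) :=
    (continuous_fst.tendsto _).comp hlim
  have h2 : Tendsto (fun n => Γ.preD (φ n)) atTop (𝓝 η) := (continuous_snd.tendsto _).comp hlim
  obtain ⟨v, hv⟩ := Γ.cauchySeq_core hE h2.cauchySeq h1.cauchySeq
  have h3 : Tendsto (fun n => ‖(E.coreToDomain (φ n) : Lp ℝ 2 μ) - v‖ ^ 2) atTop (𝓝 0) :=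
    squeeze_zero (fun _ => sq_nonneg _) (fun n => le_add_of_nonneg_left (E.nonneg _)) hv
  have h4 : v = 0 := by
    have h5 := ((h1.sub_const (v : Lp ℝ 2 μ)).norm.pow 2)
    have h6 := tendsto_nhds_unique h5 h3
    simpa using h6
  subst h4
  have h5 : Tendsto (fun n => ‖Γ.preD (φ n)‖ ^ 2) atTop (𝓝 0) := by
    refine squeeze_zero (fun _ => sq_nonneg _) (fun n => ?_) hv
    rw [Γ.norm_preD_sq hE, sub_zero]
    exact le_add_of_nonneg_right (sq_nonneg _)
  have h6 := tendsto_nhds_unique (h2.norm.pow 2) h5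
  simpa using h6

omit Γ in
theorem dense_range_core (hreg : E.IsRegular) :
    Dense (Set.range fun φ : E.core => (E.coreToDomain φ : Lp ℝ 2 μ)) := by
  rw [Metric.dense_iff]
  intro f ε hε
  obtain ⟨u, hu, hd⟩ := E.dense.exists_dist_lt f (by positivity : (0 : ℝ) < ε / 2)
  obtain ⟨φ, hφ⟩ := hreg.dense_domain ⟨u, hu⟩ ((ε / 2) ^ 2) (by positivity)
  refine ⟨_, ?_, φ, rfl⟩
  have h1 : ‖u - (E.coreToDomain φ : Lp ℝ 2 μ)‖ < ε / 2 := by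
    refine lt_of_pow_lt_pow_left₀ 2 (by positivity) (lt_of_le_of_lt ?_ hφ)
    exact le_add_of_nonneg_left (E.nonneg _)
  rw [← dist_eq_norm] at h1
  rw [Metric.mem_ball, dist_comm]
  linarith [dist_triangle f u (E.coreToDomain φ : Lp ℝ 2 μ)]

theorem dense_domain_extDeriv (hreg : E.IsRegular) :
    Dense (Γ.extDeriv.domain : Set (Lp ℝ 2 μ)) := by
  refine (dense_range_core hreg).mono ?_
  rintro _ ⟨φ, rfl⟩
  exact ⟨_, Γ.preGraph.le_topologicalClosure ⟨φ, rfl⟩, rfl⟩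

/-- The derivative of an element of the form domain. -/
theorem exists_derivative (hreg : E.IsRegular) (hE : E.IsConservative) (f : E.domain) :
    ∃ η : Γ.OneForm, (∀ ψ : E.core, inner ℝ η (Γ.preD ψ) = E.form f (E.coreToDomain ψ)) ∧
      Γ.fiberNorm η = Γ.sqrtGamma f := by
  choose φ hφ using fun n : ℕ => hreg.dense_domain f (1 / ((n : ℝ) + 1)) (by positivity)
  have h0 : Tendsto (fun n => E.form (E.coreToDomain (φ n) - f) (E.coreToDomain (φ n) - f) +
      ‖(E.coreToDomain (φ n) : Lp ℝ 2 μ) - f‖ ^ 2) atTop (𝓝 0) := by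
    refine squeeze_zero (fun n => add_nonneg (E.nonneg _) (sq_nonneg _)) (fun n => ?_)
      tendsto_one_div_add_atTop_nhds_zero_nat
    rw [norm_sub_rev, ← neg_sub f, map_neg, map_neg, LinearMap.neg_apply, neg_neg]
    exact (hφ n).le
  obtain ⟨u, hu⟩ : ∃ u : ℕ → E.FormSpace 0, u = fun n => E.coreToDomain (φ n) := ⟨_, rfl⟩
  obtain ⟨g, hg⟩ : ∃ g : E.FormSpace 0, g = f := ⟨_, rfl⟩
  have h1 : Tendsto u atTop (𝓝 g) := by
    rw [tendsto_iff_norm_sub_tendsto_zero]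
    have h2 : Tendsto (fun n => ‖u n - g‖ ^ 2) atTop (𝓝 0) := by
      refine h0.congr fun n => ?_
      rw [FormSpace.norm_sq, hu, hg]
      simp only [CharP.cast_eq_zero, zero_add, one_mul]
      rfl
    simpa [Real.sqrt_sq] using h2.sqrt
  have hform : ∀ ψ : E.core, Tendsto (fun n => E.form (E.coreToDomain (φ n)) (E.coreToDomain ψ))
      atTop (𝓝 (E.form f (E.coreToDomain ψ))) := by
    intro ψ
    have h2 : ∀ w y : E.FormSpace 0, FormSpace.bilin E 0 w y =
        inner ℝ w y - inner ℝ (FormSpace.inclL E 0 w) (FormSpace.inclL E 0 y) := by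
      intro w y
      rw [FormSpace.inner_def]
      simp [FormSpace.inclL_apply]
    have h3 : ∀ y : E.FormSpace 0, Tendsto (fun n => FormSpace.bilin E 0 (u n) y) atTop
        (𝓝 (FormSpace.bilin E 0 g y)) := by
      intro y
      simp only [h2]
      exact (h1.inner tendsto_const_nhds).sub
        ((((FormSpace.inclL E 0).continuous.tendsto g).comp h1).inner tendsto_const_nhds)
    have h4 := h3 (E.coreToDomain ψ)
    rw [hu, hg] at h4
    exact h4
  have hc : CauchySeq fun n => Γ.preD (φ n) := by
    rw [Metric.cauchySeq_iff]
    intro ε hε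
    obtain ⟨N, hN⟩ := Metric.cauchySeq_iff.1 h1.cauchySeq ε hε
    refine ⟨N, fun m hm n hn => lt_of_le_of_lt ?_ (hN m hm n hn)⟩
    rw [dist_eq_norm, dist_eq_norm]
    refine le_of_sq_le_sq ?_ (norm_nonneg _)
    rw [← map_sub, Γ.norm_preD_sq hE, map_sub, FormSpace.norm_sq, hu]
    exact le_add_of_nonneg_right (by positivity)
  obtain ⟨η, hη⟩ := cauchySeq_tendsto_of_complete hc
  refine ⟨η, fun ψ => ?_, ?_⟩
  · refine tendsto_nhds_unique (hη.inner tendsto_const_nhds) ((hform ψ).congr fun n => ?_)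
    rw [Γ.inner_preD hE]
  -- Both the fibre norm and `√Γ` are continuous, so their equality on the core survives the limit.
  · have h2 : Tendsto (fun n => Γ.fiberNorm (Γ.preD (φ n))) atTop (𝓝 (Γ.fiberNorm η)) :=
      (UniformSpace.Completion.continuous_extension.tendsto η).comp hη
    simp only [fiberNorm_preD] at h2
    exact tendsto_nhds_unique h2 (Γ.tendsto_sqrtGamma h0)

/-! ### The variation -/

/-- This is `∂* ∂ f = -Δ f`. The adjoint relation holds on the graph over the core by the weak
definition of the generator, and extends to the closure by continuity. -/
theorem mem_codiff (hreg : E.IsRegular) (hE : E.IsConservative) {w : Lp ℝ 2 μ} {f : E.domain}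
    (hf : ((f : Lp ℝ 2 μ), w) ∈ E.generator) {η : Γ.OneForm}
    (hη : ∀ ψ : E.core, inner ℝ η (Γ.preD ψ) = E.form f (E.coreToDomain ψ)) :
    ∃ h : η ∈ Γ.codiff.domain, Γ.codiff ⟨η, h⟩ = -w := by
  obtain ⟨f₁, hf₁, hw⟩ := hf
  obtain rfl : f₁ = f := Subtype.ext hf₁
  have h1 : ∀ p ∈ Γ.preGraph.topologicalClosure, inner ℝ (-w) p.1 = inner ℝ η p.2 := by
    intro p hp
    have hcl : IsClosed {p : Lp ℝ 2 μ × Γ.OneForm | inner ℝ (-w) p.1 = inner ℝ η p.2} :=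
      isClosed_eq (by fun_prop) (by fun_prop)
    refine hcl.closure_subset_iff.2 ?_ hp
    rintro _ ⟨ψ, rfl⟩
    have h2 : inner ℝ (-w) (E.coreToDomain ψ : Lp ℝ 2 μ) = inner ℝ η (Γ.preD ψ) := by
      rw [hη, hw, inner_neg_left]
    exact h2
  have h2 : ∀ x : Γ.extDeriv.domain, inner ℝ (-w) (x : Lp ℝ 2 μ) = inner ℝ η (Γ.extDeriv x) :=
    fun x => h1 _ (Submodule.mem_graph_toLinearPMap (Γ.closable hE) x)
  exact ⟨LinearPMap.mem_adjoint_domain_of_exists _ ⟨_, h2⟩,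
    LinearPMap.adjoint_apply_eq (Γ.dense_domain_extDeriv hreg) _ h2⟩

/-- The form `η = ∂ f` competes in the supremum: its fibre norm is `√Γ(f) ≤ 1` and its
codifferential is `-w`. -/
theorem ofReal_inner_le_variation (hreg : E.IsRegular) (hE : E.IsConservative) {w : Lp ℝ 2 μ}
    {f : E.domain} (hf : ((f : Lp ℝ 2 μ), w) ∈ E.generator) (h1 : ∀ᵐ x ∂μ, Γ.toMap f f x ≤ 1)
    (f₀ : Lp ℝ 2 μ) : ENNReal.ofReal (-inner ℝ f₀ w) ≤ Γ.variation f₀ := by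
  obtain ⟨η, hη, hn⟩ := Γ.exists_derivative hreg hE f
  obtain ⟨hd, hw⟩ := Γ.mem_codiff hreg hE hf hη
  rw [← inner_neg_right, ← hw]
  refine le_iSup₂_of_le (⟨η, hd⟩ : Γ.codiff.domain) ?_ le_rfl
  rw [hn]
  filter_upwards [h1, Γ.coeFn_sqrtGamma f] with x h2 h3
  rw [h3]
  exact Real.sqrt_le_one.2 h2

theorem neg_inner_le_variation (hreg : E.IsRegular) (hE : E.IsConservative) {w : Lp ℝ 2 μ}
    {f : E.domain} (hf : ((f : Lp ℝ 2 μ), w) ∈ E.generator) {K : ℝ} (hK : 0 < K)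
    (h1 : ∀ᵐ x ∂μ, Γ.toMap f f x ≤ K ^ 2) (f₀ : Lp ℝ 2 μ) (hv : Γ.variation f₀ < ∞) :
    -inner ℝ f₀ w ≤ K * (Γ.variation f₀).toReal := by
  have h2 : (((K⁻¹ • f : E.domain) : Lp ℝ 2 μ), K⁻¹ • w) ∈ E.generator := by
    obtain ⟨f₁, hf₁, hw⟩ := hf
    obtain rfl : f₁ = f := Subtype.ext hf₁
    refine ⟨K⁻¹ • f₁, rfl, fun φ => ?_⟩
    rw [map_smul, LinearMap.smul_apply, hw, inner_smul_left, conj_trivial, smul_eq_mul]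
    ring
  have h3 := Γ.ofReal_inner_le_variation hreg hE h2 (by
    filter_upwards [h1, Γ.coeFn_smul_smul f K⁻¹] with x h3 h4
    rw [h4, inv_pow, inv_mul_le_iff₀ (by positivity), mul_one]
    exact h3) f₀
  have h4 := (ENNReal.ofReal_le_iff_le_toReal hv.ne).1 h3
  rw [inner_smul_right] at h4
  have h5 := mul_le_mul_of_nonneg_left h4 hK.le
  have h6 : K * -(K⁻¹ * inner ℝ f₀ w) = -inner ℝ f₀ w := by field_simp
  rwa [h6] at h5

end DirichletForm.CarreDuChamp

theorem one_sub_exp_neg_one_pos : 0 < 1 - Real.exp (-1) := by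
  simp

namespace DirichletForm

variable {X : Type*} [MeasurableSpace X] {μ : Measure X} {E : DirichletForm μ}

/-! ### Exponential decay of the heat semigroup -/

section Decay

variable [IsProbabilityMeasure μ]

omit [IsProbabilityMeasure μ] in
theorem PoincareWith.norm_sq_le {l : ℝ} (hl : 0 < l) (hP : E.PoincareWith l) {f : E.domain}
    (hf : ∫ x, (f : Lp ℝ 2 μ) x ∂μ = 0) : l * ‖(f : Lp ℝ 2 μ)‖ ^ 2 ≤ E.form f f := by
  have h1 := hP f
  rw [hf] at h1
  have h2 : ∫ x, ((f : Lp ℝ 2 μ) x - 0) ^ 2 ∂μ = ‖(f : Lp ℝ 2 μ)‖ ^ 2 := by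
    rw [← real_inner_self_eq_norm_sq, inner_L2_eq]
    congr 1; ext x; ring
  rw [h2, one_div, ← div_eq_inv_mul, le_div_iff₀ hl] at h1
  linarith

/-- The derivative of `e^{2lr} ‖P_r f‖²` is `2 e^{2lr} (l ‖P_r f‖² - ℰ(P_r f, P_r f)) ≤ 0`, because
`P_r` preserves mean zero. -/
theorem PoincareWith.norm_heat_sq_le_of_mem {l : ℝ} (hl : 0 < l) (hP : E.PoincareWith l)
    (hE : E.IsConservative) {f f' : Lp ℝ 2 μ} (hf : (f, f') ∈ E.generator)
    (h0 : ∫ x, f x ∂μ = 0) (t : ℝ≥0) :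
    Real.exp (2 * l * t) * ‖E.heat t f‖ ^ 2 ≤ ‖f‖ ^ 2 := by
  have hG := E.heat_generatedBy
  set v : ℝ → Lp ℝ 2 μ := fun r => E.heat r.toNNReal f with hv
  have hvc : Continuous v := hG.continuous_apply f
  set ψ : ℝ → ℝ := fun r => Real.exp (2 * l * r) * ‖v r‖ ^ 2 with hψ
  have hderiv : ∀ r : ℝ, 0 < r → ∃ d, HasDerivAt ψ d r ∧ d ≤ 0 := by
    intro r hr
    have h1 : HasDerivAt v (E.heat r.toNNReal f') r := hG.hasDerivAt E.norm_heat_apply_le hf hr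
    have h2 : HasDerivAt (fun r : ℝ => Real.exp (2 * l * r)) (Real.exp (2 * l * r) * (2 * l)) r := by
      simpa using ((hasDerivAt_id r).const_mul (2 * l)).exp
    refine ⟨_, h2.mul h1.norm_sq, ?_⟩
    obtain ⟨q, hq, hqE⟩ := hG.mem_apply hf r.toNNReal
    have h3 : inner ℝ (v r) (E.heat r.toNNReal f') = -E.form q q := by
      have h4 := hqE q
      rw [hq] at h4
      rw [h4, real_inner_comm, neg_neg]
    have h5 : l * ‖v r‖ ^ 2 ≤ E.form q q := by
      have h6 := hP.norm_sq_le hl (f := q) (by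
        rw [hq, ← h0]; exact (hE.isMarkovOperator_heat _).integral_apply f)
      rwa [hq] at h6
    rw [h3]
    have h7 := Real.exp_pos (2 * l * r)
    nlinarith
  have hanti : AntitoneOn ψ (Set.Ici 0) := by
    refine antitoneOn_of_deriv_nonpos (convex_Ici _) ?_ ?_ ?_
    · exact (Continuous.mul (by fun_prop) (hvc.norm.pow 2)).continuousOn
    · intro r hr
      rw [interior_Ici] at hr
      obtain ⟨d, hd, -⟩ := hderiv r hr
      exact hd.differentiableAt.differentiableWithinAt
    · intro r hr
      rw [interior_Ici] at hr
      obtain ⟨d, hd, hd'⟩ := hderiv r hr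
      rwa [hd.deriv]
  have h1 := hanti (Set.mem_Ici.2 le_rfl) (Set.mem_Ici.2 t.coe_nonneg) t.coe_nonneg
  simpa [hψ, hv, hG.zero] using h1

theorem PoincareWith.norm_heat_sq_le {l : ℝ} (hl : 0 < l) (hP : E.PoincareWith l)
    (hE : E.IsConservative) {f : Lp ℝ 2 μ} (h0 : ∫ x, f x ∂μ = 0) (t : ℝ≥0) :
    Real.exp (2 * l * t) * ‖E.heat t f‖ ^ 2 ≤ ‖f‖ ^ 2 := by
  have h1 := E.isResolventFamily.tendsto f
  refine le_of_tendsto_of_tendsto'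
    (((((E.heat t).continuous.tendsto f).comp h1).norm.pow 2).const_mul _) (h1.norm.pow 2)
    fun n => ?_
  refine hP.norm_heat_sq_le_of_mem hl hE (E.isResolventFamily.mem n f) ?_ t
  rw [(hE.isMarkovOperator_resolvent n).integral_apply, h0]

end Decay

namespace CarreDuChamp

variable [MetricSpace X] [CompactSpace X] [BorelSpace X] [IsProbabilityMeasure μ]
  (Γ : E.CarreDuChamp)

/-! ### The heat flow and the variation -/

/-- Testing the variation with `∂ P_r g` bounds the derivative of `⟨f₀, P_r g⟩` below by `-C₁ p /
√(2r)`. The singularity at `0` is integrable, with `∫₀ᵗ dr / √(2r) = √(2t)`; in `φ` the bound has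
been integrated beforehand, so continuity at `0` suffices. -/
theorem inner_sub_heat_le_of_mem {C₁ : ℝ} (hC : 0 < C₁) (hBE : Γ.WeakBakryEmery C₁ 0)
    (hreg : E.IsRegular) (hE : E.IsConservative) {g g' : Lp ℝ 2 μ} (hg : (g, g') ∈ E.generator)
    (hg1 : ∀ᵐ x ∂μ, |g x| ≤ 1) {f₀ : Lp ℝ 2 μ} (hv : Γ.variation f₀ < ∞) (t : ℝ≥0) :
    inner ℝ f₀ (g - E.heat t g) ≤ (Γ.variation f₀).toReal * (C₁ * √(2 * t)) := by
  set p := (Γ.variation f₀).toReal with hp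
  have hG := E.heat_generatedBy
  set φ : ℝ → ℝ := fun r => inner ℝ f₀ (E.heat r.toNNReal g) + p * (C₁ * √(2 * r)) with hφ
  have hderiv : ∀ r : ℝ, 0 < r → ∃ d, HasDerivAt φ d r ∧ 0 ≤ d := by
    intro r hr
    have h1 : HasDerivAt (fun r : ℝ => E.heat r.toNNReal g) (E.heat r.toNNReal g') r :=
      hG.hasDerivAt E.norm_heat_apply_le hg hr
    have h2 : HasDerivAt (fun r : ℝ => inner ℝ f₀ (E.heat r.toNNReal g))
        (inner ℝ f₀ (E.heat r.toNNReal g')) r := by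
      simpa using (hasDerivAt_const r f₀).inner ℝ h1
    have h3 : HasDerivAt (fun r : ℝ => √(2 * r)) (2 / (2 * √(2 * r))) r := by
      have := ((hasDerivAt_id r).const_mul 2).sqrt (by simpa using hr.ne')
      simpa using this
    refine ⟨_, h2.add ((h3.const_mul C₁).const_mul p), ?_⟩
    have h4 := hG.mem_apply hg r.toNNReal
    obtain ⟨q, hq⟩ : ∃ q : E.domain, (q : Lp ℝ 2 μ) = E.heat r.toNNReal g :=
      ⟨h4.choose, h4.choose_spec.1⟩
    have hs : 0 < √(2 * r) := Real.sqrt_pos.2 (by positivity)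
    have h5 := Γ.gamma_heat_le hC hBE hE hg hg1 (Real.toNNReal_pos.2 hr) hq
    rw [← hq] at h4
    have h6 := Γ.neg_inner_le_variation hreg hE h4 (K := C₁ / √(2 * r)) (by positivity) (by
      filter_upwards [h5] with x hx
      rwa [div_pow, Real.sq_sqrt (by positivity), ← Real.coe_toNNReal r hr.le]) f₀ hv
    have h7 : p * (C₁ * (2 / (2 * √(2 * r)))) = C₁ / √(2 * r) * p := by
      field_simp
    rw [h7]
    linarith
  have hmono : MonotoneOn φ (Set.Ici 0) := by
    refine monotoneOn_of_deriv_nonneg (convex_Ici _) ?_ ?_ ?_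
    · exact (Continuous.add (continuous_const.inner (hG.continuous_apply g))
        (by fun_prop)).continuousOn
    · intro r hr
      rw [interior_Ici] at hr
      obtain ⟨d, hd, -⟩ := hderiv r hr
      exact hd.differentiableAt.differentiableWithinAt
    · intro r hr
      rw [interior_Ici] at hr
      obtain ⟨d, hd, hd'⟩ := hderiv r hr
      rwa [hd.deriv]
  have h1 := hmono (Set.mem_Ici.2 le_rfl) (Set.mem_Ici.2 t.coe_nonneg) t.coe_nonneg
  simp only [hφ, Real.toNNReal_zero, Real.toNNReal_coe, hG.zero, ContinuousLinearMap.id_apply,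
    mul_zero, Real.sqrt_zero, add_zero] at h1
  rw [inner_sub_right]
  linarith

theorem inner_sub_heat_le {C₁ : ℝ} (hC : 0 < C₁) (hBE : Γ.WeakBakryEmery C₁ 0)
    (hreg : E.IsRegular) (hE : E.IsConservative) {g : Lp ℝ 2 μ}
    (hg1 : ∀ᵐ x ∂μ, |g x| ≤ 1) {f₀ : Lp ℝ 2 μ} (hv : Γ.variation f₀ < ∞) (t : ℝ≥0) :
    inner ℝ f₀ (g - E.heat t g) ≤ (Γ.variation f₀).toReal * (C₁ * √(2 * t)) := by
  have h1 := E.isResolventFamily.tendsto g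
  refine le_of_tendsto ((tendsto_const_nhds (x := f₀)).inner (𝕜 := ℝ)
    (h1.sub (((E.heat t).continuous.tendsto g).comp h1))) (Eventually.of_forall fun n => ?_)
  exact Γ.inner_sub_heat_le_of_mem hC hBE hreg hE (E.isResolventFamily.mem n g)
    ((hE.isMarkovOperator_resolvent n).abs_apply_le hg1) hv t

/-! ### Buser's inequality -/

/-- The test function is `2 · 1_A - 1` rather than `1_A`: it is still bounded by `1`, and since
constants are fixed by the flow it doubles the left side. -/
theorem mul_one_sub_exp_le_perimeter {C₁ l : ℝ} (hC : 0 < C₁) (hBE : Γ.WeakBakryEmery C₁ 0)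
    (hreg : E.IsRegular) (hE : E.IsConservative) (hl : 0 < l) (hP : E.PoincareWith l) {A : Set X}
    (hA : MeasurableSet A) (hp : Γ.perimeter hA < ∞) (t : ℝ≥0) :
    2 * (μ.real A - μ.real A ^ 2) * (1 - Real.exp (-(l * t))) ≤
      (Γ.perimeter hA).toReal * (C₁ * √(2 * t)) := by
  set b : Lp ℝ 2 μ := indicatorConstLp 2 hA (measure_ne_top μ A) (1 : ℝ) with hb
  set m := μ.real A with hm
  have hT := hE.isMarkovOperator_heat t
  have hbx : ∀ᵐ x ∂μ, b x = A.indicator (fun _ => (1 : ℝ)) x := indicatorConstLp_coeFn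
  have hb1 : inner ℝ b (oneL2 μ) = m := by
    rw [inner_oneL2, integral_congr_ae hbx, integral_indicator hA]
    simp [hm]
  have hbb : inner ℝ b b = m := by
    rw [← hb1, inner_oneL2, inner_L2_eq]
    refine integral_congr_ae ?_
    filter_upwards [hbx] with x hx
    rw [hx]
    by_cases h : x ∈ A <;> simp [h]
  have h11 : inner ℝ (oneL2 μ) (oneL2 μ) = (1 : ℝ) := by
    rw [inner_oneL2, integral_congr_ae coeFn_oneL2]
    simp
  have h1b : inner ℝ (oneL2 μ) b = m := by rw [real_inner_comm, hb1]
  have h1 := Γ.inner_sub_heat_le hC hBE hreg hE (g := (2 : ℝ) • b - oneL2 μ) (f₀ := b) (by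
    filter_upwards [hbx, Lp.coeFn_sub ((2 : ℝ) • b) (oneL2 μ), Lp.coeFn_smul (2 : ℝ) b,
      coeFn_oneL2] with x h1 h2 h3 h4
    rw [h2, Pi.sub_apply, h3, Pi.smul_apply, h1, h4, smul_eq_mul]
    by_cases h : x ∈ A <;> norm_num [h]) hp t
  have h2 : (2 : ℝ) • b - oneL2 μ - E.heat t ((2 : ℝ) • b - oneL2 μ) =
      (2 : ℝ) • (b - E.heat t b) := by
    rw [map_sub, map_smul, hT.one]; module
  rw [h2, inner_smul_right, inner_sub_right, hbb] at h1
  -- Splitting `1_A` into its mean and the orthogonal remainder isolates the part that decays.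
  set f := b - m • oneL2 μ with hf
  have h3 : inner ℝ b (E.heat t b) = m ^ 2 + inner ℝ f (E.heat t f) := by
    have h4 : inner ℝ (oneL2 μ) (E.heat t b) = m := by
      rw [← hT.symm, hT.one, h1b]
    rw [hf, map_sub, map_smul, hT.one]
    simp only [inner_sub_left, inner_sub_right, inner_smul_left, inner_smul_right, conj_trivial,
      h4, hb1, h11]
    ring
  have hff : ‖f‖ ^ 2 = m - m ^ 2 := by
    rw [← real_inner_self_eq_norm_sq, hf]
    simp only [inner_sub_left, inner_sub_right, inner_smul_left, inner_smul_right, conj_trivial,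
      hbb, hb1, h1b, h11]
    ring
  have hf0 : ∫ x, f x ∂μ = 0 := by
    rw [← inner_oneL2, hf, inner_sub_left, inner_smul_left, hb1, h11, conj_trivial]
    ring
  -- Halving the time turns the pairing into a squared norm, so the rate `e^{-2l(t/2)}` is exactly
  -- `e^{-lt}`.
  have h5 : inner ℝ f (E.heat t f) = ‖E.heat (t / 2) f‖ ^ 2 := by
    rw [← real_inner_self_eq_norm_sq, (hE.isMarkovOperator_heat (t / 2)).symm,
      ← E.heat_generatedBy.add_apply, add_halves]
  have h6 := hP.norm_heat_sq_le hl hE hf0 (t / 2)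
  have h7 : 2 * l * ((t / 2 : ℝ≥0) : ℝ) = l * t := by push_cast; ring
  rw [h7, ← h5, hff] at h6
  have h8 : inner ℝ f (E.heat t f) ≤ Real.exp (-(l * t)) * (m - m ^ 2) := by
    have h9 := mul_le_mul_of_nonneg_left h6 (Real.exp_pos (-(l * t))).le
    rwa [← mul_assoc, ← Real.exp_add, neg_add_cancel, Real.exp_zero, one_mul] at h9
  have h9 : Γ.perimeter hA = Γ.variation b := rfl
  rw [h9]
  rw [h3] at h1
  linarith

/-- Buser's inequality for one set. The perimeter is tested with the forms `∂ P_s g`, which are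
bounded by the reverse Poincaré inequality; this needs only the weak Bakry–Émery estimate and gives
the constant with `C₁` in place of `C₁ ^ 3`. -/
theorem sqrt_mul_le_perimeter_div {C₁ l : ℝ} (hC : 1 ≤ C₁) (hBE : Γ.WeakBakryEmery C₁ 0)
    (hreg : E.IsRegular) (hE : E.IsConservative) (hl : 0 < l) (hP : E.PoincareWith l) {A : Set X}
    (hA : MeasurableSet A) (hp : Γ.perimeter hA < ∞) (hA0 : 0 < μ A) (hA1 : μ A ≤ 1 / 2) :
    √l * (1 - Real.exp (-1)) / (C₁ ^ 3 * √2) ≤ (Γ.perimeter hA).toReal / μ.real A := by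
  have hC0 : 0 < C₁ := one_pos.trans_le hC
  have hm0 : 0 < μ.real A := ENNReal.toReal_pos hA0.ne' (measure_ne_top μ A)
  have hm1 : μ.real A ≤ 1 / 2 := by
    have := ENNReal.toReal_mono (by simp) hA1
    simpa [Measure.real] using this
  -- The choice `t = 1/l` is where the factor `1 - e⁻¹` comes from.
  have h1 := Γ.mul_one_sub_exp_le_perimeter hC0 hBE hreg hE hl hP hA hp (1 / l).toNNReal
  rw [Real.coe_toNNReal _ (by positivity), mul_one_div_cancel hl.ne'] at h1
  set p := (Γ.perimeter hA).toReal with hpdef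
  have hp0 : 0 ≤ p := ENNReal.toReal_nonneg
  set m := μ.real A with hm
  have he : 0 < 1 - Real.exp (-1) := one_sub_exp_neg_one_pos
  -- The condition `m ≤ 1/2` enters here, through `m ≤ 2 (m - m²)`.
  have h3 : m * (1 - Real.exp (-1)) ≤ 2 * (m - m ^ 2) * (1 - Real.exp (-1)) :=
    mul_le_mul_of_nonneg_right (by nlinarith) he.le
  have hsl : 0 < √l := Real.sqrt_pos.2 hl
  have hs2 : 0 < √(2 : ℝ) := Real.sqrt_pos.2 two_pos
  have h4 : √(2 * (1 / l)) = √2 / √l := by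
    rw [mul_one_div, Real.sqrt_div (by norm_num)]
  have hC3 : C₁ ≤ C₁ ^ 3 := le_self_pow₀ hC (by norm_num)
  rw [div_le_div_iff₀ (by positivity) hm0]
  have h5 : m * (1 - Real.exp (-1)) ≤ p * (C₁ * (√2 / √l)) := by
    rw [← h4]; exact h3.trans h1
  calc √l * (1 - Real.exp (-1)) * m = √l * (m * (1 - Real.exp (-1))) := by ring
    _ ≤ √l * (p * (C₁ * (√2 / √l))) := mul_le_mul_of_nonneg_left h5 hsl.le
    _ = p * (C₁ * √2) := by field_simp
    _ ≤ p * (C₁ ^ 3 * √2) := by gcongr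

end CarreDuChamp

end DirichletForm

end

/-! ### The bound on the spectral gap -/

theorem mainTheorem10 {X : Type*} [MetricSpace X] [CompactSpace X] [MeasurableSpace X]
    [BorelSpace X] (μ : Measure X) [IsProbabilityMeasure μ] [μ.IsOpenPosMeasure]
    (E : DirichletForm μ) (hreg : E.IsRegular) (hloc : E.IsStrictlyLocal) (Γ : E.CarreDuChamp)
    (C₁ : ℝ) (hC₁ : 1 ≤ C₁)
    (hdom : Γ.SemigroupDomination C₁)
    (hBE : Γ.WeakBakryEmery C₁ 0)
    (hgap : E.SpectralGapInequality) :
    E.spectralGap ≤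
      ENNReal.ofReal (2 * C₁ ^ 6 / (1 - Real.exp (-1)) ^ 2) * Γ.cheeger ^ 2 := by
  have hE := DirichletForm.isConservative hreg hloc
  refine iSup_le fun l => iSup₂_le fun hl hP => ?_
  have he : 0 < 1 - Real.exp (-1) := one_sub_exp_neg_one_pos
  have hC0 : 0 < C₁ := one_pos.trans_le hC₁
  -- `k` is the number with `2 C₁⁶ / (1 - e⁻¹)² · k² = l`, so `k ≤ h` is all that is needed for each
  -- admissible `l`. An empty infimum is covered, since `k ≤ ∞`.
  set k := √l * (1 - Real.exp (-1)) / (C₁ ^ 3 * √2) with hk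
  have hk0 : 0 ≤ k := by positivity
  have h1 : ENNReal.ofReal k ≤ Γ.cheeger := by
    refine le_iInf fun A => le_iInf fun hA => le_iInf fun hp => le_iInf fun hA0 =>
      le_iInf fun hA1 => ?_
    have h2 := Γ.sqrt_mul_le_perimeter_div hC₁ hBE hreg hE hl hP hA hp hA0 hA1
    refine (ENNReal.ofReal_le_ofReal h2).trans (le_of_eq ?_)
    rw [Measure.real, ENNReal.ofReal_div_of_pos (ENNReal.toReal_pos hA0.ne' (measure_ne_top μ A)),
      ENNReal.ofReal_toReal hp.ne, ENNReal.ofReal_toReal (measure_ne_top μ A)]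
  calc ENNReal.ofReal l
      = ENNReal.ofReal (2 * C₁ ^ 6 / (1 - Real.exp (-1)) ^ 2) * ENNReal.ofReal k ^ 2 := by
        rw [← ENNReal.ofReal_pow hk0, ← ENNReal.ofReal_mul (by positivity)]
        congr 1
        rw [hk, div_pow, mul_pow, mul_pow, Real.sq_sqrt hl.le, Real.sq_sqrt zero_le_two]
        field_simp
    _ ≤ _ := by gcongr
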